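/- Let $n\ge 4$. **Diagrams.** The standard $n$-box is a rectangle with nodes $1,\dots,n$ on its north face and $1',\dots,n'$ on its south face. An *L-decorated diagram* is an isotopy class of finite families of pairwise disjoint curves (edges) in the box such that every node is the end of exactly one edge and all other edges are closed curves (loops); edges may carry finitely many decorations $\bullet$, such that all decorations can be moved simultaneously along the deformed edges to the left wall of the box without crossing an edge, and such that a diagram without non-propagating edge in the north face carries no decoration. (An edge is propagating if it joins the two faces.) Let $\mathcal P$ be the $\mathbb Z[\delta]$-algebra with basis these diagrams, $d'd$ being obtained by placing $d'$ on top of $d$ and gluing $i'$ of $d'$ to $i$ of $d$. Let $\widehat{\mathcal P}$ be its quotient by the local relations: an undecorated loop equals the factor $\delta$; two decorations on the same edge (or loop) cancel; in the presence of a loop with one decoration every other edge (or loop) loses its decorations. **Algebras.** For $1\le i\le n-1$ let $d_i$ be the undecorated diagram with edges $\{i,i+1\}$, $\{i',(i+1)'\}$ and $\{j,j'\}$ for $j\ne i,i+1$, and let $d_{\bar 1}$ be $d_1$ with one decoration on each of its two non-propagating edges. Let $\mathbb{D}\mathrm{TL}(D_n)$ be the unital $\mathbb Z[\delta]$-subalgebra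 of $\widehat{\mathcal P}$ generated by $d_{\bar 1},d_1,\dots,d_{n-1}$, and let $\mathrm{LFD}(D_n)$ be the quotient of $\mathbb{D}\mathrm{TL}(D_n)$ by the relation that diagrams with a decorated loop are $0$. **Type II diagrams and half-diagrams.** An L-decorated diagram is *$D$-admissible of type II* if it has no loops, every edge has at most one decoration, and the total number of decorations is even. Removing the propagating edges from such a diagram $d$, its upper half is the half-diagram $\overline d$ and its lower half, inverted in a horizontal line, is the half-diagram $\underline d$. The number $\mathbf p(h)$ of propagating edges of a half-diagram $h$ is the number of nodes that are not ends of its edges. **Cell datum.** Let $\Lambda=\{1,3,\dots,n\}$ if $n$ is odd and $\Lambda=\{0^+,0^-,2,4,\dots,n\}$ if $n$ is even, with $|0^\pm|=0$, $|i|=i$ otherwise, and $\lambda<\mu$ if and only if $|\lambda|<|\mu|$. Let $M(\lambda)$ be the set of half-diagrams $h$ arising from $D$-admissible diagrams of type II with $\mathbf p(h)=|\lambda|$, where for $\lambda=0^+$ (respectively $0^-$) the number of decorations of $h$ is required to be even (respectively odd). **Theorem.** Every $D$-admissible diagram of type II lies in $\mathbb{D}\mathrm{TL}(D_n)$. For $\lambda\in\Lambda$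 and $h_1,h_2\in M(\lambda)$ there is exactly one $D$-admissible diagram $h_1\circ h_2$ of type II with upper half-diagram $h_1$ and lower half-diagram $h_2$; let $C(h_1,h_2)=C^\lambda_{h_1,h_2}\in\mathrm{LFD}(D_n)$ be its image. There is a $\mathbb Z[\delta]$-linear map $*$ on $A=\mathrm{LFD}(D_n)$ that sends the image of each $D$-admissible diagram of type II to the image of its top-bottom inversion, and $(\Lambda,M,C,*)$ is a cell datum for $A$ over $\mathbb Z[\delta]$, that is: 1. every $M(\lambda)$ is finite, and $C:\coprod_{\lambda}M(\lambda)\times M(\lambda)\to A$ is injective and its image is a $\mathbb Z[\delta]$-basis of $A$; 2. $*$ is an involutory $\mathbb Z[\delta]$-linear anti-automorphism of $A$ with $(C^\lambda_{S,T})^*=C^\lambda_{T,S}$; 3. for all $a\in A$ and $\lambda\in\Lambda$ there are $r_a(S',S)\in\mathbb Z[\delta]$ ($S,S'\in M(\lambda)$) with $aC^\lambda_{S,T}\equiv\sum_{S'\in M(\lambda)}r_a(S',S)\,C^\lambda_{S',T}$ modulo the span of the $C^\mu_{S'',T''}$ with $\mu<\lambda$, for all $S,T\in M(\lambda)$. 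-/

import Mathlib

/-!
Decorated Temperley--Lieb diagrams of type `D`, the loop-free diagram algebra, and cell data.
-/

namespace LoopFree

/-- A system of decorated arcs on a set `V` of nodes, together with a collection of decorated loops.
`mate v` is the other end of the arc that starts at `v`; `mate v = v` means that no arc ends at `v`.
`deco v` is the number of decorations on the arc ending at `v`.
`loops` has one entry for every loop, namely its number of decorations. -/
@[ext]
structure Arcs (V : Type*) where
  mate : V → V
  deco : V → ℕ
  loops : Multiset ℕ
  mate_mate : ∀ v, mate (mate v) = v
  deco_mate : ∀ v, deco (mate v) = deco v
  deco_free : ∀ v, mate v = v → deco v = 0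

namespace Arcs

variable {V W X : Type*}

/-- `p` and `q` are different nodes, and each is the end of an arc. -/
def Gluable (A : Arcs V) (p q : V) : Prop := p ≠ q ∧ A.mate p ≠ p ∧ A.mate q ≠ q

/-- No arc and no loop carries a decoration. -/
def Undecorated (A : Arcs V) : Prop := (∀ v, A.deco v = 0) ∧ ∀ m ∈ A.loops, m = 0

/-- The disjoint union of two systems. -/
def sum (A : Arcs V) (B : Arcs W) : Arcs (V ⊕ W) where
  mate := Sum.map A.mate B.mate
  deco := Sum.elim A.deco B.deco
  loops := A.loops + B.loops
  mate_mate := by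
    rintro (v | v)
    · simp [A.mate_mate]
    · simp [B.mate_mate]
  deco_mate := by
    rintro (v | v)
    · simp [A.deco_mate]
    · simp [B.deco_mate]
  deco_free := by
    rintro (v | v)
    · simpa using A.deco_free v
    · simpa using B.deco_free v

/-- `B` is the image of `A` under the map `e` of nodes. -/
structure IsPush (e : V → W) (A : Arcs V) (B : Arcs W) : Prop where
  mate : ∀ v, B.mate (e v) = e (A.mate v)
  deco : ∀ v, B.deco (e v) = A.deco v
  free : ∀ w, w ∉ Set.range e → B.mate w = w
  loops : B.loops = A.loops

theorem IsPush.unique {e : V → W} (he : Function.Injective e) {A A' : Arcs V} {B : Arcs W}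
    (h : IsPush e A B) (h' : IsPush e A' B) : A = A' := by
  apply Arcs.ext
  · funext v
    exact he ((h.mate v).symm.trans (h'.mate v))
  · funext v
    exact (h.deco v).symm.trans (h'.deco v)
  · exact h.loops.symm.trans h'.loops

theorem IsPush.eq {e : V → W} {A : Arcs V} {B B' : Arcs W}
    (h : IsPush e A B) (h' : IsPush e A B') : B = B' := by
  have hm : ∀ w, B.mate w = B'.mate w := by
    intro w
    by_cases hw : w ∈ Set.range e
    · obtain ⟨v, rfl⟩ := hw
      rw [h.mate, h'.mate]
    · rw [h.free w hw, h'.free w hw]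
  apply Arcs.ext
  · funext w
    exact hm w
  · funext w
    by_cases hw : w ∈ Set.range e
    · obtain ⟨v, rfl⟩ := hw
      rw [h.deco, h'.deco]
    · rw [B.deco_free w (h.free w hw), B'.deco_free w (h'.free w hw)]
  · exact h.loops.trans h'.loops.symm

theorem IsPush.trans {e : V → W} {f : W → X} {A : Arcs V} {B : Arcs W} {C : Arcs X}
    (h : IsPush e A B) (h' : IsPush f B C) : IsPush (f ∘ e) A C where
  mate v := by simp [h'.mate, h.mate]
  deco v := by simp [h'.deco, h.deco]
  free x hx := by
    by_cases hw : x ∈ Set.range f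
    · obtain ⟨w, rfl⟩ := hw
      rw [h'.mate, h.free]
      rintro ⟨v, rfl⟩
      exact hx ⟨v, rfl⟩
    · exact h'.free x hw
  loops := h'.loops.trans h.loops

theorem IsPush.sum {Y : Type*} {e : V → W} {f : X → Y} {A : Arcs V} {B : Arcs W} {C : Arcs X}
    {D : Arcs Y} (h : IsPush e A B) (h' : IsPush f C D) :
    IsPush (Sum.map e f) (A.sum C) (B.sum D) where
  mate := by
    rintro (v | v)
    · simp [Arcs.sum, h.mate]
    · simp [Arcs.sum, h'.mate]
  deco := by
    rintro (v | v)
    · simp [Arcs.sum, h.deco]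
    · simp [Arcs.sum, h'.deco]
  free := by
    rintro (w | w) hw
    · have : w ∉ Set.range e := by
        rintro ⟨v, rfl⟩
        exact hw ⟨Sum.inl v, rfl⟩
      simp [Arcs.sum, h.free w this]
    · have : w ∉ Set.range f := by
        rintro ⟨v, rfl⟩
        exact hw ⟨Sum.inr v, rfl⟩
      simp [Arcs.sum, h'.free w this]
  loops := by simp [Arcs.sum, h.loops, h'.loops]

theorem IsPush.refl (A : Arcs V) : IsPush id A A where
  mate _ := rfl
  deco _ := rfl
  free w hw := absurd ⟨w, rfl⟩ hw
  loops := rfl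

/-- The nodes being placed on a line at the positions `pos`, the arcs can be drawn in the upper half
plane without crossings. -/
def NonCrossing (pos : V → ℕ) (A : Arcs V) : Prop :=
  ∀ u v, ¬ (pos u < pos v ∧ pos v < pos (A.mate u) ∧ pos (A.mate u) < pos (A.mate v))

/-- Every decorated arc is outermost: there is no other arc above it, so that it bounds the unbounded
region. -/
def Exposed (pos : V → ℕ) (A : Arcs V) : Prop :=
  ∀ v, A.deco v ≠ 0 → ∀ u, ¬ (pos u < pos v ∧ pos v < pos (A.mate u))

theorem NonCrossing.inside {pos : V → ℕ} (hpos : Function.Injective pos) {A : Arcs V}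
    (hA : A.NonCrossing pos) {u w : V} (h1 : pos u < pos w) (h2 : pos w < pos (A.mate u)) :
    pos u < pos (A.mate w) ∧ pos (A.mate w) < pos (A.mate u) := by
  have a1 := hA u w
  have a2 := hA (A.mate w) u
  rw [A.mate_mate] at a2
  have a3 : pos (A.mate w) ≠ pos u := fun h => by
    have := hpos h
    rw [← this, A.mate_mate] at h2
    omega
  have a4 : pos (A.mate w) ≠ pos (A.mate u) := fun h => by
    have := hpos h
    have := congrArg A.mate this
    rw [A.mate_mate, A.mate_mate] at this
    rw [this] at h1
    omega
  omega

theorem NonCrossing.separate {pos : V → ℕ} (hpos : Function.Injective pos) {A : Arcs V} {p q : V}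
    (hadj : ∀ w, A.mate w ≠ w → ¬ (pos p < pos w ∧ pos w < pos q))
    (hpq : pos p < pos q)
    (hA : A.NonCrossing pos) (u : V) (hp : u ≠ p) (hq : u ≠ q) (hp' : A.mate u ≠ p)
    (hq' : A.mate u ≠ q) :
    ((pos u < pos (A.mate p) ∧ pos (A.mate p) < pos (A.mate u)) ↔
      (pos u < pos (A.mate q) ∧ pos (A.mate q) < pos (A.mate u))) := by
  have hm := A.mate_mate
  by_cases hu : pos u < pos (A.mate u)
  · have n1 : pos u ≠ pos p := fun h => hp (hpos h)
    have n2 : pos u ≠ pos q := fun h => hq (hpos h)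
    have n3 : pos (A.mate u) ≠ pos p := fun h => hp' (hpos h)
    have n4 : pos (A.mate u) ≠ pos q := fun h => hq' (hpos h)
    have ne : A.mate u ≠ u := fun h => by rw [h] at hu; omega
    have b1 := hadj u ne
    have b2 := hadj (A.mate u) (by rw [hm]; exact ne.symm)
    have c1 := fun h1 h2 => hA.inside hpos (u := u) (w := p) h1 h2
    have c2 := fun h1 h2 => hA.inside hpos (u := u) (w := q) h1 h2
    have c3 := fun h1 h2 => hA.inside hpos (u := u) (w := A.mate p) h1 h2
    have c4 := fun h1 h2 => hA.inside hpos (u := u) (w := A.mate q) h1 h2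
    rw [hm] at c3 c4
    constructor
    · intro h
      have := c3 h.1 h.2
      exact c2 (by omega) (by omega)
    · intro h
      have := c4 h.1 h.2
      exact c1 (by omega) (by omega)
  · constructor <;> intro h <;> omega

variable [DecidableEq V] [DecidableEq W]

/-- Glue the two nodes `p` and `q`, which disappear. If `p` and `q` are the two ends of one arc,
this arc becomes a loop; otherwise the arc at `p` and the arc at `q` become one arc. Decorations are
kept. (If `p = q`, or if no arc ends at `p` or at `q`, nothing is done.) -/
def glue (A : Arcs V) (p q : V) : Arcs V :=
  if h : p ≠ q ∧ A.mate p ≠ p ∧ A.mate q ≠ q then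
    { mate := fun v => if v = p ∨ v = q then v else if v = A.mate p then A.mate q
        else if v = A.mate q then A.mate p else A.mate v
      deco := fun v => if v = p ∨ v = q then 0
        else if v = A.mate p ∨ v = A.mate q then A.deco p + A.deco q else A.deco v
      loops := if A.mate p = q then A.deco p ::ₘ A.loops else A.loops
      mate_mate := by
        have := A.mate_mate
        intro v
        grind
      deco_mate := by
        have := A.mate_mate
        have := A.deco_mate
        intro v
        grind
      deco_free := by
        have := A.mate_mate
        have := A.deco_mate
        have := A.deco_free
        intro v
        grind }
  else A

theorem glue_mate (A : Arcs V) (p q : V) (h : A.Gluable p q) (v : V) :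
    (A.glue p q).mate v = if v = p ∨ v = q then v else if v = A.mate p then A.mate q
        else if v = A.mate q then A.mate p else A.mate v := by
  unfold Gluable at h
  simp only [glue, dif_pos h]

theorem glue_deco (A : Arcs V) (p q : V) (h : A.Gluable p q) (v : V) :
    (A.glue p q).deco v = if v = p ∨ v = q then 0
        else if v = A.mate p ∨ v = A.mate q then A.deco p + A.deco q else A.deco v := by
  unfold Gluable at h
  simp only [glue, dif_pos h]

theorem glue_loops (A : Arcs V) (p q : V) (h : A.Gluable p q) :
    (A.glue p q).loops = if A.mate p = q then A.deco p ::ₘ A.loops else A.loops := by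
  unfold Gluable at h
  simp only [glue, dif_pos h]

theorem glue_of_not (A : Arcs V) (p q : V) (h : ¬ A.Gluable p q) : A.glue p q = A := by
  unfold Gluable at h
  simp only [glue, dif_neg h]

theorem glue_free (A : Arcs V) (p q v : V) (h : A.Gluable p q) :
    (A.glue p q).mate v = v ↔ (v = p ∨ v = q ∨ A.mate v = v) := by
  rw [glue_mate A p q h]
  have := A.mate_mate
  unfold Gluable at h
  grind

theorem glue_free' (A : Arcs V) (p q v : V) (hp : v ≠ p) (hq : v ≠ q) :
    (A.glue p q).mate v = v ↔ A.mate v = v := by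
  by_cases h : A.Gluable p q
  · rw [glue_free A p q v h]; tauto
  · rw [glue_of_not A p q h]

theorem glue_ok (A : Arcs V) (p q r s : V) (h1 : p ≠ r) (h2 : p ≠ s) (h3 : q ≠ r) (h4 : q ≠ s) :
    (A.glue p q).Gluable r s ↔ A.Gluable r s := by
  simp only [Gluable, ne_eq, glue_free' A p q r h1.symm h3.symm, glue_free' A p q s h2.symm h4.symm]

theorem glue_comm (A : Arcs V) (p q r s : V) (h1 : p ≠ r) (h2 : p ≠ s) (h3 : q ≠ r) (h4 : q ≠ s) :
    (A.glue p q).glue r s = (A.glue r s).glue p q := by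
  have e1 := glue_ok A p q r s h1 h2 h3 h4
  have e2 := glue_ok A r s p q h1.symm h3.symm h2.symm h4.symm
  by_cases h : A.Gluable p q
  · by_cases h' : A.Gluable r s
    · have H := e2.2 h
      have H' := e1.2 h'
      have hm := A.mate_mate
      have hd := A.deco_mate
      have a1 := glue_mate A p q h
      have a2 := glue_mate A r s h'
      have b1 := glue_deco A p q h
      have b2 := glue_deco A r s h'
      have c1 := glue_loops A p q h
      have c2 := glue_loops A r s h'
      unfold Gluable at h h'
      apply Arcs.ext
      · funext v
        rw [glue_mate _ r s H', glue_mate _ p q H, a1 r, a1 s, a1 v, a2 p, a2 q, a2 v]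
        have := hm p
        have := hm q
        have := hm r
        have := hm s
        have := hm v
        clear a1 a2 b1 b2 c1 c2 hd e1 e2 H H' hm
        grind (splits := 30)
      · funext v
        rw [glue_deco _ r s H', glue_deco _ p q H, a1 r, a1 s, a2 p, a2 q, b1 r, b1 s, b1 v,
          b2 p, b2 q, b2 v]
        have := hm p
        have := hm q
        have := hm r
        have := hm s
        have := hm v
        have := hd p
        have := hd q
        have := hd r
        have := hd s
        have := hd v
        clear a1 a2 b1 b2 c1 c2 hd e1 e2 H H' hm
        grind (splits := 30)
      · rw [glue_loops _ r s H', glue_loops _ p q H]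
        have := Multiset.cons_swap (A.deco p) (A.deco r) A.loops
        by_cases i1 : A.mate p = q <;> by_cases i2 : A.mate r = s <;>
          by_cases i3 : (A.glue p q).mate r = s <;> by_cases i4 : (A.glue r s).mate p = q <;>
          simp only [i1, i2, i3, i4, if_true, if_false, c1, c2] <;> grind
    · rw [glue_of_not A r s h', glue_of_not _ r s (by rwa [e1])]
  · rw [glue_of_not A p q h, glue_of_not _ p q (by rwa [e2])]

theorem glue_keep (A : Arcs V) (p q v : V) (h1 : v ≠ p) (h2 : v ≠ q) (h3 : A.mate v ≠ p)
    (h4 : A.mate v ≠ q) : (A.glue p q).mate v = A.mate v := by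
  by_cases h : A.Gluable p q
  · rw [glue_mate A p q h]
    have := A.mate_mate v
    have := A.mate_mate p
    have := A.mate_mate q
    grind
  · rw [glue_of_not A p q h]

theorem glue_undecorated (A : Arcs V) (p q : V) (hA : A.Undecorated) :
    (A.glue p q).Undecorated := by
  by_cases h : A.Gluable p q
  · obtain ⟨h1, h2⟩ := hA
    refine ⟨fun v => ?_, fun m hm => ?_⟩
    · rw [glue_deco A p q h]; simp [h1]
    · rw [glue_loops A p q h] at hm
      split_ifs at hm
      · rcases Multiset.mem_cons.1 hm with rfl | hm
        · exact h1 p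
        · exact h2 m hm
      · exact h2 m hm
  · rwa [glue_of_not A p q h]

/-- Glue all the pairs of a list. -/
def glueList (A : Arcs V) (l : List (V × V)) : Arcs V :=
  l.foldl (fun B e => B.glue e.1 e.2) A

@[simp] theorem glueList_nil (A : Arcs V) : A.glueList [] = A := rfl

@[simp] theorem glueList_cons (A : Arcs V) (e : V × V) (l : List (V × V)) :
    A.glueList (e :: l) = (A.glue e.1 e.2).glueList l := rfl

theorem glueList_glue (A : Arcs V) (p q : V) (l : List (V × V))
    (h : ∀ e ∈ l, p ≠ e.1 ∧ p ≠ e.2 ∧ q ≠ e.1 ∧ q ≠ e.2) :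
    (A.glue p q).glueList l = (A.glueList l).glue p q := by
  induction l generalizing A with
  | nil => rfl
  | cons e l ih =>
    have h' := h e (by simp)
    rw [glueList_cons, glueList_cons, glue_comm A p q e.1 e.2 h'.1 h'.2.1 h'.2.2.1 h'.2.2.2]
    exact ih _ (fun e' he' => h e' (by simp [he']))

theorem glueList_comm (A : Arcs V) (l m : List (V × V))
    (h : ∀ e ∈ l, ∀ f ∈ m, e.1 ≠ f.1 ∧ e.1 ≠ f.2 ∧ e.2 ≠ f.1 ∧ e.2 ≠ f.2) :
    (A.glueList l).glueList m = (A.glueList m).glueList l := by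
  induction l generalizing A with
  | nil => rfl
  | cons e l ih =>
    rw [glueList_cons, glueList_cons, ih _ (fun e' he' => h e' (by simp [he'])),
      glueList_glue A e.1 e.2 m (h e (by simp))]

theorem glueList_undecorated (A : Arcs V) (l : List (V × V)) (hA : A.Undecorated) :
    (A.glueList l).Undecorated := by
  induction l generalizing A with
  | nil => exact hA
  | cons e l ih => exact ih _ (glue_undecorated A _ _ hA)

theorem glueList_keep (A : Arcs V) (l : List (V × V)) (v : V)
    (h : ∀ e ∈ l, v ≠ e.1 ∧ v ≠ e.2 ∧ A.mate v ≠ e.1 ∧ A.mate v ≠ e.2) :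
    (A.glueList l).mate v = A.mate v := by
  induction l generalizing A with
  | nil => rfl
  | cons e l ih =>
    have h' := h e (by simp)
    have k := glue_keep A e.1 e.2 v h'.1 h'.2.1 h'.2.2.1 h'.2.2.2
    rw [glueList_cons, ih, k]
    intro e' he'
    rw [k]
    exact h e' (by simp [he'])

theorem IsPush.glue {e : V → W} (he : Function.Injective e) {A : Arcs V} {B : Arcs W}
    (h : IsPush e A B) (p q : V) : IsPush e (A.glue p q) (B.glue (e p) (e q)) := by
  have hok : B.Gluable (e p) (e q) ↔ A.Gluable p q := by
    simp [Gluable, h.mate, he.eq_iff]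
  by_cases hA : A.Gluable p q
  · have hB := hok.2 hA
    constructor
    · intro v
      rw [glue_mate B _ _ hB, glue_mate A _ _ hA]
      simp only [h.mate, he.eq_iff]
      split_ifs <;> rfl
    · intro v
      rw [glue_deco B _ _ hB, glue_deco A _ _ hA]
      simp only [h.mate, h.deco, he.eq_iff]
    · intro w hw
      rw [glue_free B _ _ _ hB]
      exact Or.inr (Or.inr (h.free w hw))
    · rw [glue_loops B _ _ hB, glue_loops A _ _ hA]
      simp only [h.mate, h.deco, he.eq_iff, h.loops]
  · rw [glue_of_not A _ _ hA, glue_of_not B _ _ (by rwa [hok])]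
    exact h

theorem IsPush.glueList {e : V → W} (he : Function.Injective e) {A : Arcs V} {B : Arcs W}
    (h : IsPush e A B) (l : List (V × V)) :
    IsPush e (A.glueList l) (B.glueList (l.map (Prod.map e e))) := by
  induction l generalizing A B with
  | nil => exact h
  | cons x l ih => exact ih (h.glue he x.1 x.2)

theorem glue_sum (A : Arcs V) (C : Arcs W) (p q : V) :
    (A.glue p q).sum C = (A.sum C).glue (Sum.inl p) (Sum.inl q) := by
  have hok : (A.sum C).Gluable (Sum.inl p) (Sum.inl q) ↔ A.Gluable p q := by
    simp [Gluable, Arcs.sum]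
  by_cases hA : A.Gluable p q
  · have hB := hok.2 hA
    apply Arcs.ext
    · funext v
      rw [glue_mate _ _ _ hB]
      rcases v with v | v
      · simp only [Arcs.sum, Sum.map_inl, glue_mate A _ _ hA, Sum.inl.injEq]
        split_ifs <;> rfl
      · simp [Arcs.sum]
    · funext v
      rw [glue_deco _ _ _ hB]
      rcases v with v | v
      · simp [Arcs.sum, glue_deco A _ _ hA]
      · simp [Arcs.sum]
    · rw [glue_loops _ _ _ hB]
      simp only [Arcs.sum, Sum.map_inl, glue_loops A _ _ hA, Sum.inl.injEq]
      split_ifs <;> simp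
  · rw [glue_of_not A _ _ hA, glue_of_not _ _ _ (by rwa [hok])]

theorem sum_glue (C : Arcs W) (A : Arcs V) (p q : V) :
    C.sum (A.glue p q) = (C.sum A).glue (Sum.inr p) (Sum.inr q) := by
  have hok : (C.sum A).Gluable (Sum.inr p) (Sum.inr q) ↔ A.Gluable p q := by
    simp [Gluable, Arcs.sum]
  by_cases hA : A.Gluable p q
  · have hB := hok.2 hA
    apply Arcs.ext
    · funext v
      rw [glue_mate _ _ _ hB]
      rcases v with v | v
      · simp [Arcs.sum]
      · simp only [Arcs.sum, Sum.map_inr, glue_mate A _ _ hA, Sum.inr.injEq]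
        split_ifs <;> rfl
    · funext v
      rw [glue_deco _ _ _ hB]
      rcases v with v | v
      · simp [Arcs.sum]
      · simp [Arcs.sum, glue_deco A _ _ hA]
    · rw [glue_loops _ _ _ hB]
      simp only [Arcs.sum, Sum.map_inr, glue_loops A _ _ hA, Sum.inr.injEq]
      split_ifs <;> simp
  · rw [glue_of_not A _ _ hA, glue_of_not _ _ _ (by rwa [hok])]

theorem glueList_sum (A : Arcs V) (C : Arcs W) (l : List (V × V)) :
    (A.glueList l).sum C = (A.sum C).glueList (l.map (Prod.map Sum.inl Sum.inl)) := by
  induction l generalizing A with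
  | nil => rfl
  | cons x l ih => rw [glueList_cons, ih, glue_sum]; rfl

theorem sum_glueList (C : Arcs W) (A : Arcs V) (l : List (V × V)) :
    C.sum (A.glueList l) = (C.sum A).glueList (l.map (Prod.map Sum.inr Sum.inr)) := by
  induction l generalizing A with
  | nil => rfl
  | cons x l ih => rw [glueList_cons, ih, sum_glue]; rfl

theorem glue_nonCrossing {pos : V → ℕ} (hpos : Function.Injective pos) {A : Arcs V} {p q : V}
    (hadj : ∀ w, A.mate w ≠ w → ¬ (pos p < pos w ∧ pos w < pos q))
    (hpq : pos p < pos q)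
    (hA : A.NonCrossing pos) : (A.glue p q).NonCrossing pos := by
  by_cases h : A.Gluable p q
  · have hm := A.mate_mate
    have key := hA.separate hpos hadj hpq
    have g := glue_mate A p q h
    have other : ∀ u, u ≠ p → u ≠ q → u ≠ A.mate p → u ≠ A.mate q →
        (A.glue p q).mate u = A.mate u ∧ A.mate u ≠ p ∧ A.mate u ≠ q := by
      intro u h1 h2 h3 h4
      have := hm u
      grind
    intro u v hc
    by_cases u1 : u = p ∨ u = q
    · rw [g u, if_pos u1] at hc
      omega
    by_cases v1 : v = p ∨ v = q
    · rw [g v, if_pos v1] at hc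
      omega
    push Not at u1 v1
    by_cases u2 : u = A.mate p ∨ u = A.mate q
    · by_cases v2 : v = A.mate p ∨ v = A.mate q
      · have gu := g u
        have gv := g v
        have := hm p
        have := hm q
        grind
      · push Not at v2
        obtain ⟨o1, o2, o3⟩ := other v v1.1 v1.2 v2.1 v2.2
        have := key v v1.1 v1.2 o2 o3
        have gu := g u
        grind
    · push Not at u2
      obtain ⟨o1, o2, o3⟩ := other u u1.1 u1.2 u2.1 u2.2
      by_cases v2 : v = A.mate p ∨ v = A.mate q
      · have := key u u1.1 u1.2 o2 o3
        have gv := g v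
        grind
      · push Not at v2
        obtain ⟨p1, -, -⟩ := other v v1.1 v1.2 v2.1 v2.2
        rw [o1, p1] at hc
        exact hA u v hc
  · rwa [glue_of_not A p q h]

theorem glue_exposed {pos : V → ℕ} (hpos : Function.Injective pos) {A : Arcs V} {p q : V}
    (hadj : ∀ w, A.mate w ≠ w → ¬ (pos p < pos w ∧ pos w < pos q))
    (hpq : pos p < pos q)
    (hA : A.NonCrossing pos) (hE : A.Exposed pos) : (A.glue p q).Exposed pos := by
  by_cases h : A.Gluable p q
  · have hm := A.mate_mate
    have hd := A.deco_mate
    have key := hA.separate hpos hadj hpq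
    have g := glue_mate A p q h
    have other : ∀ u, u ≠ p → u ≠ q → u ≠ A.mate p → u ≠ A.mate q →
        (A.glue p q).mate u = A.mate u ∧ A.mate u ≠ p ∧ A.mate u ≠ q := by
      intro u h1 h2 h3 h4
      have := hm u
      grind
    intro v hv u hc
    rw [glue_deco A p q h] at hv
    by_cases v1 : v = p ∨ v = q
    · simp [v1] at hv
    rw [if_neg v1] at hv
    push Not at v1
    by_cases u1 : u = p ∨ u = q
    · rw [g u, if_pos u1] at hc
      omega
    push Not at u1
    by_cases v2 : v = A.mate p ∨ v = A.mate q
    · rw [if_pos v2] at hv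
      by_cases u2 : u = A.mate p ∨ u = A.mate q
      · have gu := g u
        have := hm p
        have := hm q
        grind
      · push Not at u2
        obtain ⟨o1, o2, o3⟩ := other u u1.1 u1.2 u2.1 u2.2
        rw [o1] at hc
        have k := key u u1.1 u1.2 o2 o3
        have e1 := hE (A.mate p)
        have e2 := hE (A.mate q)
        rw [hd] at e1 e2
        have k1 : pos u < pos (A.mate p) ∧ pos (A.mate p) < pos (A.mate u) := by
          rcases v2 with rfl | rfl
          · exact hc
          · exact k.2 hc
        by_cases z : A.deco p = 0
        · exact e2 (by omega) u (k.1 k1)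
        · exact e1 z u k1
    · rw [if_neg v2] at hv
      have E := hE v hv
      push Not at v2
      by_cases u2 : u = A.mate p ∨ u = A.mate q
      · have e1 := E p
        have e2 := E q
        have e3 := E (A.mate p)
        have e4 := E (A.mate q)
        rw [hm] at e3 e4
        have n1 : pos v ≠ pos p := fun h => v1.1 (hpos h)
        have n2 : pos v ≠ pos q := fun h => v1.2 (hpos h)
        have b : A.mate v ≠ v := fun z => hv (A.deco_free v z)
        have b1 := hadj v b
        have gu := g u
        have n3 : pos v ≠ pos (A.mate p) := fun h => v2.1 (hpos h)
        have n4 : pos v ≠ pos (A.mate q) := fun h => v2.2 (hpos h)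
        have := hm p
        have := hm q
        grind
      · push Not at u2
        obtain ⟨o1, -, -⟩ := other u u1.1 u1.2 u2.1 u2.2
        rw [o1] at hc
        exact E u hc
  · rwa [glue_of_not A p q h]
end Arcs

theorem Arcs.glue_symm {V : Type*} [DecidableEq V] (A : Arcs V) (p q : V) :
    A.glue p q = A.glue q p := by
  have hok : A.Gluable q p ↔ A.Gluable p q := by unfold Arcs.Gluable; tauto
  have hm := A.mate_mate
  have hd := A.deco_mate
  by_cases h : A.Gluable p q
  · have h' := hok.2 h
    apply Arcs.ext
    · funext v
      rw [Arcs.glue_mate A p q h, Arcs.glue_mate A q p h']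
      have := hm p
      have := hm q
      grind
    · funext v
      rw [Arcs.glue_deco A p q h, Arcs.glue_deco A q p h']
      grind
    · rw [Arcs.glue_loops A p q h, Arcs.glue_loops A q p h']
      have := hm p
      have := hm q
      have := hd p
      grind
  · rw [Arcs.glue_of_not A p q h, Arcs.glue_of_not A q p (by rwa [hok])]

/-- Gluing an undecorated strand from `p` to `r` onto the node `ρ c` just renames that node. -/
theorem Arcs.glue_strand {U V : Type*} [DecidableEq U] [DecidableEq V] (d : Arcs U) (A : Arcs V)
    (ρ : U → V) (c : U) (p r : V) (hc : d.mate c ≠ c) (hρ : Function.Injective ρ) (hpr : r ≠ p)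
    (h1 : ∀ u, ρ u ≠ p) (h2 : ∀ u, ρ u ≠ r) (hp : A.mate p = r) (hdp : A.deco p = 0)
    (hm : ∀ u, A.mate (ρ u) = ρ (d.mate u)) (hd : ∀ u, A.deco (ρ u) = d.deco u) :
    (∀ u, (A.glue p (ρ c)).mate (Function.update ρ c r u) = Function.update ρ c r (d.mate u)) ∧
    (∀ u, (A.glue p (ρ c)).deco (Function.update ρ c r u) = d.deco u) ∧
    (A.glue p (ρ c)).loops = A.loops := by
  have hok : A.Gluable p (ρ c) := by
    refine ⟨(h1 c).symm, by rw [hp]; exact hpr, ?_⟩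
    rw [hm]
    exact fun h => hc (hρ h)
  have i : ∀ a b, ρ a = ρ b ↔ a = b := fun a b => hρ.eq_iff
  have dm := d.mate_mate
  have dd := d.deco_mate
  refine ⟨fun u => ?_, fun u => ?_, ?_⟩
  · rw [Arcs.glue_mate A p _ hok, hp, hm]
    by_cases hu : u = c
    · subst hu
      simp [hpr, (h2 u).symm, hc]
    · rw [Function.update_of_ne hu]
      by_cases hu' : u = d.mate c
      · subst hu'
        simp [h1, h2, i, hc, dm]
      · have : d.mate u ≠ c := fun h => hu' (by rw [← h, dm])
        simp [h1, h2, i, hu, hu', this, hm]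
  · rw [Arcs.glue_deco A p _ hok, hp, hm, hdp, hd]
    by_cases hu : u = c
    · subst hu
      simp [hpr, (h2 u).symm]
    · rw [Function.update_of_ne hu]
      by_cases hu' : u = d.mate c
      · subst hu'
        simp [h1, i, hc, dd]
      · simp [h1, h2, i, hu, hu', hd]
  · rw [Arcs.glue_loops A p _ hok, hp, if_neg (h2 c).symm]

/-- The nodes of the standard `k`-box: `Sum.inl i` is the node `i + 1` of the north face, `Sum.inr i`
the node `(i + 1)'` of the south face. -/
abbrev Node (k : ℕ) : Type := Fin k ⊕ Fin k

/-- The order of the nodes along the boundary of the box, starting at the top of the left wall and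
running clockwise: `1, ..., k, k', ..., 1'`. The left wall lies between the last node and the first,
so in a drawing in the half plane the region at the left wall is the unbounded one. -/
def pos {k : ℕ} : Node k → ℕ :=
  Sum.elim (fun i => (i : ℕ)) (fun i => 2 * k - 1 - (i : ℕ))

@[simp] theorem pos_inl {k : ℕ} (i : Fin k) : pos (Sum.inl i : Node k) = i := rfl

@[simp] theorem pos_inr {k : ℕ} (i : Fin k) : pos (Sum.inr i : Node k) = 2 * k - 1 - i := rfl

theorem pos_injective {k : ℕ} : Function.Injective (pos : Node k → ℕ) := by
  rintro (i | i) (j | j) h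
  · simp at h; rw [Fin.ext h]
  · simp at h; omega
  · simp at h; omega
  · simp at h; rw [Fin.ext (by omega : (i : ℕ) = j)]

/-- An L-decorated pseudo `k`-diagram up to isotopy: every node is the end of exactly one edge, the
edges do not cross, decorated edges are exposed to the left wall, and a diagram without non-propagating
edges in the north face is undecorated. Loops are recorded only by their numbers of decorations;
decorated loops necessarily lie in the region at the left wall, and where the undecorated ones lie is
irrelevant as soon as each of them is replaced by `δ`. -/
structure LDiagram (k : ℕ) extends Arcs (Node k) where
  no_free : ∀ v, mate v ≠ v
  planar : toArcs.NonCrossing pos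
  exposed : toArcs.Exposed pos
  undecorated : (∀ i j, mate (Sum.inl i) ≠ Sum.inl j) → toArcs.Undecorated

namespace LDiagram

variable {k : ℕ}

theorem ext_arcs {d e : LDiagram k} (h : d.toArcs = e.toArcs) : d = e := by
  cases d; cases e; cases h; rfl

/-- When one diagram is put on top of another, the node `i'` of the upper diagram (the first
component) is glued to the node `i` of the lower one (the second component). -/
def seam (k : ℕ) (i : Fin k) : (Node k ⊕ Node k) × (Node k ⊕ Node k) :=
  (Sum.inl (Sum.inr i), Sum.inr (Sum.inl i))

/-- Put `A` on top of `B` and glue. -/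
def stack (A B : Arcs (Node k)) : Arcs (Node k ⊕ Node k) :=
  (A.sum B).glueList ((List.finRange k).map (seam k))

/-- The nodes of the stacked box: north face of the upper box, south face of the lower box. -/
def outer : Node k → Node k ⊕ Node k := Sum.map Sum.inl Sum.inr

theorem outer_injective : Function.Injective (outer (k := k)) :=
  Sum.map_injective.2 ⟨Sum.inl_injective, Sum.inr_injective⟩

/-- The positions of the nodes of two boxes, the second box to the right of the first. -/
def pos2 : Node k ⊕ Node k → ℕ := Sum.elim pos (fun v => 2 * k + pos v)

theorem pos_lt (v : Node k) : pos v < 2 * k := by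
  rcases v with i | i
  · simp; omega
  · simp; omega

theorem pos2_injective : Function.Injective (pos2 (k := k)) := by
  rintro (v | v) (w | w) h
  · rw [pos_injective h]
  · have := pos_lt v
    simp [pos2] at h; omega
  · have := pos_lt w
    simp [pos2] at h; omega
  · simp [pos2] at h; rw [pos_injective h]

theorem pos2_outer (v w : Node k) : pos2 (outer v) < pos2 (outer w) ↔ pos v < pos w := by
  rcases v with i | i <;> rcases w with j | j <;> simp [pos2, outer] <;> omega

theorem glueList_seams (l : List (Fin k)) (hl : l.Pairwise (· < ·)) (A : Arcs (Node k ⊕ Node k))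
    (h1 : ∀ j, A.mate (seam k j).1 = (seam k j).1 ↔ j ∉ l)
    (h2 : ∀ j, A.mate (seam k j).2 = (seam k j).2 ↔ j ∉ l)
    (hA : A.NonCrossing pos2) (hE : A.Exposed pos2) :
    (A.glueList (l.map (seam k))).NonCrossing pos2 ∧ (A.glueList (l.map (seam k))).Exposed pos2 ∧
    ∀ j, (A.glueList (l.map (seam k))).mate (seam k j).1 = (seam k j).1 ∧
      (A.glueList (l.map (seam k))).mate (seam k j).2 = (seam k j).2 := by
  induction l generalizing A with
  | nil => exact ⟨hA, hE, fun j => ⟨(h1 j).2 (by simp), (h2 j).2 (by simp)⟩⟩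
  | cons i l ih =>
    rw [List.pairwise_cons] at hl
    have hi : i ∉ l := fun h => lt_irrefl _ (hl.1 i h)
    have hok : A.Gluable (seam k i).1 (seam k i).2 := by
      refine ⟨by simp [seam], ?_, ?_⟩
      · rw [Ne, h1]; simp
      · rw [Ne, h2]; simp
    have hlt : pos2 (seam k i).1 < pos2 (seam k i).2 := by
      simp [pos2, seam]; omega
    have hadj : ∀ w, A.mate w ≠ w → ¬ (pos2 (seam k i).1 < pos2 w ∧ pos2 w < pos2 (seam k i).2) := by
      rintro ((j | j) | (j | j)) hw hc
      · simp [pos2, seam] at hc; omega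
      · have : j ∈ i :: l := by
          by_contra h
          exact hw ((h1 j).2 h)
        rcases List.mem_cons.1 this with rfl | h
        · simp [pos2, seam] at hc
        · have := hl.1 j h
          simp [pos2, seam] at hc
          omega
      · have : j ∈ i :: l := by
          by_contra h
          exact hw ((h2 j).2 h)
        rcases List.mem_cons.1 this with rfl | h
        · simp [pos2, seam] at hc
        · have := hl.1 j h
          simp [pos2, seam] at hc
          omega
      · simp [pos2, seam] at hc; omega
    refine ih hl.2 (A.glue (seam k i).1 (seam k i).2) ?_ ?_
      (Arcs.glue_nonCrossing pos2_injective hadj hlt hA)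
      (Arcs.glue_exposed pos2_injective hadj hlt hA hE)
    · intro j
      rw [Arcs.glue_free _ _ _ _ hok, h1]
      by_cases hj : j = i
      · subst hj; simp [hi]
      · simp [seam, hj]
    · intro j
      rw [Arcs.glue_free _ _ _ _ hok, h2]
      by_cases hj : j = i
      · subst hj; simp [hi]
      · simp [seam, hj]

theorem sum_nonCrossing (d e : LDiagram k) : (d.toArcs.sum e.toArcs).NonCrossing pos2 := by
  rintro (u | u) (v | v) h
  · exact d.planar u v h
  · have := pos_lt (d.mate u)
    simp [Arcs.sum, pos2] at h; omega
  · have := pos_lt v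
    simp [Arcs.sum, pos2] at h; omega
  · simp [Arcs.sum, pos2] at h
    exact e.planar u v h

theorem sum_exposed (d e : LDiagram k) : (d.toArcs.sum e.toArcs).Exposed pos2 := by
  rintro (v | v) hv (u | u) h
  · exact d.exposed v hv u h
  · have := pos_lt v
    simp [Arcs.sum, pos2] at h; omega
  · have := pos_lt (d.mate u)
    simp [Arcs.sum, pos2] at h; omega
  · simp [Arcs.sum, pos2] at h
    exact e.exposed v hv u h

theorem stack_spec (d e : LDiagram k) :
    (stack d.toArcs e.toArcs).NonCrossing pos2 ∧ (stack d.toArcs e.toArcs).Exposed pos2 ∧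
    ∀ j, (stack d.toArcs e.toArcs).mate (seam k j).1 = (seam k j).1 ∧
      (stack d.toArcs e.toArcs).mate (seam k j).2 = (seam k j).2 := by
  refine glueList_seams (List.finRange k) (List.pairwise_lt_finRange k) (d.toArcs.sum e.toArcs)
    ?_ ?_ (sum_nonCrossing d e) (sum_exposed d e)
  · intro j
    simp [seam, Arcs.sum, d.no_free]
  · intro j
    simp [seam, Arcs.sum, e.no_free]

theorem stack_outer (d e : LDiagram k) (v : Node k) :
    outer (Sum.elim id id ((stack d.toArcs e.toArcs).mate (outer v))) =
      (stack d.toArcs e.toArcs).mate (outer v) := by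
  have h := (stack_spec d e).2.2
  have hm := (stack d.toArcs e.toArcs).mate_mate (outer v)
  rcases hw : (stack d.toArcs e.toArcs).mate (outer v) with (i | i) | (i | i)
  · rfl
  · exfalso
    rw [hw] at hm
    have := (h i).1
    rw [seam, hm] at this
    rcases v with v | v <;> simp [outer] at this
  · exfalso
    rw [hw] at hm
    have := (h i).2
    rw [seam, hm] at this
    rcases v with v | v <;> simp [outer] at this
  · rfl

theorem glueList_free' {V : Type*} [DecidableEq V] (A : Arcs V) (l : List (V × V)) (v : V)
    (h : ∀ e ∈ l, v ≠ e.1 ∧ v ≠ e.2) : (A.glueList l).mate v = v ↔ A.mate v = v := by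
  induction l generalizing A with
  | nil => rfl
  | cons e l ih =>
    have h' := h e (by simp)
    rw [Arcs.glueList_cons, ih _ (fun e' he' => h e' (by simp [he'])),
      Arcs.glue_free' A _ _ _ h'.1 h'.2]

theorem stack_no_free (d e : LDiagram k) (v : Node k) :
    (stack d.toArcs e.toArcs).mate (outer v) ≠ outer v := by
  rw [Ne, stack, glueList_free']
  · rcases v with v | v
    · simp [outer, Arcs.sum, d.no_free]
    · simp [outer, Arcs.sum, e.no_free]
  · rintro x hx
    obtain ⟨i, -, rfl⟩ := List.mem_map.1 hx
    rcases v with v | v <;> simp [outer, seam]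

/-- Concatenation: `d` on top of `e`. -/
def mulArcs (d e : LDiagram k) : Arcs (Node k) where
  mate v := Sum.elim id id ((stack d.toArcs e.toArcs).mate (outer v))
  deco v := (stack d.toArcs e.toArcs).deco (outer v)
  loops := (stack d.toArcs e.toArcs).loops
  mate_mate v := by
    rw [stack_outer, Arcs.mate_mate]
    rcases v with v | v <;> rfl
  deco_mate v := by rw [stack_outer, Arcs.deco_mate]
  deco_free v hv := by
    refine absurd ?_ (stack_no_free d e v)
    rw [← stack_outer, hv]

theorem mulArcs_isPush (d e : LDiagram k) :
    Arcs.IsPush outer (mulArcs d e) (stack d.toArcs e.toArcs) where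
  mate v := (stack_outer d e v).symm
  deco _ := rfl
  free := by
    have h := (stack_spec d e).2.2
    rintro ((i | i) | (i | i)) hw
    · exact absurd ⟨Sum.inl i, rfl⟩ hw
    · exact (h i).1
    · exact (h i).2
    · exact absurd ⟨Sum.inr i, rfl⟩ hw
  loops := rfl

theorem no_south_of_no_north {A : Arcs (Node k)} (hA : ∀ i j, A.mate (Sum.inl i) ≠ Sum.inl j)
    (i j : Fin k) : A.mate (Sum.inr i) ≠ Sum.inr j := by
  have h : ∀ i, ∃ j, A.mate (Sum.inl i) = Sum.inr j := by
    intro i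
    rcases h : A.mate (Sum.inl i) with j | j
    · exact absurd h (hA i j)
    · exact ⟨j, rfl⟩
  choose f hf using h
  have finj : Function.Injective f := by
    intro a b hab
    have : A.mate (Sum.inl a) = A.mate (Sum.inl b) := by rw [hf, hf, hab]
    have := congrArg A.mate this
    rw [A.mate_mate, A.mate_mate] at this
    exact Sum.inl_injective this
  obtain ⟨a, rfl⟩ := (Finite.injective_iff_surjective.1 finj) i
  rw [← hf, A.mate_mate]
  simp

theorem no_north_of_no_south {A : Arcs (Node k)} (hA : ∀ i j, A.mate (Sum.inr i) ≠ Sum.inr j)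
    (i j : Fin k) : A.mate (Sum.inl i) ≠ Sum.inl j := by
  have h : ∀ i, ∃ j, A.mate (Sum.inr i) = Sum.inl j := by
    intro i
    rcases h : A.mate (Sum.inr i) with j | j
    · exact ⟨j, rfl⟩
    · exact absurd h (hA i j)
  choose f hf using h
  have finj : Function.Injective f := by
    intro a b hab
    have : A.mate (Sum.inr a) = A.mate (Sum.inr b) := by rw [hf, hf, hab]
    have := congrArg A.mate this
    rw [A.mate_mate, A.mate_mate] at this
    exact Sum.inr_injective this
  obtain ⟨a, rfl⟩ := (Finite.injective_iff_surjective.1 finj) i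
  rw [← hf, A.mate_mate]
  simp

theorem mulArcs_undecorated (d e : LDiagram k)
    (h : ∀ i j, (mulArcs d e).mate (Sum.inl i) ≠ Sum.inl j) : (mulArcs d e).Undecorated := by
  have hs := no_south_of_no_north h
  have hd : d.toArcs.Undecorated := by
    refine d.undecorated fun i j hij => h i j ?_
    apply outer_injective
    rw [← (mulArcs_isPush d e).mate, stack, Arcs.glueList_keep]
    · simp [Arcs.sum, outer, hij]
    · rintro x hx
      obtain ⟨i, -, rfl⟩ := List.mem_map.1 hx
      simp [outer, seam, Arcs.sum, hij]
  have he : e.toArcs.Undecorated := by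
    refine e.undecorated (no_north_of_no_south fun i j hij => hs i j ?_)
    apply outer_injective
    rw [← (mulArcs_isPush d e).mate, stack, Arcs.glueList_keep]
    · simp [Arcs.sum, outer, hij]
    · rintro x hx
      obtain ⟨i, -, rfl⟩ := List.mem_map.1 hx
      simp [outer, seam, Arcs.sum, hij]
  have hsum : (d.toArcs.sum e.toArcs).Undecorated := by
    refine ⟨?_, ?_⟩
    · rintro (v | v)
      · exact hd.1 v
      · exact he.1 v
    · intro m hm
      rcases Multiset.mem_add.1 hm with hm | hm
      · exact hd.2 m hm
      · exact he.2 m hm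
  have := Arcs.glueList_undecorated _ ((List.finRange k).map (seam k)) hsum
  exact ⟨fun v => this.1 (outer v), this.2⟩

instance : Mul (LDiagram k) where
  mul d e :=
    { toArcs := mulArcs d e
      no_free := fun v hv => stack_no_free d e v (by rw [(mulArcs_isPush d e).mate, hv])
      planar := fun u v h => (stack_spec d e).1 (outer u) (outer v) (by
        simpa only [(mulArcs_isPush d e).mate, pos2_outer] using h)
      exposed := fun v hv u h => (stack_spec d e).2.1 (outer v) hv (outer u) (by
        simpa only [(mulArcs_isPush d e).mate, pos2_outer] using h)
      undecorated := mulArcs_undecorated d e }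

theorem mul_isPush (d e : LDiagram k) :
    Arcs.IsPush outer (d * e).toArcs (stack d.toArcs e.toArcs) := mulArcs_isPush d e

instance : One (LDiagram k) where
  one :=
    { mate := Sum.swap
      deco := fun _ => 0
      loops := 0
      mate_mate := Sum.swap_swap
      deco_mate := fun _ => rfl
      deco_free := fun _ _ => rfl
      no_free := by rintro (v | v) <;> simp
      planar := by
        rintro (u | u) (v | v) h <;> simp at h <;> omega
      exposed := fun _ h => absurd rfl h
      undecorated := fun _ => ⟨fun _ => rfl, by simp⟩ }

theorem assoc_aux (d e f : LDiagram k) : d * e * f = d * (e * f) := by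
  apply ext_arcs
  let L1 := (List.finRange k).map (seam k)
  have a1 := mul_isPush (d * e) f
  have a2 := ((mul_isPush d e).sum (Arcs.IsPush.refl f.toArcs)).glueList
    (Sum.map_injective.2 ⟨outer_injective, Function.injective_id⟩) L1
  have a3 := a1.trans a2
  rw [stack, Arcs.glueList_sum] at a3
  have b1 := mul_isPush d (e * f)
  have b2 := ((Arcs.IsPush.refl d.toArcs).sum (mul_isPush e f)).glueList
    (Sum.map_injective.2 ⟨Function.injective_id, outer_injective⟩) L1
  have b3 := b1.trans b2
  rw [stack, Arcs.sum_glueList] at b3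
  have c : Arcs.IsPush (Equiv.sumAssoc (Node k) (Node k) (Node k))
      ((d.toArcs.sum e.toArcs).sum f.toArcs) (d.toArcs.sum (e.toArcs.sum f.toArcs)) := by
    refine ⟨?_, ?_, ?_, ?_⟩
    · rintro ((v | v) | v) <;> simp [Arcs.sum]
    · rintro ((v | v) | v) <;> simp [Arcs.sum]
    · intro w hw
      exact absurd ((Equiv.sumAssoc (Node k) (Node k) (Node k)).surjective w) hw
    · simp [Arcs.sum, add_assoc]
  have c1 := (c.glueList (Equiv.injective _) (L1.map (Prod.map Sum.inl Sum.inl))).glueList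
    (Equiv.injective _) (L1.map (Prod.map (Sum.map outer id) (Sum.map outer id)))
  have a4 := a3.trans c1
  rw [Arcs.glueList_comm] at b3
  · have e1 : (L1.map (Prod.map (Sum.inr : _ → Node k ⊕ (Node k ⊕ Node k)) Sum.inr)) =
        (L1.map (Prod.map (Sum.map outer id) (Sum.map outer id))).map
          (Prod.map (Equiv.sumAssoc (Node k) (Node k) (Node k))
            (Equiv.sumAssoc (Node k) (Node k) (Node k))) := by
      simp [L1, seam, outer]
    have e2 : (L1.map (Prod.map (Sum.map id outer) (Sum.map id outer))) =
        (L1.map (Prod.map Sum.inl Sum.inl)).map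
          (Prod.map (Equiv.sumAssoc (Node k) (Node k) (Node k))
            (Equiv.sumAssoc (Node k) (Node k) (Node k))) := by
      simp [L1, seam, outer]
    rw [show (List.map (seam k) (List.finRange k)) = L1 from rfl, e1, e2] at b3
    have e3 : (Equiv.sumAssoc (Node k) (Node k) (Node k)) ∘ (Sum.map outer id) ∘ outer =
        (Sum.map id outer : Node k ⊕ Node k → Node k ⊕ (Node k ⊕ Node k)) ∘ outer := by
      funext v
      rcases v with v | v <;> rfl
    rw [← e3] at b3
    refine Arcs.IsPush.unique ?_ a4 b3
    exact (Equiv.injective _).comp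
      ((Sum.map_injective.2 ⟨outer_injective, Function.injective_id⟩).comp outer_injective)
  · intro x hx y hy
    simp only [L1, List.mem_map, exists_exists_and_eq_and] at hx hy
    obtain ⟨i, -, rfl⟩ := hx
    obtain ⟨j, -, rfl⟩ := hy
    simp [seam, outer]


theorem one_mul_aux (d : LDiagram k) (l : List (Fin k)) (hl : l.Nodup)
    (A : Arcs (Node k ⊕ Node k)) (ρ : Node k → Node k ⊕ Node k)
    (hρ : ∀ v, ρ v = if ∃ i ∈ l, v = Sum.inl i then Sum.inr v else outer v)
    (hm : ∀ u, A.mate (ρ u) = ρ (d.mate u)) (hd : ∀ u, A.deco (ρ u) = d.deco u)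
    (hs : ∀ i ∈ l, A.mate (Sum.inl (Sum.inr i)) = Sum.inl (Sum.inl i) ∧
      A.deco (Sum.inl (Sum.inr i)) = 0)
    (hf : ∀ i ∉ l, A.mate (seam k i).1 = (seam k i).1 ∧ A.mate (seam k i).2 = (seam k i).2)
    (hL : A.loops = d.loops) :
    Arcs.IsPush outer d.toArcs (A.glueList (l.map (seam k))) := by
  induction l generalizing A ρ with
  | nil =>
    have : ρ = outer := by funext v; simp [hρ]
    subst this
    refine ⟨hm, hd, ?_, hL⟩
    rintro ((i | i) | (i | i)) hw
    · exact absurd ⟨Sum.inl i, rfl⟩ hw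
    · exact (hf i (by simp)).1
    · exact (hf i (by simp)).2
    · exact absurd ⟨Sum.inr i, rfl⟩ hw
  | cons i l ih =>
    rw [List.nodup_cons] at hl
    have hq : (seam k i).2 = ρ (Sum.inl i) := by
      rw [hρ, if_pos ⟨i, by simp, rfl⟩]; rfl
    have inj : Function.Injective ρ := by
      refine Function.LeftInverse.injective (g := Sum.elim id id) fun v => ?_
      rw [hρ]
      split_ifs
      · rfl
      · rcases v with v | v <;> rfl
    have n1 : ∀ j u, ρ u ≠ Sum.inl (Sum.inr j) := by
      rintro j (a | a) <;> rw [hρ] <;> split_ifs <;> simp [outer]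
    have n2 : ∀ u, ρ u ≠ Sum.inl (Sum.inl i) := by
      intro u hu
      by_cases h : ∃ j ∈ i :: l, u = Sum.inl j
      · rw [hρ, if_pos h] at hu
        obtain ⟨j, -, rfl⟩ := h
        simp at hu
      · rw [hρ, if_neg h] at hu
        have : u = Sum.inl i := outer_injective (hu.trans rfl)
        exact h ⟨i, by simp, this⟩
    obtain ⟨h1, h2, h3⟩ := Arcs.glue_strand d.toArcs A ρ (Sum.inl i) (seam k i).1
      (Sum.inl (Sum.inl i)) (d.no_free _) inj (by simp [seam]) (n1 i) n2 (hs i (by simp)).1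
      (hs i (by simp)).2 hm hd
    rw [← hq] at h1 h2 h3
    have hok : A.Gluable (seam k i).1 (seam k i).2 := by
      refine ⟨by simp [seam], ?_, ?_⟩
      · rw [seam, (hs i (by simp)).1]; simp
      · rw [hq, hm]
        exact fun h => d.no_free _ (inj h)
    refine ih hl.2 _ (Function.update ρ (Sum.inl i) (Sum.inl (Sum.inl i))) ?_ h1 h2 ?_ ?_
      (h3.trans hL)
    · intro v
      by_cases hv : v = Sum.inl i
      · subst hv
        simp [hl.1, outer]
      · rw [Function.update_of_ne hv, hρ]
        simp [hv]
    · intro j hj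
      have hji : j ≠ i := fun h => hl.1 (h ▸ hj)
      have hj' := hs j (by simp [hj])
      have nz : Sum.inl (Sum.inr j) ≠ A.mate (seam k i).2 := by
        rw [hq, hm]
        exact (n1 j _).symm
      constructor
      · rw [Arcs.glue_keep, hj'.1]
        · simp [seam, hji]
        · simp [seam]
        · rw [hj'.1]; simp [seam]
        · rw [hj'.1]; simp [seam]
      · rw [Arcs.glue_deco _ _ _ hok, if_neg (by simp [seam, hji]), if_neg, hj'.2]
        rintro (h | h)
        · rw [seam, (hs i (by simp)).1] at h
          simp at h
        · exact nz h
    · intro j hj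
      rw [Arcs.glue_free _ _ _ _ hok, Arcs.glue_free _ _ _ _ hok]
      by_cases hji : j = i
      · subst hji; simp
      · have := hf j (by simp [hji, hj])
        simp [this]

theorem mul_one_aux (d : LDiagram k) (l : List (Fin k)) (hl : l.Nodup)
    (A : Arcs (Node k ⊕ Node k)) (ρ : Node k → Node k ⊕ Node k)
    (hρ : ∀ v, ρ v = if ∃ i ∈ l, v = Sum.inr i then Sum.inl v else outer v)
    (hm : ∀ u, A.mate (ρ u) = ρ (d.mate u)) (hd : ∀ u, A.deco (ρ u) = d.deco u)
    (hs : ∀ i ∈ l, A.mate (Sum.inr (Sum.inl i)) = Sum.inr (Sum.inr i) ∧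
      A.deco (Sum.inr (Sum.inl i)) = 0)
    (hf : ∀ i ∉ l, A.mate (seam k i).1 = (seam k i).1 ∧ A.mate (seam k i).2 = (seam k i).2)
    (hL : A.loops = d.loops) :
    Arcs.IsPush outer d.toArcs (A.glueList (l.map (seam k))) := by
  induction l generalizing A ρ with
  | nil =>
    have : ρ = outer := by funext v; simp [hρ]
    subst this
    refine ⟨hm, hd, ?_, hL⟩
    rintro ((i | i) | (i | i)) hw
    · exact absurd ⟨Sum.inl i, rfl⟩ hw
    · exact (hf i (by simp)).1
    · exact (hf i (by simp)).2
    · exact absurd ⟨Sum.inr i, rfl⟩ hw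
  | cons i l ih =>
    rw [List.nodup_cons] at hl
    have hq : (seam k i).1 = ρ (Sum.inr i) := by
      rw [hρ, if_pos ⟨i, by simp, rfl⟩]; rfl
    have inj : Function.Injective ρ := by
      refine Function.LeftInverse.injective (g := Sum.elim id id) fun v => ?_
      rw [hρ]
      split_ifs
      · rfl
      · rcases v with v | v <;> rfl
    have n1 : ∀ j u, ρ u ≠ Sum.inr (Sum.inl j) := by
      rintro j (a | a) <;> rw [hρ] <;> split_ifs <;> simp [outer]
    have n2 : ∀ u, ρ u ≠ Sum.inr (Sum.inr i) := by
      intro u hu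
      by_cases h : ∃ j ∈ i :: l, u = Sum.inr j
      · rw [hρ, if_pos h] at hu
        obtain ⟨j, -, rfl⟩ := h
        simp at hu
      · rw [hρ, if_neg h] at hu
        have : u = Sum.inr i := outer_injective (hu.trans rfl)
        exact h ⟨i, by simp, this⟩
    obtain ⟨h1, h2, h3⟩ := Arcs.glue_strand d.toArcs A ρ (Sum.inr i) (seam k i).2
      (Sum.inr (Sum.inr i)) (d.no_free _) inj (by simp [seam]) (n1 i) n2 (hs i (by simp)).1
      (hs i (by simp)).2 hm hd
    rw [← hq, Arcs.glue_symm] at h1 h2 h3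
    have hok : A.Gluable (seam k i).1 (seam k i).2 := by
      refine ⟨by simp [seam], ?_, ?_⟩
      · rw [hq, hm]
        exact fun h => d.no_free _ (inj h)
      · rw [seam, (hs i (by simp)).1]; simp
    refine ih hl.2 _ (Function.update ρ (Sum.inr i) (Sum.inr (Sum.inr i))) ?_ h1 h2 ?_ ?_
      (h3.trans hL)
    · intro v
      by_cases hv : v = Sum.inr i
      · subst hv
        simp [hl.1, outer]
      · rw [Function.update_of_ne hv, hρ]
        simp [hv]
    · intro j hj
      have hji : j ≠ i := fun h => hl.1 (h ▸ hj)
      have hj' := hs j (by simp [hj])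
      have nz : Sum.inr (Sum.inl j) ≠ A.mate (seam k i).1 := by
        rw [hq, hm]
        exact (n1 j _).symm
      constructor
      · rw [Arcs.glue_keep, hj'.1]
        · simp [seam]
        · simp [seam, hji]
        · rw [hj'.1]; simp [seam]
        · rw [hj'.1]; simp [seam]
      · rw [Arcs.glue_deco _ _ _ hok, if_neg (by simp [seam, hji]), if_neg, hj'.2]
        rintro (h | h)
        · exact nz h
        · rw [seam, (hs i (by simp)).1] at h
          simp at h
    · intro j hj
      rw [Arcs.glue_free _ _ _ _ hok, Arcs.glue_free _ _ _ _ hok]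
      by_cases hji : j = i
      · subst hji; simp
      · have := hf j (by simp [hji, hj])
        simp [this]

instance : Monoid (LDiagram k) where
  mul_assoc := assoc_aux
  one_mul d := by
    apply ext_arcs
    refine Arcs.IsPush.unique outer_injective (mul_isPush 1 d) ?_
    refine one_mul_aux d (List.finRange k) (List.nodup_finRange k) _ Sum.inr ?_ ?_ ?_ ?_ ?_ ?_
    · rintro (i | i) <;> simp [outer]
    · intro u; rfl
    · intro u; rfl
    · intro i _; exact ⟨rfl, rfl⟩
    · intro i hi; simp at hi
    · exact zero_add _
  mul_one d := by
    apply ext_arcs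
    refine Arcs.IsPush.unique outer_injective (mul_isPush d 1) ?_
    refine mul_one_aux d (List.finRange k) (List.nodup_finRange k) _ Sum.inl ?_ ?_ ?_ ?_ ?_ ?_
    · rintro (i | i) <;> simp [outer]
    · intro u; rfl
    · intro u; rfl
    · intro i _; exact ⟨rfl, rfl⟩
    · intro i hi; simp at hi
    · exact add_zero _

/-- Top-bottom inversion. -/
def flip (d : LDiagram k) : LDiagram k where
  mate v := (d.mate v.swap).swap
  deco v := d.deco v.swap
  loops := d.loops
  mate_mate v := by simp [d.mate_mate]
  deco_mate v := by simp [d.deco_mate]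
  deco_free v hv := d.deco_free _ (by rw [← Sum.swap_swap (d.mate _), hv])
  no_free v hv := d.no_free v.swap (by rw [← Sum.swap_swap (d.mate _), hv])
  planar := by
    have hp : ∀ v : Node k, pos v.swap = 2 * k - 1 - pos v := by
      rintro (i | i) <;> simp
      omega
    intro u v h
    have a1 := pos_lt u
    have a2 := pos_lt v
    have a3 := pos_lt (d.mate u.swap)
    have a4 := pos_lt (d.mate v.swap)
    have := d.planar (d.mate v.swap) (d.mate u.swap)
    rw [d.mate_mate, d.mate_mate] at this
    simp only [hp] at h this
    omega
  exposed := by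
    have hp : ∀ v : Node k, pos v.swap = 2 * k - 1 - pos v := by
      rintro (i | i) <;> simp
      omega
    intro v hv u h
    have a1 := pos_lt u
    have a2 := pos_lt v
    have a3 := pos_lt (d.mate u.swap)
    have := d.exposed v.swap hv (d.mate u.swap)
    rw [d.mate_mate] at this
    simp only [hp] at h this
    omega
  undecorated h := by
    have hd : d.toArcs.Undecorated := d.undecorated (no_north_of_no_south fun i j hij => h i j (by
      simp [hij]))
    exact ⟨fun v => hd.1 v.swap, hd.2⟩

/-- The diagram with an edge joining the nodes `i + 1` and `i + 2` of the north face, an edge joining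
the nodes `(i + 1)'` and `(i + 2)'` of the south face, each with `m` decorations, and vertical
undecorated edges elsewhere. -/
def cupCap (i : ℕ) (hi : i + 1 < k) (m : ℕ) (hm : m ≠ 0 → i = 0) : LDiagram k where
  mate := Sum.elim
    (fun j : Fin k => if (j : ℕ) = i then Sum.inl ⟨i + 1, hi⟩ else
      if (j : ℕ) = i + 1 then Sum.inl ⟨i, by omega⟩ else Sum.inr j)
    (fun j : Fin k => if (j : ℕ) = i then Sum.inr ⟨i + 1, hi⟩ else
      if (j : ℕ) = i + 1 then Sum.inr ⟨i, by omega⟩ else Sum.inl j)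
  deco := Sum.elim
    (fun j : Fin k => if (j : ℕ) = i ∨ (j : ℕ) = i + 1 then m else 0)
    (fun j : Fin k => if (j : ℕ) = i ∨ (j : ℕ) = i + 1 then m else 0)
  loops := 0
  mate_mate := by
    rintro (j | j) <;> simp only [Sum.elim_inl, Sum.elim_inr] <;> split_ifs <;>
      simp_all [Fin.ext_iff]
  deco_mate := by
    rintro (j | j) <;> simp only [Sum.elim_inl, Sum.elim_inr] <;> split_ifs <;> simp_all
  deco_free := by
    rintro (j | j) <;> simp only [Sum.elim_inl, Sum.elim_inr] <;> split_ifs <;>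
      simp_all [Fin.ext_iff]
  no_free := by
    rintro (j | j) <;> simp only [Sum.elim_inl, Sum.elim_inr] <;> split_ifs <;>
      simp_all [Fin.ext_iff]
  planar := by
    rintro (u | u) (v | v) h <;> simp only [Sum.elim_inl, Sum.elim_inr] at h <;>
      split_ifs at h <;> simp at h <;> omega
  exposed := by
    rintro (v | v) hv (u | u) h <;> simp only [Sum.elim_inl, Sum.elim_inr] at h hv <;>
      split_ifs at h hv <;> simp at h hv <;> have := hm hv <;> omega
  undecorated h := absurd (by simp) (h ⟨i, by omega⟩ ⟨i + 1, hi⟩)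

/-- `d_{i+1}`, for `i + 1 < n`: the simple diagrams `d_1, ..., d_{n-1}`. -/
def simple (i : ℕ) (hi : i + 1 < k) : LDiagram k := cupCap i hi 0 (by simp)

/-- `d_{1bar}`: as `d_1`, with one decoration on each of the two non-propagating edges. -/
def simpleBar (h : 0 + 1 < k) : LDiagram k := cupCap 0 h 1 (by simp)

end LDiagram

open Polynomial

/-- The algebra with basis the L-decorated pseudo `k`-diagrams over `ℤ[δ]`; the indeterminate of
`ℤ[X]` is `δ`. -/
abbrev PL (k : ℕ) : Type := MonoidAlgebra ℤ[X] (LDiagram k)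

/-- `d` as an element of `PL k`. -/
noncomputable def PL.of {k : ℕ} (d : LDiagram k) : PL k := MonoidAlgebra.of ℤ[X] (LDiagram k) d

/-- The decorations of `d` with `m` more of them on the edge ending at `v`. -/
def LDiagram.decoAdd {k : ℕ} (d : LDiagram k) (v : Node k) (m : ℕ) : Node k → ℕ :=
  fun u => if u = v ∨ u = d.mate v then d.deco u + m else d.deco u

/-- The local relations. -/
inductive LocalRel (k : ℕ) : PL k → PL k → Prop
  /-- An undecorated loop is replaced by the factor `δ`. -/
  | loop (d d' : LDiagram k) : d'.mate = d.mate → d'.deco = d.deco →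
      d'.loops = 0 ::ₘ d.loops → LocalRel k (PL.of d') ((X : ℤ[X]) • PL.of d)
  /-- Two decorations on the same edge cancel. -/
  | cancel (d d' : LDiagram k) (v : Node k) : d'.mate = d.mate → d'.deco = d.decoAdd v 2 →
      d'.loops = d.loops → LocalRel k (PL.of d') (PL.of d)
  /-- Two decorations on the same loop cancel. -/
  | cancelLoop (d d' : LDiagram k) (m : ℕ) (s : Multiset ℕ) : d'.mate = d.mate →
      d'.deco = d.deco → d.loops = m ::ₘ s → d'.loops = (m + 2) ::ₘ s →
      LocalRel k (PL.of d') (PL.of d)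
  /-- In the presence of a decorated loop, an edge loses its decoration. -/
  | absorb (d d' : LDiagram k) (v : Node k) : 1 ∈ d.loops → d'.mate = d.mate →
      d'.deco = d.decoAdd v 1 → d'.loops = d.loops → LocalRel k (PL.of d') (PL.of d)
  /-- In the presence of a decorated loop, another loop loses its decoration. -/
  | absorbLoop (d d' : LDiagram k) (m : ℕ) (s : Multiset ℕ) : d'.mate = d.mate →
      d'.deco = d.deco → d.loops = 1 ::ₘ m ::ₘ s → d'.loops = 1 ::ₘ (m + 1) ::ₘ s →
      LocalRel k (PL.of d') (PL.of d)

/-- The quotient of `PL k` by the local relations. -/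
def PHat (k : ℕ) : Type := RingQuot (LocalRel k)

noncomputable instance (k : ℕ) : Ring (PHat k) := inferInstanceAs (Ring (RingQuot (LocalRel k)))

noncomputable instance (k : ℕ) : Algebra ℤ[X] (PHat k) :=
  inferInstanceAs (Algebra ℤ[X] (RingQuot (LocalRel k)))

/-- The quotient map. -/
noncomputable def PHat.mk {k : ℕ} : PL k →ₐ[ℤ[X]] PHat k := RingQuot.mkAlgHom ℤ[X] (LocalRel k)

/-- The class of the diagram `d`. -/
noncomputable def PHat.of {k : ℕ} (d : LDiagram k) : PHat k := PHat.mk (PL.of d)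

/-- The diagram algebra of type `D_n`: the unital subalgebra generated by the simple diagrams. -/
noncomputable def DTL (n : ℕ) : Subalgebra ℤ[X] (PHat n) :=
  Algebra.adjoin ℤ[X]
    ({x | ∃ (i : ℕ) (hi : i + 1 < n), x = PHat.of (LDiagram.simple i hi)} ∪
      {x | ∃ h : 0 + 1 < n, x = PHat.of (LDiagram.simpleBar h)})

/-- The additional relation: a diagram with a decorated loop is `0`. -/
def DecoratedLoopRel (n : ℕ) (x y : DTL n) : Prop :=
  (∃ d : LDiagram n, 1 ∈ d.loops ∧ (x : PHat n) = PHat.of d) ∧ y = 0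

/-- The loop-free diagram algebra. -/
def LFD (n : ℕ) : Type := RingQuot (DecoratedLoopRel n)

noncomputable instance (n : ℕ) : Ring (LFD n) :=
  inferInstanceAs (Ring (RingQuot (DecoratedLoopRel n)))

noncomputable instance (n : ℕ) : Algebra ℤ[X] (LFD n) :=
  inferInstanceAs (Algebra ℤ[X] (RingQuot (DecoratedLoopRel n)))

/-- The quotient map. -/
noncomputable def LFD.mk {n : ℕ} : DTL n →ₐ[ℤ[X]] LFD n :=
  RingQuot.mkAlgHom ℤ[X] (DecoratedLoopRel n)

/-- The number of decorations on the arcs; the sum over the nodes counts every arc twice. -/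
def Arcs.numDeco {V : Type*} [Fintype V] (A : Arcs V) : ℕ := (∑ v, A.deco v) / 2

/-- `D`-admissible of type II: no loops, at most one decoration on every edge, and an even total
number of decorations. -/
structure LDiagram.IsTypeII {n : ℕ} (d : LDiagram n) : Prop where
  loops : d.loops = 0
  deco_le : ∀ v, d.deco v ≤ 1
  even : Even d.toArcs.numDeco

theorem LDiagram.IsTypeII.flip {n : ℕ} {d : LDiagram n} (h : d.IsTypeII) : d.flip.IsTypeII where
  loops := h.loops
  deco_le v := h.deco_le v.swap
  even := by
    have : d.flip.toArcs.numDeco = d.toArcs.numDeco := by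
      unfold Arcs.numDeco
      congr 1
      exact Equiv.sum_comp (Equiv.sumComm (Fin n) (Fin n)) d.deco
    rw [this]
    exact h.even

/-- The `D`-admissible diagrams of type II. -/
def TypeII (n : ℕ) : Type := {d : LDiagram n // d.IsTypeII}

/-- Top-bottom inversion. -/
def TypeII.flip {n : ℕ} (d : TypeII n) : TypeII n := ⟨d.1.flip, d.2.flip⟩

/-- The upper half-diagram of `d`: the arcs of the north face, the propagating edges being removed.
A half-diagram is a system of arcs on one face in which the nodes without arc are the ends of the
removed propagating edges. -/
def TypeII.upper {n : ℕ} (d : TypeII n) : Arcs (Fin n) where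
  mate i := Sum.elim id (fun _ => i) (d.1.mate (Sum.inl i))
  deco i := Sum.elim (fun _ => d.1.deco (Sum.inl i)) (fun _ => 0) (d.1.mate (Sum.inl i))
  loops := 0
  mate_mate i := by
    rcases h : d.1.mate (Sum.inl i) with j | j
    · have : d.1.mate (Sum.inl j) = Sum.inl i := by rw [← h, d.1.mate_mate]
      simp [this]
    · simp [h]
  deco_mate i := by
    rcases h : d.1.mate (Sum.inl i) with j | j
    · have : d.1.mate (Sum.inl j) = Sum.inl i := by rw [← h, d.1.mate_mate]
      have h2 := d.1.deco_mate (Sum.inl i)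
      rw [h] at h2
      simp [this, h2]
    · simp [h]
  deco_free i := by
    rcases h : d.1.mate (Sum.inl i) with j | j
    · intro hj
      simp only [Sum.elim_inl, id] at hj
      exact absurd (hj ▸ h) (d.1.no_free _)
    · simp

/-- The lower half-diagram: the lower half, inverted in a horizontal line. -/
def TypeII.lower {n : ℕ} (d : TypeII n) : Arcs (Fin n) := d.flip.upper

/-- The number of propagating edges of a half-diagram. -/
def numProp {n : ℕ} (h : Arcs (Fin n)) : ℕ := (Finset.univ.filter fun i => h.mate i = i).card

/-- The symbols `m`, `0⁺`, `0⁻`. -/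
inductive Label : Type
  | num (m : ℕ)
  | zeroPlus
  | zeroMinus

/-- The absolute value `|λ|`. -/
def Label.abs : Label → ℕ
  | num m => m
  | zeroPlus => 0
  | zeroMinus => 0

instance : PartialOrder Label where
  le a b := a = b ∨ a.abs < b.abs
  lt a b := a.abs < b.abs
  le_refl a := Or.inl rfl
  le_trans a b c := by
    rintro (rfl | h) (rfl | h')
    · exact Or.inl rfl
    · exact Or.inr h'
    · exact Or.inr h
    · exact Or.inr (h.trans h')
  le_antisymm a b := by
    rintro (rfl | h) (h' | h')
    · rfl
    · rfl
    · exact h'.symm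
    · exact absurd h' (lt_asymm h)
  lt_iff_le_not_ge a b := by
    constructor
    · intro h
      refine ⟨Or.inr h, ?_⟩
      rintro (rfl | h')
      · exact lt_irrefl _ h
      · exact lt_asymm h h'
    · rintro ⟨rfl | h, h'⟩
      · exact absurd (Or.inl rfl) h'
      · exact h

/-- The labels that occur for `n`. -/
def Label.Valid (n : ℕ) : Label → Prop
  | num m => 0 < m ∧ m ≤ n ∧ m % 2 = n % 2
  | zeroPlus => Even n
  | zeroMinus => Even n

/-- The poset `Λ`: `{1, 3, ..., n}` for `n` odd and `{0⁺, 0⁻, 2, 4, ..., n}` for `n` even, ordered by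
absolute value. -/
abbrev Lam (n : ℕ) : Type := {a : Label // a.Valid n}

/-- The set `M(λ)`: the half-diagrams of the diagrams of type II with `|λ|` propagating edges; for
`0⁺` the number of decorations has to be even, for `0⁻` odd. -/
def M {n : ℕ} (l : Lam n) : Type :=
  {h : Arcs (Fin n) // (∃ d : TypeII n, h = d.upper ∨ h = d.lower) ∧ numProp h = l.1.abs ∧
    (l.1 = Label.zeroPlus → Even h.numDeco) ∧ (l.1 = Label.zeroMinus → Odd h.numDeco)}

/-- `(Λ, M, C, *)` is a cell datum for the `R`-algebra `A`. -/
structure IsCellDatum (R : Type*) [CommRing R] {A : Type*} [Ring A] [Algebra R A]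
    {Λ : Type*} [PartialOrder Λ] {M : Λ → Type*} (C : ∀ l, M l → M l → A) (star : A →ₗ[R] A) :
    Prop where
  finite : ∀ l, Finite (M l)
  injective : Function.Injective fun x : Σ l, M l × M l => C x.1 x.2.1 x.2.2
  linearIndependent : LinearIndependent R
    (Subtype.val : Set.range (fun x : Σ l, M l × M l => C x.1 x.2.1 x.2.2) → A)
  span : Submodule.span R (Set.range fun x : Σ l, M l × M l => C x.1 x.2.1 x.2.2) = ⊤
  star_star : ∀ a, star (star a) = a
  star_mul : ∀ a b, star (a * b) = star b * star a
  star_C : ∀ l S T, star (C l S T) = C l T S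
  mul_C : ∀ (a : A) (l : Λ), ∃ r : M l → M l → R, ∀ S T,
    a * C l S T - ∑ᶠ S', r S' S • C l S' T ∈
      Submodule.span R {x | ∃ m, m < l ∧ ∃ S'' T'', x = C m S'' T''}

end LoopFree

/-!
Linear independence: a diagram has a normal form, a multiple of a diagram without loops whose edges
carry at most one decoration, where a diagram with a decorated loop is read as `0`. Multiplication
followed by taking normal forms is an action of the loop-free algebra on the free module on these
reduced diagrams, and applying it to the identity separates them.

Spanning: the identity and the generators are of type II, and products of diagrams of type II are
multiples of diagrams of type II. Conversely, a diagram of type II other than the identity has an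
arc in the north face that joins two neighbours `i` and `i + 1` and is undecorated or has `i = 1`.
In the undecorated case, reroute this arc together with the first edge that crosses the vertical
line between `i` and `i + 1`, or carries a decoration, to the right of it. This splits off the
generator `d_i` and lowers the total horizontal extent of the edges, where a decorated edge counts
as passing the left wall. The decorated case reduces to this one by adding a decoration at the first
node of each face, which exchanges `d_1` and its decorated version.

Cellularity: propagating edges do not cross, so they match the free nodes of the two halves in
order, and only the leftmost one can be decorated, which is decided by parity; so a diagram of type
II amounts to a pair of half-diagrams. The upper half of a product depends on its right factor only
through the upper half of the latter, and the lower half remains that of the right factor as long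
as the number of propagating edges does not drop.
-/

namespace LoopFree

open Polynomial LDiagram

namespace Arcs

variable {V W : Type*}

theorem even_sum [Fintype V] (A : Arcs V) (f : V → ℕ) (hmate : ∀ v, f (A.mate v) = f v)
    (hfree : ∀ v, A.mate v = v → f v = 0) : Even (∑ v, f v) := by
  classical
  rw [← ZMod.natCast_eq_zero_iff_even, Nat.cast_sum]
  refine Finset.sum_involution (fun v _ => A.mate v) (fun v _ => ?_) (fun v _ hv hfix => hv ?_)
    (fun v _ => Finset.mem_univ _) (fun v _ => A.mate_mate v)
  · rw [hmate]
    exact CharTwo.add_self_eq_zero _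
  · rw [hfree v hfix, Nat.cast_zero]

theorem two_mul_numDeco [Fintype V] (A : Arcs V) : 2 * A.numDeco = ∑ v, A.deco v :=
  Nat.two_mul_div_two_of_even (A.even_sum A.deco A.deco_mate A.deco_free)

section Total

/-- Twice the number of all decorations: those of an arc are counted at both of its ends, those of
a loop are counted twice. Gluing only moves decorations around, hence preserves this number. -/
def total [Fintype V] (A : Arcs V) : ℕ := ∑ v, A.deco v + 2 * A.loops.sum

variable [Fintype V]

theorem total_glue_of_mate_eq [DecidableEq V] {A : Arcs V} {p q : V} (h : A.Gluable p q)
    (hpq : A.mate p = q) : (A.glue p q).total = A.total := by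
  have deco_eq : ∀ v, (A.glue p q).deco v + (if v = p then A.deco p else 0) +
      (if v = q then A.deco p else 0) = A.deco v := by
    intro v
    have hne := h.1
    have hmate := A.mate_mate p
    have hdeco := A.deco_mate p
    rw [glue_deco A p q h]
    grind
  have sum_eq := Finset.sum_congr rfl fun v (_ : v ∈ Finset.univ) => deco_eq v
  simp only [Finset.sum_add_distrib, Finset.sum_ite_eq', Finset.mem_univ, if_true] at sum_eq
  rw [total, total, glue_loops A p q h, if_pos hpq, Multiset.sum_cons]
  linarith

theorem total_glue_of_mate_ne [DecidableEq V] {A : Arcs V} {p q : V} (h : A.Gluable p q)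
    (hpq : A.mate p ≠ q) : (A.glue p q).total = A.total := by
  have deco_eq : ∀ v, (A.glue p q).deco v + (if v = p then A.deco p else 0) +
      (if v = q then A.deco q else 0) = A.deco v + (if v = A.mate p then A.deco q else 0) +
      (if v = A.mate q then A.deco p else 0) := by
    intro v
    obtain ⟨hne, hp, hq⟩ := id h
    have hmp := A.mate_mate p
    have hmq := A.mate_mate q
    have hdp := A.deco_mate p
    have hdq := A.deco_mate q
    rw [glue_deco A p q h]
    grind
  have sum_eq := Finset.sum_congr rfl fun v (_ : v ∈ Finset.univ) => deco_eq v
  simp only [Finset.sum_add_distrib, Finset.sum_ite_eq', Finset.mem_univ, if_true] at sum_eq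
  rw [total, total, glue_loops A p q h, if_neg hpq]
  omega

theorem total_glue [DecidableEq V] (A : Arcs V) (p q : V) : (A.glue p q).total = A.total := by
  by_cases h : A.Gluable p q
  · by_cases hpq : A.mate p = q
    · exact total_glue_of_mate_eq h hpq
    · exact total_glue_of_mate_ne h hpq
  · rw [glue_of_not A p q h]

theorem total_glueList [DecidableEq V] (A : Arcs V) (l : List (V × V)) :
    (A.glueList l).total = A.total := by
  induction l generalizing A with
  | nil => rfl
  | cons e l ih => rw [glueList_cons, ih, total_glue]

theorem total_sum [Fintype W] (A : Arcs V) (B : Arcs W) : (A.sum B).total = A.total + B.total := by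
  simp only [total, Arcs.sum, Fintype.sum_sum_type, Sum.elim_inl, Sum.elim_inr, Multiset.sum_add]
  ring

theorem IsPush.total_eq [Fintype W] {e : V → W} (he : Function.Injective e) {A : Arcs V}
    {B : Arcs W} (h : IsPush e A B) : B.total = A.total := by
  have sum_deco : ∑ v, A.deco v = ∑ w, B.deco w :=
    Fintype.sum_of_injective e he _ _ (fun w hw => B.deco_free w (h.free w hw))
      fun v => (h.deco v).symm
  rw [total, total, h.loops, sum_deco]

end Total

section ModTwo

/-- `A` and `B` agree, the decorations being counted modulo `2`, except for additional loops
`s` of `A`. -/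
structure ModTwo (A B : Arcs V) (s : Multiset ℕ) : Prop where
  mate : A.mate = B.mate
  deco : ∀ v, A.deco v % 2 = B.deco v % 2
  loops : A.loops.map (· % 2) = B.loops.map (· % 2) + s

namespace ModTwo

theorem glue [DecidableEq V] {A B : Arcs V} {s : Multiset ℕ} (h : ModTwo A B s) (p q : V) :
    ModTwo (A.glue p q) (B.glue p q) s := by
  have gluable_iff : A.Gluable p q ↔ B.Gluable p q := by simp only [Gluable, h.mate]
  by_cases hA : A.Gluable p q
  · have hB := gluable_iff.1 hA
    refine ⟨funext fun v => ?_, fun v => ?_, ?_⟩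
    · rw [glue_mate A p q hA, glue_mate B p q hB, h.mate]
    · rw [glue_deco A p q hA, glue_deco B p q hB, h.mate]
      split_ifs
      · rfl
      · rw [Nat.add_mod, h.deco, h.deco, ← Nat.add_mod]
      · exact h.deco v
    · rw [glue_loops A p q hA, glue_loops B p q hB, h.mate]
      split_ifs
      · rw [Multiset.map_cons, Multiset.map_cons, h.loops, h.deco, Multiset.cons_add]
      · exact h.loops
  · rw [glue_of_not A p q hA, glue_of_not B p q (by rwa [← gluable_iff])]
    exact h

theorem glueList [DecidableEq V] {A B : Arcs V} {s : Multiset ℕ} (h : ModTwo A B s)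
    (l : List (V × V)) : ModTwo (A.glueList l) (B.glueList l) s := by
  induction l generalizing A B with
  | nil => exact h
  | cons e l ih => exact ih (h.glue e.1 e.2)

theorem sum {A B : Arcs V} {C D : Arcs W} {s t : Multiset ℕ} (hAB : ModTwo A B s)
    (hCD : ModTwo C D t) : ModTwo (A.sum C) (B.sum D) (s + t) := by
  refine ⟨?_, ?_, ?_⟩
  · simp only [Arcs.sum, hAB.mate, hCD.mate]
  · rintro (v | w)
    · exact hAB.deco v
    · exact hCD.deco w
  · simp only [Arcs.sum, Multiset.map_add, hAB.loops, hCD.loops]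
    abel

end ModTwo

end ModTwo

section AgreeOn

/-- `A` and `B` have the same loops and the same arcs with both ends in `U`. -/
structure AgreeOn (U : Set V) (A B : Arcs V) : Prop where
  mate : ∀ v ∈ U, A.mate v ∈ U ∨ B.mate v ∈ U → A.mate v = B.mate v
  deco : ∀ v ∈ U, A.mate v ∈ U → A.deco v = B.deco v
  loops : A.loops = B.loops

namespace AgreeOn

variable {U : Set V} {A B : Arcs V}

theorem mate_eq_self_iff (h : AgreeOn U A B) {v : V} (hv : v ∈ U) :
    A.mate v = v ↔ B.mate v = v := by
  constructor
  · intro hfree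
    rw [← h.mate v hv (Or.inl (by rwa [hfree])), hfree]
  · intro hfree
    rw [h.mate v hv (Or.inr (by rwa [hfree])), hfree]

variable [DecidableEq V]

theorem glue (h : AgreeOn U A B) {p q : V} (hp : p ∈ U) (hq : q ∈ U) :
    AgreeOn U (A.glue p q) (B.glue p q) := by
  have gluable_iff : A.Gluable p q ↔ B.Gluable p q := by
    simp only [Gluable, ne_eq, h.mate_eq_self_iff hp, h.mate_eq_self_iff hq]
  by_cases hA : A.Gluable p q
  · have hB := gluable_iff.1 hA
    have mate_mate_A := A.mate_mate
    have mate_mate_B := B.mate_mate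
    have mate_p := h.mate p hp
    have mate_q := h.mate q hq
    have deco_p := h.deco p hp
    have deco_q := h.deco q hq
    refine ⟨fun v hv => ?_, fun v hv => ?_, ?_⟩
    · have mate_v := h.mate v hv
      rw [glue_mate A p q hA, glue_mate B p q hB]
      grind
    · have mate_v := h.mate v hv
      have deco_v := h.deco v hv
      rw [glue_mate A p q hA, glue_deco A p q hA, glue_deco B p q hB]
      grind
    · rw [glue_loops A p q hA, glue_loops B p q hB, h.loops]
      grind
  · rw [glue_of_not A p q hA, glue_of_not B p q (by rwa [← gluable_iff])]
    exact h

theorem glueList (h : AgreeOn U A B) (l : List (V × V)) (hl : ∀ e ∈ l, e.1 ∈ U ∧ e.2 ∈ U) :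
    AgreeOn U (A.glueList l) (B.glueList l) := by
  induction l generalizing A B with
  | nil => exact h
  | cons e l ih =>
    rw [List.forall_mem_cons] at hl
    exact ih (h.glue hl.1.1 hl.1.2) hl.2

end AgreeOn

end AgreeOn

section Keep

variable [DecidableEq V]

theorem glue_deco_of_ne (A : Arcs V) {p q v : V} (hvp : v ≠ p) (hvq : v ≠ q)
    (hmp : A.mate v ≠ p) (hmq : A.mate v ≠ q) : (A.glue p q).deco v = A.deco v := by
  by_cases h : A.Gluable p q
  · rw [glue_deco A p q h, if_neg (by tauto), if_neg]
    rintro (rfl | rfl)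
    · exact hmp (A.mate_mate p)
    · exact hmq (A.mate_mate q)
  · rw [glue_of_not A p q h]

theorem glueList_deco_of_ne (A : Arcs V) (l : List (V × V)) (v : V)
    (h : ∀ e ∈ l, v ≠ e.1 ∧ v ≠ e.2 ∧ A.mate v ≠ e.1 ∧ A.mate v ≠ e.2) :
    (A.glueList l).deco v = A.deco v := by
  induction l generalizing A with
  | nil => rfl
  | cons e l ih =>
    rw [List.forall_mem_cons] at h
    obtain ⟨⟨hv₁, hv₂, hm₁, hm₂⟩, hl⟩ := h
    have mate_eq := glue_keep A e.1 e.2 v hv₁ hv₂ hm₁ hm₂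
    rw [glueList_cons, ih _ (by rwa [mate_eq]), glue_deco_of_ne A hv₁ hv₂ hm₁ hm₂]

end Keep

end Arcs

namespace LDiagram

variable {k : ℕ}

theorem ext_data {d e : LDiagram k} (hmate : d.mate = e.mate) (hdeco : ∀ v, d.deco v = e.deco v)
    (hloops : d.loops = e.loops) : d = e :=
  ext_arcs (Arcs.ext hmate (funext hdeco) hloops)

section Reduce

/-- Give the edges of `d` the decorations `f` and replace its loops by `s`. No undecorated edge may
become decorated, so that all decorations stay exposed to the left wall. -/
def redecorate (d : LDiagram k) (f : Node k → ℕ) (s : Multiset ℕ)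
    (hmate : ∀ v, f (d.mate v) = f v) (hdeco : ∀ v, f v ≠ 0 → d.deco v ≠ 0)
    (hloops : (∀ m ∈ d.loops, m = 0) → ∀ m ∈ s, m = 0) : LDiagram k where
  mate := d.mate
  deco := f
  loops := s
  mate_mate := d.mate_mate
  deco_mate := hmate
  deco_free v hv := absurd hv (d.no_free v)
  no_free := d.no_free
  planar := d.planar
  exposed v hv := d.exposed v (hdeco v hv)
  undecorated h := by
    obtain ⟨deco_eq_zero, loops_eq_zero⟩ := d.undecorated h
    exact ⟨fun v => by_contra fun hv => hdeco v hv (deco_eq_zero v), hloops loops_eq_zero⟩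

/-- Remove the loops, and cancel pairs of decorations on the edges. -/
def reduce (d : LDiagram k) : LDiagram k :=
  d.redecorate (fun v => d.deco v % 2) 0 (fun v => by rw [d.deco_mate])
    (fun v hmod hdeco => hmod (by rw [hdeco])) (by simp)

@[simp] theorem reduce_mate (d : LDiagram k) : d.reduce.mate = d.mate := rfl

@[simp] theorem reduce_deco (d : LDiagram k) (v : Node k) : d.reduce.deco v = d.deco v % 2 := rfl

@[simp] theorem reduce_loops (d : LDiagram k) : d.reduce.loops = 0 := rfl

theorem reduce_congr {d e : LDiagram k} {s : Multiset ℕ} (h : Arcs.ModTwo d.toArcs e.toArcs s) :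
    d.reduce = e.reduce :=
  ext_data h.mate h.deco rfl

theorem modTwo_refl (d : LDiagram k) : Arcs.ModTwo d.toArcs d.toArcs 0 :=
  ⟨rfl, fun _ => rfl, by simp⟩

theorem modTwo_reduce (d : LDiagram k) :
    Arcs.ModTwo d.toArcs d.reduce.toArcs (d.loops.map (· % 2)) :=
  ⟨rfl, fun v => by simp, by simp⟩

theorem modTwo_of_stack {d d' e e' : LDiagram k} {s : Multiset ℕ}
    (h : Arcs.ModTwo (stack d.toArcs e.toArcs) (stack d'.toArcs e'.toArcs) s) :
    Arcs.ModTwo (d * e).toArcs (d' * e').toArcs s := by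
  refine ⟨funext fun v => outer_injective ?_, fun v => h.deco (outer v), h.loops⟩
  rw [← (mul_isPush d e).mate, ← (mul_isPush d' e').mate, h.mate]

theorem modTwo_mul {d d' e e' : LDiagram k} {s t : Multiset ℕ}
    (hd : Arcs.ModTwo d.toArcs d'.toArcs s) (he : Arcs.ModTwo e.toArcs e'.toArcs t) :
    Arcs.ModTwo (d * e).toArcs (d' * e').toArcs (s + t) :=
  modTwo_of_stack ((hd.sum he).glueList _)

theorem modTwo_mul_reduce (d e : LDiagram k) :
    Arcs.ModTwo (d * e).toArcs (d * e.reduce).toArcs (e.loops.map (· % 2)) := by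
  simpa only [zero_add] using modTwo_mul d.modTwo_refl e.modTwo_reduce

theorem modTwo_reduce_mul (d e : LDiagram k) :
    Arcs.ModTwo (d * e).toArcs (d.reduce * e).toArcs (d.loops.map (· % 2)) := by
  simpa only [add_zero] using modTwo_mul d.modTwo_reduce e.modTwo_refl

/-- A diagram without loops and with at most one decoration on every edge. -/
def IsReduced (d : LDiagram k) : Prop := d.loops = 0 ∧ ∀ v, d.deco v ≤ 1

theorem reduce_isReduced (d : LDiagram k) : d.reduce.IsReduced :=
  ⟨rfl, fun _ => Nat.lt_succ_iff.1 (Nat.mod_lt _ two_pos)⟩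

theorem IsReduced.reduce_eq {d : LDiagram k} (h : d.IsReduced) : d.reduce = d :=
  ext_data rfl (fun v => Nat.mod_eq_of_lt (Nat.lt_succ_of_le (h.2 v))) h.1.symm

theorem IsTypeII.isReduced {d : LDiagram k} (h : d.IsTypeII) : d.IsReduced := ⟨h.loops, h.deco_le⟩

end Reduce

section LoopWeight

/-- The scalar contributed by a collection of loops in the quotient in which a loop with an odd
number of decorations vanishes. -/
noncomputable def loopWeight (s : Multiset ℕ) : ℤ[X] :=
  (s.map fun m => if m % 2 = 0 then (X : ℤ[X]) else 0).prod

@[simp] theorem loopWeight_zero : loopWeight 0 = 1 := rfl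

@[simp] theorem loopWeight_cons (m : ℕ) (s : Multiset ℕ) :
    loopWeight (m ::ₘ s) = (if m % 2 = 0 then X else 0) * loopWeight s := by
  simp [loopWeight]

theorem loopWeight_add (s t : Multiset ℕ) : loopWeight (s + t) = loopWeight s * loopWeight t := by
  simp [loopWeight]

theorem loopWeight_map_mod (s : Multiset ℕ) : loopWeight (s.map (· % 2)) = loopWeight s := by
  simp [loopWeight]

theorem loopWeight_eq_zero {s : Multiset ℕ} {m : ℕ} (hm : m ∈ s) (hodd : m % 2 = 1) :
    loopWeight s = 0 :=
  Multiset.prod_eq_zero (Multiset.mem_map.2 ⟨m, hm, by simp [hodd]⟩)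

theorem loopWeight_congr {d e : LDiagram k} {s : Multiset ℕ}
    (h : Arcs.ModTwo d.toArcs e.toArcs (s.map (· % 2))) :
    loopWeight d.loops = loopWeight e.loops * loopWeight s := by
  rw [← loopWeight_map_mod, h.loops, loopWeight_add, loopWeight_map_mod, loopWeight_map_mod]

end LoopWeight

section Action

/-- The free module on the reduced diagrams, on which the diagrams act by multiplication. -/
abbrev ReducedModule (k : ℕ) : Type := {e : LDiagram k // e.IsReduced} →₀ ℤ[X]

/-- The normal form of `d` in the free module on the reduced diagrams. -/
noncomputable def normalForm (d : LDiagram k) : ReducedModule k :=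
  Finsupp.single ⟨d.reduce, d.reduce_isReduced⟩ (loopWeight d.loops)

theorem normalForm_congr {d e : LDiagram k} {s : Multiset ℕ}
    (h : Arcs.ModTwo d.toArcs e.toArcs (s.map (· % 2))) :
    normalForm d = loopWeight s • normalForm e := by
  rw [normalForm, normalForm, Finsupp.smul_single, smul_eq_mul, mul_comm, ← loopWeight_congr h]
  congr 1
  exact Subtype.ext (reduce_congr h)

theorem IsReduced.normalForm_eq {d : LDiagram k} (h : d.IsReduced) :
    normalForm d = Finsupp.single ⟨d, h⟩ 1 := by
  rw [normalForm, h.1, loopWeight_zero]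
  congr 1
  exact Subtype.ext h.reduce_eq

/-- The action of the diagrams on the free module on the reduced diagrams: multiply, then pass to
normal forms. Applied to the identity diagram, it separates the reduced diagrams. -/
noncomputable def action : LDiagram k →* Module.End ℤ[X] (ReducedModule k) where
  toFun d := Finsupp.linearCombination ℤ[X] fun e => normalForm (d * e.1)
  map_one' := by
    ext1 e
    ext1
    simp [e.2.normalForm_eq]
  map_mul' d d' := by
    ext1 e
    ext1
    simp only [LinearMap.comp_apply, Finsupp.lsingle_apply, Finsupp.linearCombination_single,
      one_smul, Module.End.mul_apply]
    rw [mul_assoc, normalForm_congr (modTwo_mul_reduce d (d' * e.1)), normalForm.eq_1 (d' * e.1),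
      Finsupp.linearCombination_single]

theorem action_single (d e : LDiagram k) (he : e.IsReduced) (c : ℤ[X]) :
    action d (Finsupp.single ⟨e, he⟩ c) = c • normalForm (d * e) := by
  simp [action]

theorem action_eq_smul_action_reduce (d : LDiagram k) :
    action d = loopWeight d.loops • action d.reduce := by
  ext1 ⟨e, he⟩
  ext1
  simp only [LinearMap.comp_apply, Finsupp.lsingle_apply, LinearMap.smul_apply, action_single,
    one_smul]
  exact normalForm_congr (modTwo_reduce_mul d e)

theorem action_eq_smul_action {d e : LDiagram k} {c : ℤ[X]} (hmate : d.mate = e.mate)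
    (hdeco : ∀ v, d.deco v % 2 = e.deco v % 2)
    (hloops : loopWeight d.loops = c * loopWeight e.loops) : action d = c • action e := by
  rw [action_eq_smul_action_reduce d, action_eq_smul_action_reduce e, hloops, mul_smul,
    show d.reduce = e.reduce from ext_data hmate hdeco rfl]

theorem action_eq_zero {d : LDiagram k} {m : ℕ} (hm : m ∈ d.loops) (hodd : m % 2 = 1) :
    action d = 0 := by
  rw [action_eq_smul_action_reduce, loopWeight_eq_zero hm hodd, zero_smul]

end Action

end LDiagram

/-- The representation of `PL k` on the free module on the reduced diagrams. -/
noncomputable def PL.rep (k : ℕ) : PL k →ₐ[ℤ[X]] Module.End ℤ[X] (ReducedModule k) :=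
  MonoidAlgebra.lift ℤ[X] _ (LDiagram k) action

theorem PL.rep_of {k : ℕ} (d : LDiagram k) : PL.rep k (PL.of d) = action d := by
  simp [PL.rep, PL.of]

theorem PL.rep_eq_of_localRel {k : ℕ} {x y : PL k} (h : LocalRel k x y) :
    PL.rep k x = PL.rep k y := by
  cases h with
  | loop d d' hmate hdeco hloops =>
    rw [map_smul, PL.rep_of, PL.rep_of]
    exact action_eq_smul_action hmate (fun v => by rw [hdeco]) (by simp [hloops])
  | cancel d d' v hmate hdeco hloops =>
    rw [PL.rep_of, PL.rep_of, ← one_smul ℤ[X] (action d)]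
    refine action_eq_smul_action hmate (fun u => ?_) (by rw [hloops, one_mul])
    simp only [hdeco, decoAdd]
    split_ifs
    · exact Nat.add_mod_right _ _
    · rfl
  | cancelLoop d d' m s hmate hdeco hloops hloops' =>
    rw [PL.rep_of, PL.rep_of, ← one_smul ℤ[X] (action d)]
    exact action_eq_smul_action hmate (fun u => by rw [hdeco]) (by simp [hloops, hloops'])
  | absorb d d' v hone _ _ hloops =>
    rw [PL.rep_of, PL.rep_of, action_eq_zero hone rfl, action_eq_zero (by rwa [hloops]) rfl]
  | absorbLoop d d' m s _ _ hloops hloops' =>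
    rw [PL.rep_of, PL.rep_of, action_eq_zero (m := 1) (by simp [hloops']) rfl,
      action_eq_zero (m := 1) (by simp [hloops]) rfl]

/-- The representation of `PHat k` on the free module on the reduced diagrams. -/
noncomputable def PHat.rep (k : ℕ) : PHat k →ₐ[ℤ[X]] Module.End ℤ[X] (ReducedModule k) :=
  RingQuot.liftAlgHom ℤ[X] ⟨PL.rep k, fun _ _ h => PL.rep_eq_of_localRel h⟩

theorem PHat.rep_of {k : ℕ} (d : LDiagram k) : PHat.rep k (PHat.of d) = action d :=
  (RingQuot.liftAlgHom_mkAlgHom_apply ℤ[X] (PL.rep k)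
    (fun _ _ h => PL.rep_eq_of_localRel h) _).trans (PL.rep_of d)

theorem PHat.rep_eq_of_decoratedLoopRel {n : ℕ} {x y : DTL n} (h : DecoratedLoopRel n x y) :
    PHat.rep n x = PHat.rep n y := by
  obtain ⟨⟨d, hone, hx⟩, rfl⟩ := h
  rw [hx, PHat.rep_of, action_eq_zero hone rfl, ZeroMemClass.coe_zero, map_zero]

/-- The representation of `LFD n` on the free module on the reduced diagrams. -/
noncomputable def LFD.rep (n : ℕ) : LFD n →ₐ[ℤ[X]] Module.End ℤ[X] (ReducedModule n) :=
  RingQuot.liftAlgHom ℤ[X]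
    ⟨(PHat.rep n).comp (DTL n).val, fun _ _ h => PHat.rep_eq_of_decoratedLoopRel h⟩

theorem LFD.rep_mk {n : ℕ} (d : LDiagram n) (hd : PHat.of d ∈ DTL n) :
    LFD.rep n (LFD.mk ⟨PHat.of d, hd⟩) = action d :=
  (RingQuot.liftAlgHom_mkAlgHom_apply ℤ[X] ((PHat.rep n).comp (DTL n).val)
    (fun _ _ h => PHat.rep_eq_of_decoratedLoopRel h) _).trans (PHat.rep_of d)

namespace LDiagram

variable {k : ℕ}

/-- Remove two decorations from the edge at `v`. -/
def dropTwo (d : LDiagram k) (v : Node k) : LDiagram k :=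
  d.redecorate (fun u => if u = v ∨ u = d.mate v then d.deco u - 2 else d.deco u) d.loops
    (fun u => by
      have deco_mate := d.deco_mate u
      have mate_mate := d.mate_mate
      grind)
    (fun u hu h0 => hu (by simp [h0])) id

/-- Replace the loops of `d` by `s`. -/
def withLoops (d : LDiagram k) (s : Multiset ℕ)
    (hs : (∀ m ∈ d.loops, m = 0) → ∀ m ∈ s, m = 0) : LDiagram k :=
  d.redecorate d.deco s d.deco_mate (fun _ => id) hs

theorem reduce_dropTwo {d : LDiagram k} {v : Node k} (hv : 2 ≤ d.deco v) :
    (d.dropTwo v).reduce = d.reduce := by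
  refine ext_data rfl (fun u => ?_) rfl
  have deco_mate := d.deco_mate v
  simp only [reduce_deco, dropTwo, redecorate]
  grind

theorem sum_deco_dropTwo_lt {d : LDiagram k} {v : Node k} (hv : 2 ≤ d.deco v) :
    ∑ u, (d.dropTwo v).deco u < ∑ u, d.deco u := by
  refine Finset.sum_lt_sum (fun u _ => ?_) ⟨v, Finset.mem_univ v, ?_⟩
  · simp only [dropTwo, redecorate]
    split_ifs <;> omega
  · simp only [dropTwo, redecorate, true_or, if_true]
    omega

end LDiagram

namespace PHat

variable {k : ℕ}

theorem of_mul (d e : LDiagram k) : PHat.of (d * e) = PHat.of d * PHat.of e := by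
  rw [PHat.of, PL.of, map_mul, map_mul]
  rfl

theorem of_one : PHat.of (1 : LDiagram k) = 1 := by
  rw [PHat.of, PL.of, map_one, map_one]

theorem mk_eq {x y : PL k} (h : LocalRel k x y) : (PHat.mk x : PHat k) = PHat.mk y :=
  RingQuot.mkAlgHom_rel ℤ[X] h

theorem of_dropTwo {d : LDiagram k} {v : Node k} (hv : 2 ≤ d.deco v) :
    PHat.of (d.dropTwo v) = PHat.of d := by
  refine (mk_eq (LocalRel.cancel (d.dropTwo v) d v rfl (funext fun u => ?_) rfl)).symm
  have deco_mate := d.deco_mate v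
  simp only [decoAdd, dropTwo, redecorate]
  grind

theorem of_eq_smul_of_withLoops {d : LDiagram k} {s : Multiset ℕ}
    (hs : (∀ m ∈ d.loops, m = 0) → ∀ m ∈ s, m = 0) (hloops : d.loops = 0 ::ₘ s) :
    PHat.of d = (X : ℤ[X]) • PHat.of (d.withLoops s hs) := by
  refine (mk_eq (LocalRel.loop (d.withLoops s hs) d rfl rfl hloops)).trans ?_
  rw [map_smul]
  rfl

theorem of_eq_of_withLoops {d : LDiagram k} {m : ℕ} {s : Multiset ℕ}
    (hs : (∀ m ∈ d.loops, m = 0) → ∀ l ∈ m ::ₘ s, l = 0) (hloops : d.loops = (m + 2) ::ₘ s) :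
    PHat.of d = PHat.of (d.withLoops (m ::ₘ s) hs) :=
  mk_eq (LocalRel.cancelLoop (d.withLoops (m ::ₘ s) hs) d m s rfl rfl rfl hloops)

theorem of_eq_of_reduce {d : LDiagram k} (h : d.loops = 0) : PHat.of d = PHat.of d.reduce := by
  induction hN : ∑ v, d.deco v using Nat.strong_induction_on generalizing d with
  | _ N ih =>
    subst hN
    by_cases hd : ∀ v, d.deco v ≤ 1
    · rw [IsReduced.reduce_eq ⟨h, hd⟩]
    · push Not at hd
      obtain ⟨v, hv⟩ := hd
      rw [← of_dropTwo hv, ← reduce_dropTwo hv]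
      exact ih _ (sum_deco_dropTwo_lt hv) (d := d.dropTwo v) h rfl

theorem of_eq_smul_of_reduce {d : LDiagram k} (h : ∀ m ∈ d.loops, m % 2 = 0) :
    PHat.of d = loopWeight d.loops • PHat.of d.reduce := by
  induction hN : d.loops.sum + d.loops.card using Nat.strong_induction_on generalizing d with
  | _ N ih =>
    subst hN
    rcases Multiset.empty_or_exists_mem d.loops with hempty | ⟨m, hm⟩
    · rw [of_eq_of_reduce hempty, hempty, loopWeight_zero, one_smul]
    · obtain ⟨s, hs⟩ := Multiset.exists_cons_of_mem hm
      have heven := h m hm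
      rw [hs, Multiset.forall_mem_cons] at h
      match m with
      | 0 =>
        have weight_eq : loopWeight d.loops = X * loopWeight s := by simp [hs]
        have zero_of_mem (hzero : ∀ m ∈ d.loops, m = 0) : ∀ m ∈ s, m = 0 :=
          fun m hm => hzero m (hs ▸ Multiset.mem_cons_of_mem hm)
        rw [of_eq_smul_of_withLoops zero_of_mem hs, weight_eq, mul_smul]
        exact congrArg _ (ih _ (by simp [hs, withLoops, redecorate]) h.2 rfl)
      | 1 => omega
      | m + 2 =>
        have weight_eq : loopWeight d.loops = loopWeight (m ::ₘ s) := by simp [hs]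
        have not_zero (hzero : ∀ m ∈ d.loops, m = 0) : ∀ l ∈ m ::ₘ s, l = 0 :=
          absurd (hzero _ hm) (Nat.succ_ne_zero _)
        rw [of_eq_of_withLoops not_zero hs, weight_eq]
        refine ih _ (by simp [hs, withLoops, redecorate]) ?_ rfl
        exact Multiset.forall_mem_cons.2 ⟨by omega, h.2⟩

theorem exists_one_mem_loops {d : LDiagram k} {m : ℕ} (hm : m ∈ d.loops) (hodd : m % 2 = 1) :
    ∃ d', 1 ∈ d'.loops ∧ PHat.of d = PHat.of d' := by
  induction m using Nat.twoStepInduction generalizing d with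
  | zero => omega
  | one => exact ⟨d, hm, rfl⟩
  | more m ih _ =>
    obtain ⟨s, hs⟩ := Multiset.exists_cons_of_mem hm
    rw [of_eq_of_withLoops (fun hzero => absurd (hzero _ hm) (Nat.succ_ne_zero _)) hs]
    exact ih (Multiset.mem_cons_self m s) (by omega)

theorem of_congr {d e : LDiagram k} (h : Arcs.ModTwo d.toArcs e.toArcs 0)
    (he : ∀ m ∈ e.loops, m % 2 = 0) : PHat.of d = PHat.of e := by
  have hd : ∀ m ∈ d.loops, m % 2 = 0 := by
    intro m hm
    have mod_mem : m % 2 ∈ d.loops.map (· % 2) := Multiset.mem_map_of_mem _ hm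
    rw [h.loops, add_zero] at mod_mem
    obtain ⟨l, hl, hlm⟩ := Multiset.mem_map.1 mod_mem
    rw [← hlm, he l hl]
  rw [of_eq_smul_of_reduce hd, of_eq_smul_of_reduce he, reduce_congr h,
    loopWeight_congr (s := 0) h, loopWeight_zero, mul_one]

end PHat

theorem LFD.mk_eq_zero {n : ℕ} {d : LDiagram n} (hd : PHat.of d ∈ DTL n) {m : ℕ}
    (hm : m ∈ d.loops) (hodd : m % 2 = 1) : LFD.mk ⟨PHat.of d, hd⟩ = 0 := by
  obtain ⟨d', hone, hd'⟩ := PHat.exists_one_mem_loops hm hodd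
  exact (RingQuot.mkAlgHom_rel ℤ[X] (s := DecoratedLoopRel n) ⟨⟨d', hone, hd'⟩, rfl⟩).trans
    (map_zero LFD.mk)

namespace LDiagram

variable {n : ℕ}

section Parity

theorem numDeco_mul (d e : LDiagram n) : (d * e).toArcs.numDeco + (d * e).loops.sum =
    (d.toArcs.numDeco + d.loops.sum) + (e.toArcs.numDeco + e.loops.sum) := by
  have total_mul : (d * e).toArcs.total = d.toArcs.total + e.toArcs.total := by
    rw [← (mul_isPush d e).total_eq outer_injective, stack, Arcs.total_glueList, Arcs.total_sum]
  simp only [Arcs.total, ← Arcs.two_mul_numDeco] at total_mul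
  omega

theorem numDeco_reduce (d : LDiagram n) : d.reduce.toArcs.numDeco % 2 = d.toArcs.numDeco % 2 := by
  have sum_eq : ∑ v, d.deco v = ∑ v, d.reduce.deco v + 2 * ∑ v, d.deco v / 2 := by
    rw [Finset.mul_sum, ← Finset.sum_add_distrib]
    exact Finset.sum_congr rfl fun v _ => (Nat.mod_add_div _ 2).symm
  obtain ⟨c, hc⟩ := d.toArcs.even_sum (fun v => d.deco v / 2) (fun v => by rw [d.deco_mate])
    (fun v hv => absurd hv (d.no_free v))
  rw [← Arcs.two_mul_numDeco, ← Arcs.two_mul_numDeco] at sum_eq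
  omega

theorem IsTypeII.mul_reduce {d e : LDiagram n} (hd : d.IsTypeII) (he : e.IsTypeII)
    (h : ∀ m ∈ (d * e).loops, m % 2 = 0) : (d * e).reduce.IsTypeII where
  loops := rfl
  deco_le := (d * e).reduce_isReduced.2
  even := by
    have loops_even : 2 ∣ (d * e).loops.sum :=
      Multiset.dvd_sum fun m hm => Nat.dvd_of_mod_eq_zero (h m hm)
    have deco_add := numDeco_mul d e
    rw [hd.loops, he.loops, Multiset.sum_zero, add_zero, add_zero] at deco_add
    have deco_even := hd.even.add he.even
    rw [← deco_add, Nat.even_add, even_iff_two_dvd (a := (d * e).loops.sum)] at deco_even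
    rw [Nat.even_iff, numDeco_reduce, ← Nat.even_iff]
    exact deco_even.2 loops_even

theorem one_isTypeII : (1 : LDiagram n).IsTypeII where
  loops := rfl
  deco_le _ := Nat.zero_le 1
  even := by
    have deco_eq : ∀ v, (1 : LDiagram n).deco v = 0 := fun _ => rfl
    simp [Arcs.numDeco, deco_eq]

theorem cupCap_isTypeII (i : ℕ) (hi : i + 1 < n) (m : ℕ) (hm : m ≠ 0 → i = 0) (h : m ≤ 1) :
    (cupCap i hi m hm).IsTypeII where
  loops := rfl
  deco_le := by
    rintro (j | j) <;> simp only [cupCap, Sum.elim_inl, Sum.elim_inr] <;> split_ifs <;> omega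
  even := by
    have deco_eq (j : Fin n) : (if (j : ℕ) = i ∨ (j : ℕ) = i + 1 then m else 0) =
        (if j = ⟨i, by omega⟩ then m else 0) + (if j = ⟨i + 1, hi⟩ then m else 0) := by
      simp only [Fin.ext_iff]
      grind
    have sum_eq : ∑ v, (cupCap i hi m hm).deco v = 2 * (m + m) := by
      simp only [Fintype.sum_sum_type, cupCap, Sum.elim_inl, Sum.elim_inr, deco_eq,
        Finset.sum_add_distrib, Finset.sum_ite_eq', Finset.mem_univ, if_true]
      ring
    rw [Arcs.numDeco, sum_eq, Nat.mul_div_cancel_left _ two_pos]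
    exact ⟨m, rfl⟩

end Parity

section Flip

/-- Top-bottom inversion of two boxes on top of each other. -/
def flipTwo (k : ℕ) (v : Node k ⊕ Node k) : Node k ⊕ Node k := (Sum.map Sum.swap Sum.swap v).swap

theorem flipTwo_involutive (k : ℕ) : Function.Involutive (flipTwo k) := by
  rintro ((v | v) | (v | v)) <;> rfl

theorem flipTwo_isPush_glueList (l : List (Fin n)) {A B : Arcs (Node n ⊕ Node n)}
    (h : Arcs.IsPush (flipTwo n) A B) :
    Arcs.IsPush (flipTwo n) (A.glueList (l.map (seam n))) (B.glueList (l.map (seam n))) := by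
  induction l generalizing A B with
  | nil => exact h
  | cons i _ ih =>
    have glue_isPush := h.glue (flipTwo_involutive n).injective (seam n i).1 (seam n i).2
    rw [Arcs.glue_symm B] at glue_isPush
    exact ih glue_isPush

theorem flip_isPush (d : LDiagram n) : Arcs.IsPush Sum.swap d.flip.toArcs d.toArcs :=
  ⟨fun v => by simp [LDiagram.flip], fun _ => rfl, fun w hw => absurd ⟨w.swap, Sum.swap_swap w⟩ hw,
    rfl⟩

theorem flip_mul (d e : LDiagram n) : (d * e).flip = e.flip * d.flip := by
  have sum_isPush : Arcs.IsPush (flipTwo n) (d.toArcs.sum e.toArcs)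
      (e.flip.toArcs.sum d.flip.toArcs) := by
    refine ⟨?_, ?_, fun w hw => absurd ((flipTwo_involutive n).surjective w) hw, add_comm _ _⟩ <;>
      rintro (v | v) <;> simp [flipTwo, Arcs.sum, LDiagram.flip]
  have isPush_stack := (flip_isPush (d * e)).trans
    ((mul_isPush d e).trans (flipTwo_isPush_glueList (List.finRange n) sum_isPush))
  have outer_eq : (flipTwo n ∘ outer) ∘ Sum.swap = outer := by
    funext v
    rcases v with v | v <;> rfl
  rw [outer_eq] at isPush_stack
  exact ext_arcs (Arcs.IsPush.unique outer_injective isPush_stack (mul_isPush e.flip d.flip))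

theorem flip_flip (d : LDiagram n) : d.flip.flip = d :=
  ext_data (funext fun v => by simp [LDiagram.flip]) (fun v => by simp [LDiagram.flip]) rfl

end Flip

end LDiagram

namespace Arcs

/-- `B` is obtained from `A` by gluing the two ends `x` and `y` of an arc to the ends `p` and `q` of
two other arcs, which thereby become a single arc. -/
structure IsBridging {V : Type*} [DecidableEq V] (A B : Arcs V) (x y p q : V) : Prop where
  mate : ∀ v, B.mate v = if v = x ∨ v = y ∨ v = p ∨ v = q then v
      else if v = A.mate p then A.mate q else if v = A.mate q then A.mate p else A.mate v
  deco : ∀ v, B.deco v = if v = x ∨ v = y ∨ v = p ∨ v = q then 0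
      else if v = A.mate p ∨ v = A.mate q then A.deco x + A.deco p + A.deco q else A.deco v
  loops : B.loops = A.loops

theorem isBridging_glue_glue {V : Type*} [DecidableEq V] (A : Arcs V) {x y p q : V}
    (hxy : A.mate x = y) (hnodup : [x, y, p, q].Nodup)
    (hp : A.mate p ≠ p) (hq : A.mate q ≠ q) (hmpq : A.mate p ≠ q) :
    A.IsBridging ((A.glue x p).glue y q) x y p q := by
  simp only [List.nodup_cons, List.mem_cons, List.not_mem_nil, or_false, not_or, not_false_eq_true,
    List.nodup_nil, and_true] at hnodup
  obtain ⟨⟨hne, hpx, hqx⟩, ⟨hpy, hqy⟩, hpq⟩ := hnodup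
  have mate_x := A.mate_mate x
  have mate_p := A.mate_mate p
  have mate_q := A.mate_mate q
  have gluable_x : A.Gluable x p := ⟨hpx, by rwa [hxy, ne_comm], hp⟩
  have glue_y : (A.glue x p).mate y = A.mate p := by
    rw [glue_mate A x p gluable_x]
    grind
  have glue_q : (A.glue x p).mate q = A.mate q := by
    rw [glue_mate A x p gluable_x]
    grind
  have gluable_y : (A.glue x p).Gluable y q := ⟨hqy, by grind, by rwa [glue_q]⟩
  constructor
  · intro v
    rw [glue_mate _ y q gluable_y, glue_y, glue_q, glue_mate A x p gluable_x]
    grind [A.mate_mate v]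
  · intro v
    rw [glue_deco _ y q gluable_y, glue_y, glue_q]
    simp only [glue_deco A x p gluable_x]
    grind [A.mate_mate v]
  · rw [glue_loops _ y q gluable_y, glue_y, glue_loops A x p gluable_x]
    grind

end Arcs

namespace LDiagram

variable {n : ℕ}

theorem glueList_seam_perm (A : Arcs (Node n ⊕ Node n)) {l m : List (Fin n)} (h : l.Perm m)
    (hl : l.Nodup) : A.glueList (l.map (seam n)) = A.glueList (m.map (seam n)) := by
  induction h generalizing A with
  | nil => rfl
  | cons i _ ih => exact ih _ (List.nodup_cons.1 hl).2
  | swap i j l =>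
    have hij : i ≠ j := by
      rintro rfl
      simp at hl
    simp only [List.map_cons, Arcs.glueList_cons]
    rw [Arcs.glue_comm] <;> simp [seam, hij.symm]
  | trans hlk _ ihl ihm => exact (ihl A hl).trans (ihm A (hlk.nodup_iff.1 hl))

/-- The edges `{p, a}` and `{q, b}` of `e` are replaced in `d` by an edge `{p, q}` with `m`
decorations and an edge `{a, b}` that carries these `m` and those of `{p, a}` and `{q, b}`. The
decorations are counted modulo `2`. -/
structure IsCapping (d e : LDiagram n) (p q a b : Node n) (m : ℕ) : Prop where
  mate_p : d.mate p = q
  mate_a : d.mate a = b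
  cut_p : e.mate p = a
  cut_q : e.mate q = b
  ne_q : a ≠ q
  mate_eq : ∀ v, v ≠ p → v ≠ q → v ≠ a → v ≠ b → d.mate v = e.mate v
  deco_p : d.deco p % 2 = m % 2
  deco_a : d.deco a % 2 = (m + e.deco p + e.deco q) % 2
  deco_eq : ∀ v, v ≠ p → v ≠ q → v ≠ a → v ≠ b → d.deco v % 2 = e.deco v % 2
  loops : e.loops = d.loops

namespace IsCapping

variable {d e : LDiagram n} {p q a b : Node n} {i m : ℕ}

theorem isBridging_cupCap (hi : i + 1 < n) (hm : m ≠ 0 → i = 0) (e : LDiagram n)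
    (he : e.mate (Sum.inl ⟨i, by omega⟩) ≠ Sum.inl ⟨i + 1, hi⟩) :
    ((cupCap i hi m hm).toArcs.sum e.toArcs).IsBridging
      (((cupCap i hi m hm).toArcs.sum e.toArcs).glueList
        ([⟨i, by omega⟩, ⟨i + 1, hi⟩].map (seam n)))
      (Sum.inl (Sum.inr ⟨i, by omega⟩)) (Sum.inl (Sum.inr ⟨i + 1, hi⟩))
      (Sum.inr (Sum.inl ⟨i, by omega⟩)) (Sum.inr (Sum.inl ⟨i + 1, hi⟩)) := by
  apply Arcs.isBridging_glue_glue <;> simp [seam, Arcs.sum, cupCap, e.no_free, he]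

theorem isBridging_one (hi : i + 1 < n) (d : LDiagram n)
    (hd : d.mate (Sum.inl ⟨i, by omega⟩) = Sum.inl ⟨i + 1, hi⟩) :
    ((1 : LDiagram n).toArcs.sum d.toArcs).IsBridging
      (((1 : LDiagram n).toArcs.sum d.toArcs).glueList
        ([⟨i, by omega⟩, ⟨i + 1, hi⟩].map (seam n)))
      (Sum.inr (Sum.inl ⟨i, by omega⟩)) (Sum.inr (Sum.inl ⟨i + 1, hi⟩))
      (Sum.inl (Sum.inr ⟨i, by omega⟩)) (Sum.inl (Sum.inr ⟨i + 1, hi⟩)) := by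
  have one_mate : ∀ v : Node n, (1 : LDiagram n).mate v = v.swap := fun _ => rfl
  simp only [List.map_cons, List.map_nil, Arcs.glueList_cons, Arcs.glueList_nil]
  rw [Arcs.glue_symm _ (seam n ⟨i, by omega⟩).1, Arcs.glue_symm _ (seam n ⟨i + 1, hi⟩).1]
  apply Arcs.isBridging_glue_glue <;> simp [seam, Arcs.sum, one_mate, hd]

/-- Capping the strands of `1` with the arc `{p, q}` of `d` gives an arc of the north face, which is
also the north arc of `cupCap`; the south arc of `cupCap` joins the edges of `e` at `p` and `q`. -/
theorem modTwo_glue (hi : i + 1 < n) (hm : m ≠ 0 → i = 0)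
    (h : IsCapping d e (Sum.inl ⟨i, by omega⟩) (Sum.inl ⟨i + 1, hi⟩) a b m) :
    Arcs.ModTwo
      (((cupCap i hi m hm).toArcs.sum e.toArcs).glueList
        ([⟨i, by omega⟩, ⟨i + 1, hi⟩].map (seam n)))
      (((1 : LDiagram n).toArcs.sum d.toArcs).glueList
        ([⟨i, by omega⟩, ⟨i + 1, hi⟩].map (seam n))) 0 := by
  have one_mate : ∀ v : Node n, (1 : LDiagram n).mate v = v.swap := fun _ => rfl
  have one_deco : ∀ v : Node n, (1 : LDiagram n).deco v = 0 := fun _ => rfl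
  have one_loops : (1 : LDiagram n).loops = 0 := rfl
  have bridging_e := isBridging_cupCap hi hm e (by rw [h.cut_p]; exact h.ne_q)
  have bridging_d := isBridging_one hi d h.mate_p
  refine ⟨funext fun v => ?_, fun v => ?_, ?_⟩
  · have mate_b := d.mate_mate a
    rw [bridging_e.mate, bridging_d.mate]
    rcases v with (j | j) | v <;>
      simp only [Arcs.sum, cupCap, one_mate, h.cut_p, h.cut_q, Sum.map_inl, Sum.map_inr,
        Sum.elim_inl, Sum.swap_inl, Sum.swap_inr, Sum.inl.injEq, Sum.inr.injEq, Fin.ext_iff,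
        reduceCtorEq]
    · grind
    · grind
    · grind [h.mate_eq v, h.mate_a]
  · have deco_b := d.deco_mate a
    rw [bridging_e.deco, bridging_d.deco]
    rcases v with (j | j) | v <;>
      simp only [Arcs.sum, cupCap, one_mate, one_deco, h.cut_p, h.cut_q, Sum.map_inl,
        Sum.map_inr, Sum.elim_inl, Sum.elim_inr, Sum.swap_inr, Sum.inl.injEq, Sum.inr.injEq,
        Fin.ext_iff, reduceCtorEq]
    · grind [h.deco_p]
    · grind
    · grind [h.deco_a, h.deco_eq v, h.mate_a]
  · rw [bridging_e.loops, bridging_d.loops]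
    simp only [Arcs.sum, cupCap, one_loops, h.loops, Multiset.zero_add, Multiset.add_zero]

theorem modTwo_mul (hi : i + 1 < n) (hm : m ≠ 0 → i = 0)
    (h : IsCapping d e (Sum.inl ⟨i, by omega⟩) (Sum.inl ⟨i + 1, hi⟩) a b m) :
    Arcs.ModTwo (cupCap i hi m hm * e).toArcs d.toArcs 0 := by
  have perm : (List.finRange n).Perm (⟨i, by omega⟩ :: ⟨i + 1, hi⟩ ::
      ((List.finRange n).erase ⟨i, by omega⟩).erase ⟨i + 1, hi⟩) :=
    (List.perm_cons_erase (List.mem_finRange _)).trans <| .cons _ <| List.perm_cons_erase <|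
      (List.mem_erase_of_ne (by simp)).2 (List.mem_finRange _)
  have modTwo_stack : Arcs.ModTwo (stack (cupCap i hi m hm).toArcs e.toArcs)
      (stack (1 : LDiagram n).toArcs d.toArcs) 0 := by
    unfold stack
    rw [glueList_seam_perm _ perm (List.nodup_finRange n),
      glueList_seam_perm _ perm (List.nodup_finRange n)]
    exact (h.modTwo_glue hi hm).glueList _
  simpa only [one_mul] using modTwo_of_stack modTwo_stack

theorem of_eq_mul (hi : i + 1 < n) (hm : m ≠ 0 → i = 0) (hd : d.loops = 0)
    (h : IsCapping d e (Sum.inl ⟨i, by omega⟩) (Sum.inl ⟨i + 1, hi⟩) a b m) :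
    PHat.of d = PHat.of (cupCap i hi m hm) * PHat.of e := by
  rw [← PHat.of_mul]
  exact (PHat.of_congr (h.modTwo_mul hi hm) (by simp [hd])).symm

end IsCapping

end LDiagram

theorem Arcs.eq_or_eq_mate_of_exposed_of_no_north {n : ℕ} {A : Arcs (Node n)}
    (hexposed : A.Exposed pos) (hN : ∀ i j, A.mate (Sum.inl i) ≠ Sum.inl j) {u v : Node n}
    (hu : A.deco u ≠ 0) (hv : A.deco v ≠ 0) : u = v ∨ u = A.mate v := by
  have not_lt_of_deco : ∀ i j, A.deco (Sum.inl i) ≠ 0 → A.deco (Sum.inl j) ≠ 0 → ¬ i < j := by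
    intro i j _ hj hij
    rcases hi : A.mate (Sum.inl i) with k | k
    · exact hN i k hi
    · have exposed_j := hexposed (Sum.inl j) hj (Sum.inl i)
      simp only [hi, pos_inl, pos_inr] at exposed_j
      omega
  have exists_north : ∀ w : Node n, A.deco w ≠ 0 →
      ∃ i, A.deco (Sum.inl i) ≠ 0 ∧ (w = Sum.inl i ∨ w = A.mate (Sum.inl i)) := by
    rintro (i | i) hw
    · exact ⟨i, hw, Or.inl rfl⟩
    · rcases hi : A.mate (Sum.inr i) with k | k
      · exact ⟨k, by rwa [← hi, A.deco_mate], Or.inr (by rw [← hi, A.mate_mate])⟩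
      · exact absurd hi (no_south_of_no_north hN i k)
  obtain ⟨i, hi, hui⟩ := exists_north u hu
  obtain ⟨j, hj, hvj⟩ := exists_north v hv
  obtain rfl : i = j := le_antisymm (not_lt.1 (not_lt_of_deco j i hj hi))
    (not_lt.1 (not_lt_of_deco i j hi hj))
  grind [A.mate_mate]

/-- If all edges are propagating then only the leftmost one is exposed. -/
theorem Arcs.deco_eq_zero_of_no_north {n : ℕ} {A : Arcs (Node n)} (no_free : ∀ v, A.mate v ≠ v)
    (hexposed : A.Exposed pos) (deco_le : ∀ v, A.deco v ≤ 1) (heven : Even A.numDeco)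
    (hN : ∀ i j, A.mate (Sum.inl i) ≠ Sum.inl j) (v : Node n) : A.deco v = 0 := by
  by_contra hv
  have sum_deco : ∑ u, A.deco u = A.deco v + A.deco (A.mate v) := by
    refine Fintype.sum_eq_add v (A.mate v) (no_free v).symm fun u hu => ?_
    by_contra deco_u
    rcases Arcs.eq_or_eq_mate_of_exposed_of_no_north hexposed hN deco_u hv with h | h
    exacts [hu.1 h, hu.2 h]
  have two_mul_numDeco := A.two_mul_numDeco
  rw [sum_deco, A.deco_mate] at two_mul_numDeco
  have deco_v := deco_le v
  rw [Nat.even_iff] at heven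
  omega

/-- The arcs obtained by moving the ends of all arcs along a permutation of the nodes. -/
def Arcs.permute {V : Type*} (A : Arcs V) (σ : Equiv.Perm V) : Arcs V where
  mate v := σ (A.mate (σ.symm v))
  deco v := A.deco (σ.symm v)
  loops := A.loops
  mate_mate v := by simp [A.mate_mate]
  deco_mate v := by simp [A.deco_mate]
  deco_free v hv := A.deco_free _ (σ.injective (by simpa using hv))

theorem Arcs.permute_mate_ne {V : Type*} {A : Arcs V} (no_free : ∀ v, A.mate v ≠ v)
    (σ : Equiv.Perm V) (v : V) : (A.permute σ).mate v ≠ v := fun hv =>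
  no_free _ ((Equiv.eq_symm_apply σ).2 hv)

theorem Arcs.numDeco_permute {n : ℕ} (A : Arcs (Node n)) (σ : Equiv.Perm (Node n)) :
    (A.permute σ).numDeco = A.numDeco := by
  unfold Arcs.numDeco
  exact congrArg (· / 2) (Equiv.sum_comp σ.symm A.deco)

namespace LDiagram

variable {n : ℕ}

theorem mate_inl_of_no_north {d : LDiagram n} (hN : ∀ i j, d.mate (Sum.inl i) ≠ Sum.inl j)
    (i : Fin n) : d.mate (Sum.inl i) = Sum.inr i := by
  have exists_south : ∀ i, ∃ j, d.mate (Sum.inl i) = Sum.inr j := by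
    intro i
    rcases hi : d.mate (Sum.inl i) with j | j
    · exact absurd hi (hN i j)
    · exact ⟨j, rfl⟩
  choose f hf using exists_south
  have f_injective : f.Injective := by
    intro i j hij
    have mate_eq : d.mate (Sum.inl i) = d.mate (Sum.inl j) := by rw [hf, hf, hij]
    exact Sum.inl_injective (by rw [← d.mate_mate (Sum.inl i), mate_eq, d.mate_mate])
  have f_strictMono : StrictMono f := by
    intro i j hij
    have planar := d.planar (Sum.inl i) (Sum.inl j)
    simp only [hf, pos_inl, pos_inr] at planar
    have f_ne : (f i : ℕ) ≠ f j := fun h => hij.ne (f_injective (Fin.ext h))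
    rw [Fin.lt_def] at hij ⊢
    omega
  have f_eq : f_strictMono.orderIsoOfSurjective f (Finite.surjective_of_injective f_injective) =
      OrderIso.refl _ := Subsingleton.elim _ _
  rw [hf]
  exact congrArg Sum.inr (DFunLike.congr_fun f_eq i)

theorem eq_one_of_no_north {d : LDiagram n} (hN : ∀ i j, d.mate (Sum.inl i) ≠ Sum.inl j)
    (hloops : d.loops = 0) : d = 1 := by
  refine ext_data (funext fun v => ?_) (fun v => (d.undecorated hN).1 v) hloops
  change d.mate v = v.swap
  rcases v with i | i
  · exact mate_inl_of_no_north hN i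
  · rw [← mate_inl_of_no_north hN i, d.mate_mate, mate_inl_of_no_north hN i]
    rfl

/-- The arcs `{p, q}`, between neighbouring positions, and `{a, b}` can be rerouted into arcs
`{p, a}` and `{q, b}` without crossing another arc (`covers_a`, `covers_b`) and without covering a
decoration (`exposed_between`). -/
structure CanReroute (d : LDiagram n) (p q a b : Node n) : Prop where
  mate_p : d.mate p = q
  mate_a : d.mate a = b
  deco_p : d.deco p = 0
  succ : pos q = pos p + 1
  ne_p : a ≠ p
  ne_q : a ≠ q
  order : (pos a < pos p ∧ pos q < pos b) ∨ (pos q < pos b ∧ pos b < pos a)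
  covers_a : ∀ u, u ≠ p → u ≠ q → u ≠ a → u ≠ b →
    ((pos u < pos p ∧ pos p < pos (d.mate u)) ↔ (pos u < pos a ∧ pos a < pos (d.mate u)))
  covers_b : ∀ u, u ≠ p → u ≠ q → u ≠ a → u ≠ b →
    ((pos u < pos p ∧ pos p < pos (d.mate u)) ↔ (pos u < pos b ∧ pos b < pos (d.mate u)))
  exposed_between : ∀ v, d.deco v ≠ 0 → v ≠ a → v ≠ b → ¬ (pos q < pos v ∧ pos v < pos a)

namespace CanReroute

variable {d : LDiagram n} {p q a b : Node n}

theorem mate_q (h : CanReroute d p q a b) : d.mate q = p := by rw [← h.mate_p, d.mate_mate]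

theorem mate_b (h : CanReroute d p q a b) : d.mate b = a := by rw [← h.mate_a, d.mate_mate]

theorem deco_b (h : CanReroute d p q a b) : d.deco b = d.deco a := by rw [← h.mate_a, d.deco_mate]

theorem deco_q (h : CanReroute d p q a b) : d.deco q = 0 := by
  rw [← h.mate_p, d.deco_mate, h.deco_p]

theorem pairwise_ne (h : CanReroute d p q a b) :
    p ≠ q ∧ p ≠ a ∧ p ≠ b ∧ q ≠ a ∧ q ≠ b ∧ a ≠ b := by
  grind [h.mate_p, h.mate_a, h.mate_q, h.mate_b, h.ne_p, h.ne_q, d.no_free p, d.no_free a]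

theorem permute_cases (h : CanReroute d p q a b) (u : Node n) :
    (u = p ∧ (d.permute (Equiv.swap p b)).mate u = a ∧
      (d.permute (Equiv.swap p b)).deco u = d.deco a) ∨
    (u = a ∧ (d.permute (Equiv.swap p b)).mate u = p ∧
      (d.permute (Equiv.swap p b)).deco u = d.deco a) ∨
    (u = q ∧ (d.permute (Equiv.swap p b)).mate u = b ∧
      (d.permute (Equiv.swap p b)).deco u = 0) ∨
    (u = b ∧ (d.permute (Equiv.swap p b)).mate u = q ∧
      (d.permute (Equiv.swap p b)).deco u = 0) ∨
    ((u ≠ p ∧ u ≠ q ∧ u ≠ a ∧ u ≠ b) ∧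
      (d.permute (Equiv.swap p b)).mate u = d.mate u ∧
      (d.permute (Equiv.swap p b)).deco u = d.deco u) := by
  obtain ⟨hpq, hpa, hpb, hqa, hqb, hab⟩ := h.pairwise_ne
  have mate_mate := d.mate_mate u
  simp only [Arcs.permute, Equiv.symm_swap]
  by_cases hup : u = p
  · simp [hup, h.mate_b, h.deco_b, Equiv.swap_apply_of_ne_of_ne hpa.symm hab]
  by_cases hub : u = b
  · simp [hub, h.mate_p, h.deco_p, Equiv.swap_apply_of_ne_of_ne hpq.symm hqb]
  rw [Equiv.swap_apply_of_ne_of_ne hup hub, Equiv.swap_apply_def]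
  grind [h.mate_p, h.mate_a, h.mate_q, h.mate_b, h.deco_q]

theorem pos_of_untouched (h : CanReroute d p q a b) {u : Node n}
    (hu : u ≠ p ∧ u ≠ q ∧ u ≠ a ∧ u ≠ b) :
    (pos u ≠ pos p ∧ pos u ≠ pos q ∧ pos u ≠ pos a ∧ pos u ≠ pos b) ∧
      (pos (d.mate u) ≠ pos p ∧ pos (d.mate u) ≠ pos q ∧ pos (d.mate u) ≠ pos a ∧
        pos (d.mate u) ≠ pos b) ∧
      ((pos u < pos p ∧ pos p < pos (d.mate u)) ↔ (pos u < pos a ∧ pos a < pos (d.mate u))) ∧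
      ((pos u < pos p ∧ pos p < pos (d.mate u)) ↔ (pos u < pos b ∧ pos b < pos (d.mate u))) := by
  have mate_ne : d.mate u ≠ p ∧ d.mate u ≠ q ∧ d.mate u ≠ a ∧ d.mate u ≠ b := by
    grind [h.mate_p, h.mate_a, h.mate_q, h.mate_b, d.mate_mate u]
  simp only [pos_injective.ne_iff]
  exact ⟨hu, mate_ne, h.covers_a u hu.1 hu.2.1 hu.2.2.1 hu.2.2.2,
    h.covers_b u hu.1 hu.2.1 hu.2.2.1 hu.2.2.2⟩

theorem nonCrossing (h : CanReroute d p q a b) : (d.permute (Equiv.swap p b)).NonCrossing pos := by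
  have order := h.order
  have succ := h.succ
  intro u v
  rcases h.permute_cases u with
    ⟨rfl, hu, -⟩ | ⟨rfl, hu, -⟩ | ⟨rfl, hu, -⟩ | ⟨rfl, hu, -⟩ | ⟨hu_ne, hu, -⟩ <;>
  rcases h.permute_cases v with
    ⟨rfl, hv, -⟩ | ⟨rfl, hv, -⟩ | ⟨rfl, hv, -⟩ | ⟨rfl, hv, -⟩ | ⟨hv_ne, hv, -⟩ <;>
  simp only [hu, hv]
  all_goals try have pos_u := h.pos_of_untouched hu_ne
  all_goals try have pos_v := h.pos_of_untouched hv_ne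
  all_goals first | omega | exact d.planar u v

theorem exposed (h : CanReroute d p q a b) : (d.permute (Equiv.swap p b)).Exposed pos := by
  have order := h.order
  have succ := h.succ
  intro v deco_v u
  rcases h.permute_cases v with
    ⟨rfl, -, hv⟩ | ⟨rfl, -, hv⟩ | ⟨rfl, -, hv⟩ | ⟨rfl, -, hv⟩ | ⟨hv_ne, -, hv⟩ <;>
  rw [hv] at deco_v
  rotate_left 2
  · exact absurd rfl deco_v
  · exact absurd rfl deco_v
  · have exposed_v := d.exposed v deco_v
    have not_below_a := exposed_v a
    have not_below_b := exposed_v b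
    rw [h.mate_a] at not_below_a
    rw [h.mate_b] at not_below_b
    have between := h.exposed_between v deco_v hv_ne.2.2.1 hv_ne.2.2.2
    have pos_v := h.pos_of_untouched hv_ne
    rcases h.permute_cases u with
      ⟨rfl, hu, -⟩ | ⟨rfl, hu, -⟩ | ⟨rfl, hu, -⟩ | ⟨rfl, hu, -⟩ | ⟨-, hu, -⟩ <;> rw [hu]
    all_goals first | omega | exact exposed_v u
  all_goals
    have exposed_u := d.exposed _ deco_v u
    rcases h.permute_cases u with
      ⟨rfl, hu, -⟩ | ⟨rfl, hu, -⟩ | ⟨rfl, hu, -⟩ | ⟨rfl, hu, -⟩ | ⟨hu_ne, hu, -⟩ <;> rw [hu]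
    on_goal 5 => have pos_u := h.pos_of_untouched hu_ne
    all_goals omega

end CanReroute

/-- The diagram obtained by exchanging the ends `p` and `b`, so that the arcs `{p, q}` and `{a, b}`
become `{p, a}` and `{q, b}`. -/
def reroute (d : LDiagram n) (hd : d.IsTypeII) (p q a b : Node n) (h : CanReroute d p q a b) :
    LDiagram n where
  toArcs := d.permute (Equiv.swap p b)
  no_free := Arcs.permute_mate_ne d.no_free _
  planar := h.nonCrossing
  exposed := h.exposed
  undecorated hN := by
    refine ⟨Arcs.deco_eq_zero_of_no_north (Arcs.permute_mate_ne d.no_free _) h.exposed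
      (fun v => hd.deco_le _) ?_ hN, fun m hm => absurd hm ?_⟩
    · rw [Arcs.numDeco_permute]
      exact hd.even
    · simp [Arcs.permute, hd.loops]

theorem reroute_isTypeII {d : LDiagram n} (hd : d.IsTypeII) {p q a b : Node n}
    (h : CanReroute d p q a b) : (d.reroute hd p q a b h).IsTypeII where
  loops := hd.loops
  deco_le v := hd.deco_le _
  even := by
    change Even (d.permute (Equiv.swap p b)).numDeco
    rw [Arcs.numDeco_permute]
    exact hd.even

theorem CanReroute.isCapping {d : LDiagram n} (hd : d.IsTypeII) {p q a b : Node n}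
    (h : CanReroute d p q a b) : IsCapping d (d.reroute hd p q a b h) p q a b 0 := by
  have hne := h.pairwise_ne
  have permute_cases := h.permute_cases
  constructor
  case cut_p => grind [reroute]
  case cut_q => grind [reroute]
  case mate_eq => grind [reroute]
  case deco_a => grind [reroute, h.deco_p]
  case deco_eq => grind [reroute]
  case loops => rfl
  case deco_p => rw [h.deco_p]
  exacts [h.mate_p, h.mate_a, h.ne_q]

/-- The index of a node on its face. -/
def col : Node n → ℕ := Sum.elim (fun i => (i : ℕ)) (fun i => (i : ℕ))

theorem succ_le_col_iff {i : ℕ} (hi : i + 1 < n) (v : Node n) :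
    i + 1 ≤ col v ↔ i + 1 ≤ pos v ∧ pos v ≤ 2 * n - 2 - i := by
  rcases v with j | j
  · simp only [col, pos_inl, Sum.elim_inl]
    omega
  · simp only [col, pos_inr, Sum.elim_inr]
    omega

theorem even_sum_succ_le_col (n i : ℕ) :
    Even (∑ v : Node n, if i + 1 ≤ col v then 1 else 0) := by
  rw [Fintype.sum_sum_type]
  exact ⟨_, rfl⟩

/-- An odd number of nodes other than `q` lie to the right of the vertical line between the columns
`i` and `i + 1`. -/
theorem exists_crossing (d : LDiagram n) {i : ℕ} {p q : Node n} (hp : col p = i)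
    (hq : col q = i + 1) (hpq : d.mate p = q) :
    ∃ v, v ≠ q ∧ i + 1 ≤ col v ∧ col (d.mate v) ≤ i := by
  by_contra! not_crossing
  have mate_q : d.mate q = p := by rw [← hpq, d.mate_mate]
  have even_other := d.toArcs.even_sum (fun v => if v ≠ q ∧ i + 1 ≤ col v then 1 else 0)
    (fun v => by
      have not_crossing_v := not_crossing v
      have not_crossing_mate := not_crossing (d.mate v)
      grind [d.mate_mate v])
    (fun v hv => absurd hv (d.no_free v))
  have sum_split : ∑ v : Node n, (if i + 1 ≤ col v then 1 else 0) =
      ∑ v, (if v ≠ q ∧ i + 1 ≤ col v then 1 else 0) + 1 := by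
    have indicator_split : ∀ v, (if i + 1 ≤ col v then 1 else 0) =
        (if v ≠ q ∧ i + 1 ≤ col v then 1 else 0) + if v = q then 1 else 0 := by grind
    simp only [indicator_split, Finset.sum_add_distrib, Finset.sum_ite_eq', Finset.mem_univ,
      if_true]
  have even_all := even_sum_succ_le_col n i
  rw [sum_split] at even_all
  exact Nat.not_even_iff_odd.2 even_other.add_one even_all

/-- In the order of `pos`, the node `b` is the first one after position `i + 1` that lies to the
right of the line between the columns `i` and `i + 1`, and whose edge crosses this line or is
decorated. -/
structure IsFirstExit (d : LDiagram n) (i : ℕ) (b : Node n) : Prop where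
  succ_lt_pos : i + 1 < pos b
  succ_le_col : i + 1 ≤ col b
  exit : d.deco b ≠ 0 ∨ col (d.mate b) ≤ i
  first : ∀ v, i + 1 < pos v → pos v < pos b → i + 1 ≤ col (d.mate v) ∧ d.deco v = 0

theorem exists_isFirstExit (d : LDiagram n) {i : ℕ} (hi : i + 1 < n)
    (hmate : d.mate (Sum.inl ⟨i, by omega⟩) = Sum.inl ⟨i + 1, hi⟩) :
    ∃ b, IsFirstExit d i b := by
  let exits : Finset (Node n) := Finset.univ.filter fun v =>
    i + 1 < pos v ∧ i + 1 ≤ col v ∧ (d.deco v ≠ 0 ∨ col (d.mate v) ≤ i)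
  have exits_nonempty : exits.Nonempty := by
    obtain ⟨v, hv, succ_le, mate_le⟩ := d.exists_crossing rfl rfl hmate
    have pos_ne : pos v ≠ i + 1 := fun h => hv (pos_injective h)
    have pos_le := (succ_le_col_iff hi v).1 succ_le
    exact ⟨v, Finset.mem_filter.2 ⟨Finset.mem_univ v, by omega, succ_le, Or.inr mate_le⟩⟩
  obtain ⟨b, hb, hmin⟩ := exits.exists_min_image pos exits_nonempty
  simp only [exits, Finset.mem_filter, Finset.mem_univ, true_and] at hb hmin
  refine ⟨b, hb.1, hb.2.1, hb.2.2, fun v succ_lt lt_b => ?_⟩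
  have pos_le := (succ_le_col_iff hi b).1 hb.2.1
  have succ_le : i + 1 ≤ col v := (succ_le_col_iff hi v).2 ⟨by omega, by omega⟩
  by_contra not_first
  exact absurd (hmin v ⟨succ_lt, succ_le, by omega⟩) (not_le.2 lt_b)

theorem covers_mate_iff (d : LDiagram n) (b u : Node n) :
    (pos u < pos (d.mate b) ∧ pos (d.mate b) < pos (d.mate u)) ↔
      (pos u < pos b ∧ pos b < pos (d.mate u)) := by
  constructor
  · rintro ⟨left, right⟩
    simpa only [d.mate_mate] using d.planar.inside pos_injective left right
  · rintro ⟨left, right⟩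
    exact d.planar.inside pos_injective left right

namespace IsFirstExit

variable {d : LDiagram n} {i : ℕ} {b : Node n}

theorem mate_ne (h : IsFirstExit d i b) (hi : i + 1 < n)
    (hmate : d.mate (Sum.inl ⟨i, by omega⟩) = Sum.inl ⟨i + 1, hi⟩) :
    d.mate b ≠ Sum.inl ⟨i, by omega⟩ ∧ d.mate b ≠ Sum.inl ⟨i + 1, hi⟩ := by
  have succ_lt := h.succ_lt_pos
  constructor <;> intro hb
  · rw [← d.mate_mate b, hb, hmate, pos_inl] at succ_lt
    simp at succ_lt
  · rw [← d.mate_mate b, hb, ← hmate, d.mate_mate, pos_inl] at succ_lt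
    simp at succ_lt

theorem order (h : IsFirstExit d i b) (hi : i + 1 < n)
    (hmate : d.mate (Sum.inl ⟨i, by omega⟩) = Sum.inl ⟨i + 1, hi⟩) :
    (pos (d.mate b) < i ∧ i + 1 < pos b) ∨ (i + 1 < pos b ∧ pos b < pos (d.mate b)) := by
  have succ_lt := h.succ_lt_pos
  have pos_ne := pos_injective.ne (d.no_free b)
  have pos_ne_p := pos_injective.ne (h.mate_ne hi hmate).1
  have pos_ne_q := pos_injective.ne (h.mate_ne hi hmate).2
  simp only [pos_inl] at pos_ne_p pos_ne_q
  by_contra not_order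
  have first := h.first (d.mate b) (by omega) (by omega)
  rw [d.mate_mate, d.deco_mate] at first
  have mate_le : col (d.mate b) ≤ i := h.exit.resolve_left (not_not.2 first.2)
  have pos_le := (succ_le_col_iff hi b).1 h.succ_le_col
  have succ_le_mate := (succ_le_col_iff hi (d.mate b)).2 ⟨by omega, by omega⟩
  omega

theorem covers_iff (h : IsFirstExit d i b) (hi : i + 1 < n)
    (hmate : d.mate (Sum.inl ⟨i, by omega⟩) = Sum.inl ⟨i + 1, hi⟩) {u : Node n}
    (hup : u ≠ Sum.inl ⟨i, by omega⟩) (huq : u ≠ Sum.inl ⟨i + 1, hi⟩) (hua : u ≠ d.mate b) :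
    (pos u < i ∧ i < pos (d.mate u)) ↔ (pos u < pos b ∧ pos b < pos (d.mate u)) := by
  have succ_lt := h.succ_lt_pos
  have pos_le := (succ_le_col_iff hi b).1 h.succ_le_col
  have pos_ne_p := pos_injective.ne hup
  have pos_ne_q := pos_injective.ne huq
  have mate_ne_p : d.mate u ≠ Sum.inl ⟨i, by omega⟩ := fun hu =>
    huq (by rw [← hmate, ← hu, d.mate_mate])
  have mate_ne_q : d.mate u ≠ Sum.inl ⟨i + 1, hi⟩ := fun hu =>
    hup (by rw [← d.mate_mate u, hu, ← hmate, d.mate_mate])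
  have mate_ne_b : d.mate u ≠ b := fun hu => hua (by rw [← hu, d.mate_mate])
  have pos_mate_ne_p := pos_injective.ne mate_ne_p
  have pos_mate_ne_q := pos_injective.ne mate_ne_q
  have pos_mate_ne_b := pos_injective.ne mate_ne_b
  simp only [pos_inl] at pos_ne_p pos_ne_q pos_mate_ne_p pos_mate_ne_q
  constructor
  · rintro ⟨left, right⟩
    refine ⟨by omega, ?_⟩
    by_contra not_right
    have first := (h.first (d.mate u) (by omega) (by omega)).1
    rw [d.mate_mate, succ_le_col_iff hi] at first
    omega
  · rintro ⟨left, right⟩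
    refine ⟨?_, by omega⟩
    by_contra not_left
    have mate_u_le := (succ_le_col_iff hi (d.mate u)).1 (h.first u (by omega) (by omega)).1
    have covers_mate := (covers_mate_iff d b u).2 ⟨left, right⟩
    have succ_le_mate := (succ_le_col_iff hi (d.mate b)).2 ⟨by omega, by omega⟩
    rcases h.exit with hdeco | hcol
    · exact d.exposed b hdeco u ⟨left, right⟩
    · omega

end IsFirstExit

theorem IsFirstExit.canReroute {d : LDiagram n} {i : ℕ} {b : Node n} (h : IsFirstExit d i b)
    (hi : i + 1 < n) (hmate : d.mate (Sum.inl ⟨i, by omega⟩) = Sum.inl ⟨i + 1, hi⟩)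
    (hdeco : d.deco (Sum.inl ⟨i, by omega⟩) = 0) :
    CanReroute d (Sum.inl ⟨i, by omega⟩) (Sum.inl ⟨i + 1, hi⟩) (d.mate b) b where
  mate_p := hmate
  mate_a := d.mate_mate b
  deco_p := hdeco
  succ := rfl
  ne_p := (h.mate_ne hi hmate).1
  ne_q := (h.mate_ne hi hmate).2
  order := h.order hi hmate
  covers_a u hup huq hua _ := (h.covers_iff hi hmate hup huq hua).trans (covers_mate_iff d b u).symm
  covers_b _ hup huq hua _ := h.covers_iff hi hmate hup huq hua
  exposed_between v hv _ hvb hbetween := by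
    rcases (pos_injective.ne hvb).lt_or_gt with hlt | hgt
    · exact hv (h.first v hbetween.1 hlt).2
    · exact d.exposed v hv b ⟨hgt, hbetween.2⟩

theorem exists_canReroute (d : LDiagram n) {i : ℕ} (hi : i + 1 < n)
    (hmate : d.mate (Sum.inl ⟨i, by omega⟩) = Sum.inl ⟨i + 1, hi⟩)
    (hdeco : d.deco (Sum.inl ⟨i, by omega⟩) = 0) :
    ∃ a b, CanReroute d (Sum.inl ⟨i, by omega⟩) (Sum.inl ⟨i + 1, hi⟩) a b ∧ i + 1 ≤ col b ∧
      (d.deco a ≠ 0 ∨ col a ≤ i) := by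
  obtain ⟨b, hb⟩ := d.exists_isFirstExit hi hmate
  exact ⟨d.mate b, b, hb.canReroute hi hmate hdeco, hb.succ_le_col, by
    rw [d.deco_mate]
    exact hb.exit⟩

/-- The cost of an edge, counted at one of its ends. -/
def edgeCost (d : LDiagram n) (v : Node n) : ℕ :=
  if d.deco v = 0 then (col v - col (d.mate v)) + (col (d.mate v) - col v)
  else col v + col (d.mate v)

/-- Twice the total horizontal extent of the edges, where decorated edges are led past the left
wall. It decreases when an arc joining neighbours is factored out. -/
def cost (d : LDiagram n) : ℕ := ∑ v, d.edgeCost v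

theorem cost_reroute_lt {d : LDiagram n} (hd : d.IsTypeII) {p q a b : Node n}
    (h : CanReroute d p q a b) {i : ℕ} (hp : col p = i) (hq : col q = i + 1) (hb : i + 1 ≤ col b)
    (ha : d.deco a ≠ 0 ∨ col a ≤ i) : (d.reroute hd p q a b h).cost < d.cost := by
  obtain ⟨hpq, hpa, hpb, hqa, hqb, hab⟩ := h.pairwise_ne
  have sum_four : ∀ f : Node n → ℕ,
      ∑ v, f v = f p + (f q + (f a + f b)) + ∑ v ∈ {p, q, a, b}ᶜ, f v := fun f => by
    rw [← Finset.sum_add_sum_compl {p, q, a, b}, Finset.sum_insert (by simp [*]),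
      Finset.sum_insert (by simp [*]), Finset.sum_pair hab]
  have sum_other : ∑ v ∈ {p, q, a, b}ᶜ, (d.reroute hd p q a b h).edgeCost v =
      ∑ v ∈ {p, q, a, b}ᶜ, d.edgeCost v := by
    refine Finset.sum_congr rfl fun v hv => ?_
    simp only [Finset.mem_compl, Finset.mem_insert, Finset.mem_singleton, not_or] at hv
    obtain ⟨mate_v, deco_v⟩ : (d.permute (Equiv.swap p b)).mate v = d.mate v ∧
        (d.permute (Equiv.swap p b)).deco v = d.deco v := by
      simpa [hv.1, hv.2.1, hv.2.2.1, hv.2.2.2] using h.permute_cases v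
    simp only [edgeCost, reroute, mate_v, deco_v]
  rw [cost, cost, sum_four, sum_four, sum_other]
  have cut : (d.reroute hd p q a b h).mate p = a ∧ (d.reroute hd p q a b h).deco p = d.deco a ∧
      (d.reroute hd p q a b h).mate q = b ∧ (d.reroute hd p q a b h).deco q = 0 ∧
      (d.reroute hd p q a b h).mate a = p ∧ (d.reroute hd p q a b h).deco a = d.deco a ∧
      (d.reroute hd p q a b h).mate b = q ∧ (d.reroute hd p q a b h).deco b = 0 := by
    grind [reroute, h.permute_cases]
  simp only [edgeCost, cut, h.mate_p, h.mate_q, h.mate_a, h.mate_b, h.deco_p, h.deco_q, h.deco_b,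
    hp, hq, if_true]
  split_ifs <;> omega

theorem exists_neighbours_of_north (d : LDiagram n) {j k : Fin n} (hjk : j < k)
    (h : d.mate (Sum.inl j) = Sum.inl k) : ∃ (i : ℕ) (hi : i + 1 < n), j ≤ i ∧ i + 1 ≤ k ∧
      d.mate (Sum.inl ⟨i, by omega⟩) = Sum.inl ⟨i + 1, hi⟩ := by
  induction hN : (k : ℕ) - j using Nat.strong_induction_on generalizing j k with
  | _ N ih =>
    rw [Fin.lt_def] at hjk
    by_cases hk : (k : ℕ) = j + 1
    · exact ⟨j, by omega, le_rfl, hk.ge, h.trans (congrArg Sum.inl (Fin.ext hk))⟩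
    · obtain ⟨u, hu⟩ : ∃ u : Fin n, (u : ℕ) = j + 1 := ⟨⟨j + 1, by omega⟩, rfl⟩
      have inside := d.planar.inside pos_injective (u := Sum.inl j) (w := Sum.inl u)
        (by simp only [pos_inl]; omega) (by rw [h]; simp only [pos_inl]; omega)
      have pos_ne := pos_injective.ne (d.no_free (Sum.inl u))
      rcases hw : d.mate (Sum.inl u) with w | w <;> rw [hw] at inside pos_ne <;>
        simp only [h, pos_inl, pos_inr] at inside pos_ne
      · obtain ⟨i, hi, u_le, le_w, mate_i⟩ :=
          ih (w - u) (by omega) (j := u) (k := w) (Fin.lt_def.2 (by omega)) hw rfl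
        exact ⟨i, hi, by omega, by omega, mate_i⟩
      · omega

theorem exists_neighbours (d : LDiagram n) {j k : Fin n} (h : d.mate (Sum.inl j) = Sum.inl k) :
    ∃ (i : ℕ) (hi : i + 1 < n), d.mate (Sum.inl ⟨i, by omega⟩) = Sum.inl ⟨i + 1, hi⟩ := by
  rcases lt_trichotomy j k with hjk | rfl | hkj
  · obtain ⟨i, hi, -, -, mate_i⟩ := d.exists_neighbours_of_north hjk h
    exact ⟨i, hi, mate_i⟩
  · exact absurd h (d.no_free _)
  · obtain ⟨i, hi, -, -, mate_i⟩ := d.exists_neighbours_of_north hkj (by rw [← h, d.mate_mate])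
    exact ⟨i, hi, mate_i⟩

/-- The leftmost arc joining neighbours works: if it is decorated then its left neighbour, not being
covered by a propagating edge, is the right end of another arc. -/
theorem exists_neighbours_undecorated_or_first (d : LDiagram n) {j k : Fin n}
    (h : d.mate (Sum.inl j) = Sum.inl k) :
    ∃ (i : ℕ) (hi : i + 1 < n), d.mate (Sum.inl ⟨i, by omega⟩) = Sum.inl ⟨i + 1, hi⟩ ∧
      (d.deco (Sum.inl ⟨i, by omega⟩) = 0 ∨ i = 0) := by
  classical
  have exists_i := d.exists_neighbours h
  obtain ⟨hi, mate_i⟩ := Nat.find_spec exists_i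
  refine ⟨Nat.find exists_i, hi, mate_i, ?_⟩
  have not_earlier := fun {m} (hm : m < Nat.find exists_i) => Nat.find_min exists_i hm
  generalize Nat.find exists_i = i at hi mate_i not_earlier
  by_contra! hdeco
  obtain ⟨u, hu⟩ : ∃ u : Fin n, (u : ℕ) + 1 = i := ⟨⟨i - 1, by omega⟩, Nat.succ_pred hdeco.2⟩
  have exposed := d.exposed _ hdeco.1 (Sum.inl u)
  have pos_ne := pos_injective.ne (d.no_free (Sum.inl u))
  rcases hw : d.mate (Sum.inl u) with w | w <;> rw [hw] at exposed pos_ne <;>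
    simp only [pos_inl, pos_inr] at exposed pos_ne
  · have mate_w : d.mate (Sum.inl w) = Sum.inl u := by rw [← hw, d.mate_mate]
    have w_ne : (w : ℕ) ≠ i := by
      rintro rfl
      rw [mate_i] at mate_w
      have := congrArg Fin.val (Sum.inl_injective mate_w)
      simp only at this
      omega
    obtain ⟨m, hm, -, m_lt, mate_m⟩ :=
      d.exists_neighbours_of_north (Fin.lt_def.2 (by omega)) mate_w
    exact not_earlier (by omega) ⟨hm, mate_m⟩
  · omega

/-- The number of ends in the first column of the edge at `v`. -/
def leftEnds (d : LDiagram n) (v : Node n) : ℕ :=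
  (if col v = 0 then 1 else 0) + (if col (d.mate v) = 0 then 1 else 0)

theorem leftEnds_mate (d : LDiagram n) (v : Node n) : d.leftEnds (d.mate v) = d.leftEnds v := by
  rw [leftEnds, leftEnds, d.mate_mate, add_comm]

theorem sum_leftEnds (d : LDiagram n) :
    ∑ v, d.leftEnds v = 4 * ∑ i : Fin n, if (i : ℕ) = 0 then 1 else 0 := by
  have sum_mate : ∑ v, (if col (d.mate v) = 0 then 1 else 0) = ∑ v, if col v = 0 then 1 else 0 :=
    Equiv.sum_comp (Function.Involutive.toPerm d.mate d.mate_mate)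
      (fun v => if col v = 0 then 1 else 0)
  have sum_col : ∑ v : Node n, (if col v = 0 then 1 else 0) =
      2 * ∑ i : Fin n, if (i : ℕ) = 0 then 1 else 0 := by
    rw [Fintype.sum_sum_type, two_mul]
    rfl
  simp only [leftEnds, Finset.sum_add_distrib]
  rw [sum_mate, sum_col]
  ring

theorem pos_of_col_eq_zero {v : Node n} (hv : col v = 0) : pos v = 0 ∨ pos v = 2 * n - 1 := by
  rcases v with i | i <;> simp only [col, Sum.elim_inl, Sum.elim_inr] at hv <;> simp [hv]

theorem exposed_of_leftEnds (d : LDiagram n) {v : Node n} (hv : d.leftEnds v ≠ 0) (u : Node n) :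
    ¬ (pos u < pos v ∧ pos v < pos (d.mate u)) := by
  rintro ⟨left, right⟩
  have inside := d.planar.inside pos_injective left right
  have pos_mate_lt := pos_lt (d.mate u)
  have left_end : col v = 0 ∨ col (d.mate v) = 0 := by
    unfold leftEnds at hv
    grind
  rcases left_end with h | h <;> have pos_eq := pos_of_col_eq_zero h <;> omega

/-- The diagram obtained by adding a decoration at the first node of each face, where two
decorations on an edge cancel. -/
def toggle (d : LDiagram n) (hd : d.IsTypeII) : LDiagram n where
  mate := d.mate
  deco v := (d.deco v + d.leftEnds v) % 2
  loops := 0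
  mate_mate := d.mate_mate
  deco_mate v := by rw [d.deco_mate, d.leftEnds_mate]
  deco_free v hv := absurd hv (d.no_free v)
  no_free := d.no_free
  planar := d.planar
  exposed v hv := by
    by_cases deco_v : d.deco v = 0
    · refine d.exposed_of_leftEnds fun leftEnds_eq => hv ?_
      simp only [deco_v, leftEnds_eq]
    · exact d.exposed v deco_v
  undecorated hN := by
    refine ⟨fun v => ?_, fun m hm => absurd hm (Multiset.notMem_zero m)⟩
    have col_mate : col (d.mate v) = col v := by
      rw [eq_one_of_no_north hN hd.loops]
      rcases v with i | i <;> rfl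
    simp only [(d.undecorated hN).1 v, leftEnds, col_mate]
    omega

variable {d : LDiagram n}

theorem toggle_isTypeII (hd : d.IsTypeII) : (d.toggle hd).IsTypeII where
  loops := rfl
  deco_le v := Nat.lt_succ_iff.1 (Nat.mod_lt _ two_pos)
  even := by
    have two_mul_numDeco := d.toArcs.two_mul_numDeco
    have two_mul_numDeco_toggle := (d.toggle hd).toArcs.two_mul_numDeco
    have sum_div_mod : ∑ v, (d.toggle hd).deco v + 2 * ∑ v, (d.deco v + d.leftEnds v) / 2 =
        ∑ v, (d.deco v + d.leftEnds v) := by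
      rw [Finset.mul_sum, ← Finset.sum_add_distrib]
      exact Finset.sum_congr rfl fun v _ => Nat.mod_add_div _ 2
    obtain ⟨c, hc⟩ := d.toArcs.even_sum (fun v => (d.deco v + d.leftEnds v) / 2)
      (fun v => by rw [d.deco_mate, d.leftEnds_mate]) (fun v hv => absurd hv (d.no_free v))
    rw [Finset.sum_add_distrib, d.sum_leftEnds] at sum_div_mod
    have even_numDeco := hd.even
    rw [Nat.even_iff] at even_numDeco ⊢
    omega

theorem cost_toggle (hd : d.IsTypeII) : (d.toggle hd).cost = d.cost := by
  refine Finset.sum_congr rfl fun v _ => ?_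
  have deco_le := hd.deco_le v
  simp only [edgeCost, toggle, leftEnds]
  split_ifs <;> omega

theorem IsCapping.toggle {e : LDiagram n} (hd : d.IsTypeII) (he : e.IsTypeII) {p q a b : Node n}
    (h : IsCapping (d.toggle hd) e p q a b 0) (hp : col p = 0) (hq : col q ≠ 0) :
    IsCapping d (e.toggle he) p q a b 1 where
  mate_p := h.mate_p
  mate_a := h.mate_a
  cut_p := h.cut_p
  cut_q := h.cut_q
  ne_q := h.ne_q
  mate_eq := h.mate_eq
  deco_p := by
    have deco_p := h.deco_p
    have mate_p : d.mate p = q := h.mate_p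
    simp only [LDiagram.toggle, leftEnds, mate_p, hp, hq, if_true, if_false] at deco_p
    omega
  deco_a := by
    have deco_a := h.deco_a
    have mate_a : d.mate a = b := h.mate_a
    simp only [LDiagram.toggle, leftEnds, mate_a, h.cut_p, h.cut_q, hp, hq, if_true, if_false]
      at deco_a ⊢
    omega
  deco_eq v hvp hvq hva hvb := by
    have deco_v := h.deco_eq v hvp hvq hva hvb
    have mate_v : d.mate v = e.mate v := h.mate_eq v hvp hvq hva hvb
    simp only [LDiagram.toggle, leftEnds, mate_v] at deco_v ⊢
    omega
  loops := hd.loops.symm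

theorem exists_simple_mul (hd : d.IsTypeII) {i : ℕ} (hi : i + 1 < n)
    (hmate : d.mate (Sum.inl ⟨i, by omega⟩) = Sum.inl ⟨i + 1, hi⟩)
    (hdeco : d.deco (Sum.inl ⟨i, by omega⟩) = 0) :
    ∃ e : LDiagram n, e.IsTypeII ∧ e.cost < d.cost ∧
      PHat.of d = PHat.of (simple i hi) * PHat.of e := by
  obtain ⟨a, b, h, hb, ha⟩ := d.exists_canReroute hi hmate hdeco
  exact ⟨_, reroute_isTypeII hd h, cost_reroute_lt hd h rfl rfl hb ha,
    (h.isCapping hd).of_eq_mul hi _ hd.loops⟩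

theorem exists_simpleBar_mul (hd : d.IsTypeII) (hi : 0 + 1 < n)
    (hmate : d.mate (Sum.inl ⟨0, by omega⟩) = Sum.inl ⟨0 + 1, hi⟩)
    (hdeco : d.deco (Sum.inl ⟨0, by omega⟩) ≠ 0) :
    ∃ e : LDiagram n, e.IsTypeII ∧ e.cost < d.cost ∧
      PHat.of d = PHat.of (simpleBar hi) * PHat.of e := by
  have deco_toggle : (d.toggle hd).deco (Sum.inl ⟨0, by omega⟩) = 0 := by
    have deco_le := hd.deco_le (Sum.inl ⟨0, by omega⟩)
    simp only [toggle, leftEnds, hmate, col, Sum.elim_inl, if_true, Nat.add_eq_zero_iff,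
      one_ne_zero, and_false, if_false]
    omega
  obtain ⟨a, b, h, hb, ha⟩ := (d.toggle hd).exists_canReroute hi hmate deco_toggle
  have reroute_typeII := reroute_isTypeII (toggle_isTypeII hd) h
  refine ⟨_, toggle_isTypeII reroute_typeII, ?_,
    ((h.isCapping (toggle_isTypeII hd)).toggle hd reroute_typeII rfl one_ne_zero).of_eq_mul
      hi _ hd.loops⟩
  rw [cost_toggle, ← cost_toggle hd]
  exact cost_reroute_lt _ h rfl rfl hb ha

theorem of_mem_DTL (d : LDiagram n) (hd : d.IsTypeII) : PHat.of d ∈ DTL n := by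
  induction hc : d.cost using Nat.strong_induction_on generalizing d with
  | _ c ih =>
    by_cases hN : ∀ i j, d.mate (Sum.inl i) ≠ Sum.inl j
    · rw [eq_one_of_no_north hN hd.loops, PHat.of_one]
      exact one_mem _
    · push Not at hN
      obtain ⟨j, k, hjk⟩ := hN
      obtain ⟨i, hi, hmate, hdeco⟩ := d.exists_neighbours_undecorated_or_first hjk
      by_cases deco_zero : d.deco (Sum.inl ⟨i, by omega⟩) = 0
      · obtain ⟨e, he, cost_lt, d_eq⟩ := exists_simple_mul hd hi hmate deco_zero
        rw [d_eq]
        exact mul_mem (Algebra.subset_adjoin (Or.inl ⟨i, hi, rfl⟩)) (ih _ (hc ▸ cost_lt) e he rfl)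
      · obtain rfl : i = 0 := hdeco.resolve_left deco_zero
        obtain ⟨e, he, cost_lt, d_eq⟩ := exists_simpleBar_mul hd hi hmate deco_zero
        rw [d_eq]
        exact mul_mem (Algebra.subset_adjoin (Or.inr ⟨hi, rfl⟩)) (ih _ (hc ▸ cost_lt) e he rfl)

end LDiagram

variable {n : ℕ}

/-- The nodes of a half-diagram that are not ends of its arcs; they are the ends of the removed
propagating edges. -/
abbrev Arcs.Free (A : Arcs (Fin n)) : Type := {i : Fin n // A.mate i = i}

namespace LDiagram

/-- The upper half of a diagram, as `TypeII.upper` but for all diagrams. -/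
def upperHalf (d : LDiagram n) : Arcs (Fin n) where
  mate i := Sum.elim id (fun _ => i) (d.mate (Sum.inl i))
  deco i := Sum.elim (fun _ => d.deco (Sum.inl i)) (fun _ => 0) (d.mate (Sum.inl i))
  loops := 0
  mate_mate i := by
    rcases h : d.mate (Sum.inl i) with j | j
    · have mate_j : d.mate (Sum.inl j) = Sum.inl i := by rw [← h, d.mate_mate]
      simp [mate_j]
    · simp [h]
  deco_mate i := by
    rcases h : d.mate (Sum.inl i) with j | j
    · have mate_j : d.mate (Sum.inl j) = Sum.inl i := by rw [← h, d.mate_mate]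
      have deco_j : d.deco (Sum.inl j) = d.deco (Sum.inl i) := by rw [← h, d.deco_mate]
      simp [mate_j, deco_j]
    · simp [h]
  deco_free i := by
    rcases h : d.mate (Sum.inl i) with j | j
    · intro hj
      simp only [Sum.elim_inl, id] at hj
      exact absurd (hj ▸ h) (d.no_free _)
    · simp

/-- The lower half of a diagram, inverted in a horizontal line. -/
abbrev lowerHalf (d : LDiagram n) : Arcs (Fin n) := d.flip.upperHalf

theorem upperHalf_cases (d : LDiagram n) (i : Fin n) :
    (∃ j, j ≠ i ∧ d.mate (Sum.inl i) = Sum.inl j ∧ d.upperHalf.mate i = j ∧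
      d.upperHalf.deco i = d.deco (Sum.inl i)) ∨
    (∃ j, d.mate (Sum.inl i) = Sum.inr j ∧ d.upperHalf.mate i = i ∧ d.upperHalf.deco i = 0) := by
  rcases h : d.mate (Sum.inl i) with j | j
  · refine Or.inl ⟨j, fun hji => d.no_free (Sum.inl i) (by rw [h, hji]), rfl, ?_⟩
    simp [upperHalf, h]
  · exact Or.inr ⟨j, rfl, by simp [upperHalf, h]⟩

theorem lowerHalf_cases (d : LDiagram n) (i : Fin n) :
    (∃ j, j ≠ i ∧ d.mate (Sum.inr i) = Sum.inr j ∧ d.lowerHalf.mate i = j ∧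
      d.lowerHalf.deco i = d.deco (Sum.inr i)) ∨
    (∃ j, d.mate (Sum.inr i) = Sum.inl j ∧ d.lowerHalf.mate i = i ∧ d.lowerHalf.deco i = 0) := by
  have mate_inr : d.mate (Sum.inr i) = (d.flip.mate (Sum.inl i)).swap := (Sum.swap_swap _).symm
  rcases d.flip.upperHalf_cases i with ⟨j, hji, mate_i, half⟩ | ⟨j, mate_i, half⟩
  · exact Or.inl ⟨j, hji, by rw [mate_inr, mate_i, Sum.swap_inl], half⟩
  · exact Or.inr ⟨j, by rw [mate_inr, mate_i, Sum.swap_inr], half⟩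

theorem upperHalf_mate_eq_self_iff {d : LDiagram n} {i : Fin n} :
    d.upperHalf.mate i = i ↔ ∃ j, d.mate (Sum.inl i) = Sum.inr j := by
  grind [d.upperHalf_cases i]

theorem lowerHalf_mate_eq_self_iff {d : LDiagram n} {i : Fin n} :
    d.lowerHalf.mate i = i ↔ ∃ j, d.mate (Sum.inr i) = Sum.inl j := by
  grind [d.lowerHalf_cases i]

theorem propagating_lt {d : LDiagram n} {i i' j j' : Fin n} (hi : d.mate (Sum.inl i) = Sum.inr j)
    (hi' : d.mate (Sum.inl i') = Sum.inr j') (hlt : i < i') : j < j' := by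
  have planar := d.planar (Sum.inl i) (Sum.inl i')
  have mate_ne : d.mate (Sum.inl i) ≠ d.mate (Sum.inl i') := fun h =>
    hlt.ne (Sum.inl_injective (by rw [← d.mate_mate (Sum.inl i), h, d.mate_mate]))
  have ne : (j : ℕ) ≠ j' := fun h => mate_ne (by rw [hi, hi', Fin.ext h])
  simp only [hi, hi', pos_inl, pos_inr] at planar
  rw [Fin.lt_def] at hlt ⊢
  omega

theorem deco_eq_zero_of_propagating_lt {d : LDiagram n} {i i' j : Fin n}
    (hi : d.mate (Sum.inl i) = Sum.inr j) (hlt : i < i') : d.deco (Sum.inl i') = 0 := by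
  by_contra hdeco
  have exposed := d.exposed _ hdeco (Sum.inl i)
  simp only [hi, pos_inl, pos_inr] at exposed
  omega

/-- As propagating edges do not cross, they match the free nodes of the two halves in order. -/
theorem exists_orderIso_free (d : LDiagram n) {S T : Arcs (Fin n)} (hS : d.upperHalf = S)
    (hT : d.lowerHalf = T) :
    ∃ σ : S.Free ≃o T.Free, ∀ i : S.Free, d.mate (Sum.inl i) = Sum.inr (σ i).1 := by
  subst hS hT
  have exists_end : ∀ i : d.upperHalf.Free, ∃ j : d.lowerHalf.Free,
      d.mate (Sum.inl i) = Sum.inr j.1 := by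
    rintro ⟨i, hi⟩
    obtain ⟨j, mate_i⟩ := upperHalf_mate_eq_self_iff.1 hi
    exact ⟨⟨j, lowerHalf_mate_eq_self_iff.2 ⟨i, by rw [← mate_i, d.mate_mate]⟩⟩, mate_i⟩
  choose f hf using exists_end
  have f_strictMono : StrictMono f := fun i i' hlt => propagating_lt (hf i) (hf i') hlt
  have f_surjective : f.Surjective := by
    rintro ⟨j, hj⟩
    obtain ⟨i, mate_j⟩ := lowerHalf_mate_eq_self_iff.1 hj
    have mate_i : d.mate (Sum.inl i) = Sum.inr j := by rw [← mate_j, d.mate_mate]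
    exact ⟨⟨i, upperHalf_mate_eq_self_iff.2 ⟨j, mate_i⟩⟩,
      Subtype.ext (Sum.inr_injective (α := Fin n) (by rw [← hf, mate_i]))⟩
  exact ⟨f_strictMono.orderIsoOfSurjective f f_surjective, hf⟩

end LDiagram

theorem numProp_eq_card (A : Arcs (Fin n)) : numProp A = Fintype.card A.Free :=
  (Fintype.card_subtype _).symm

namespace LDiagram

theorem numProp_lowerHalf (d : LDiagram n) : numProp d.lowerHalf = numProp d.upperHalf := by
  obtain ⟨σ, -⟩ := d.exists_orderIso_free rfl rfl
  rw [numProp_eq_card, numProp_eq_card, Fintype.card_congr σ.toEquiv]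

theorem sum_deco_inl (d : LDiagram n) :
    ∑ i, d.deco (Sum.inl i) = ∑ i, d.upperHalf.deco i +
      ∑ i : d.upperHalf.Free, d.deco (Sum.inl i) := by
  have sum_free : ∑ i : d.upperHalf.Free, d.deco (Sum.inl i) =
      ∑ i, if d.upperHalf.mate i = i then d.deco (Sum.inl i) else 0 := by
    rw [← Finset.sum_filter]
    exact (Finset.sum_subtype _ (by simp) fun i => d.deco (Sum.inl i)).symm
  rw [sum_free, ← Finset.sum_add_distrib]
  refine Finset.sum_congr rfl fun i _ => ?_
  grind [d.upperHalf_cases i]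

theorem numDeco_eq_add (d : LDiagram n) :
    d.numDeco = d.upperHalf.numDeco + d.lowerHalf.numDeco +
      ∑ i : d.upperHalf.Free, d.deco (Sum.inl i) := by
  obtain ⟨σ, hσ⟩ := d.exists_orderIso_free rfl rfl
  have sum_free : ∑ j : d.lowerHalf.Free, d.flip.deco (Sum.inl j) =
      ∑ i : d.upperHalf.Free, d.deco (Sum.inl i) := by
    rw [← Equiv.sum_comp σ.toEquiv]
    refine Finset.sum_congr rfl fun i _ => ?_
    rw [← d.deco_mate (Sum.inl i), hσ]
    rfl
  have two_mul_numDeco := d.toArcs.two_mul_numDeco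
  have two_mul_upper := d.upperHalf.two_mul_numDeco
  have two_mul_lower := d.lowerHalf.two_mul_numDeco
  have sum_north := d.sum_deco_inl
  have sum_south : ∑ i, d.deco (Sum.inr i) = ∑ i, d.lowerHalf.deco i +
      ∑ i : d.upperHalf.Free, d.deco (Sum.inl i) := sum_free ▸ d.flip.sum_deco_inl
  rw [Fintype.sum_sum_type] at two_mul_numDeco
  omega

theorem numDeco_eq_of_isBot (d : LDiagram n) {S T : Arcs (Fin n)} (hS : d.upperHalf = S)
    (hT : d.lowerHalf = T) {m : S.Free} (hm : IsBot m) :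
    d.numDeco = S.numDeco + T.numDeco + d.deco (Sum.inl m) := by
  subst hS hT
  rw [numDeco_eq_add, Fintype.sum_eq_single m]
  intro i hi
  obtain ⟨j, mate_m⟩ := upperHalf_mate_eq_self_iff.1 m.2
  exact deco_eq_zero_of_propagating_lt mate_m ((hm i).lt_of_ne hi.symm)

theorem mate_eq_of_halves_eq {d e : LDiagram n} (hu : d.upperHalf = e.upperHalf)
    (hl : d.lowerHalf = e.lowerHalf) : d.mate = e.mate := by
  obtain ⟨σ, hσ⟩ := d.exists_orderIso_free hu hl
  obtain ⟨τ, hτ⟩ := e.exists_orderIso_free rfl rfl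
  obtain rfl : σ = τ := Subsingleton.elim σ τ
  have mate_inl : ∀ i, d.mate (Sum.inl i) = e.mate (Sum.inl i) := by
    intro i
    by_cases hi : e.upperHalf.mate i = i
    · rw [hσ ⟨i, hi⟩, hτ ⟨i, hi⟩]
    · have mate_upper : d.upperHalf.mate i = e.upperHalf.mate i := by rw [hu]
      grind [d.upperHalf_cases i, e.upperHalf_cases i]
  funext v
  rcases v with i | i
  · exact mate_inl i
  · have mate_lower : d.lowerHalf.mate i = e.lowerHalf.mate i := by rw [hl]
    grind [d.lowerHalf_cases i, e.lowerHalf_cases i, d.mate_mate, e.mate_mate]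

theorem deco_inl_eq_of_halves_eq {d e : LDiagram n} (hd : d.IsTypeII) (he : e.IsTypeII)
    (hu : d.upperHalf = e.upperHalf) (hl : d.lowerHalf = e.lowerHalf) (i : Fin n) :
    d.deco (Sum.inl i) = e.deco (Sum.inl i) := by
  by_cases hi : e.upperHalf.mate i = i
  · by_cases hbot : IsBot (⟨i, hi⟩ : Arcs.Free e.upperHalf)
    · have numDeco_d := d.numDeco_eq_of_isBot hu hl hbot
      have numDeco_e := e.numDeco_eq_of_isBot rfl rfl hbot
      have even_d := Nat.even_iff.1 hd.even
      have even_e := Nat.even_iff.1 he.even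
      have deco_d_le := hd.deco_le (Sum.inl i)
      have deco_e_le := he.deco_le (Sum.inl i)
      dsimp only at numDeco_d numDeco_e
      omega
    · simp only [IsBot, not_forall, not_le] at hbot
      obtain ⟨⟨m, hm⟩, hlt⟩ := hbot
      obtain ⟨j, mate_m⟩ := upperHalf_mate_eq_self_iff.1 hm
      rw [deco_eq_zero_of_propagating_lt mate_m hlt, deco_eq_zero_of_propagating_lt
        (by rw [mate_eq_of_halves_eq hu hl, mate_m]) hlt]
  · have deco_upper : d.upperHalf.deco i = e.upperHalf.deco i := by rw [hu]
    have mate_upper : d.upperHalf.mate i = e.upperHalf.mate i := by rw [hu]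
    grind [d.upperHalf_cases i, e.upperHalf_cases i]

/-- The parity condition determines the decoration of the leftmost propagating edge. -/
theorem IsTypeII.ext_halves {d e : LDiagram n} (hd : d.IsTypeII) (he : e.IsTypeII)
    (hu : d.upperHalf = e.upperHalf) (hl : d.lowerHalf = e.lowerHalf) : d = e := by
  have mate_eq := mate_eq_of_halves_eq hu hl
  have deco_inl := deco_inl_eq_of_halves_eq hd he hu hl
  refine ext_data mate_eq (fun v => ?_) (hd.loops.trans he.loops.symm)
  rcases v with i | i
  · exact deco_inl i
  · rcases d.lowerHalf_cases i with ⟨j, -, mate_d, -, deco_d⟩ | ⟨j, mate_d, -⟩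
    · rcases e.lowerHalf_cases i with ⟨-, -, -, -, deco_e⟩ | ⟨k, mate_e, -⟩
      · rw [← deco_d, ← deco_e, hl]
      · rw [mate_eq, mate_e] at mate_d
        cases mate_d
    · rw [← d.deco_mate, ← e.deco_mate, ← mate_eq, mate_d, deco_inl]

end LDiagram

/-- The conditions that characterize the halves of diagrams of type II. -/
structure Arcs.IsHalf (A : Arcs (Fin n)) : Prop where
  loops : A.loops = 0
  deco_le : ∀ i, A.deco i ≤ 1
  planar : A.NonCrossing Fin.val
  exposed : A.Exposed Fin.val
  free_exposed : ∀ f, A.mate f = f → ∀ u : Fin n, ¬ ((u : ℕ) < f ∧ (f : ℕ) < A.mate u)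
  deco_lt_free : ∀ i, A.deco i ≠ 0 → ∀ f, A.mate f = f → (i : ℕ) < f

theorem LDiagram.upperHalf_isHalf (d : LDiagram n) (hd : ∀ v, d.deco v ≤ 1) :
    d.upperHalf.IsHalf where
  loops := rfl
  deco_le i := by
    grind [d.upperHalf_cases i]
  planar u v := by
    have planar := d.planar (Sum.inl u) (Sum.inl v)
    rcases d.upperHalf_cases u with ⟨i, -, mate_u, half_u, -⟩ | ⟨i, -, half_u, -⟩ <;>
    rcases d.upperHalf_cases v with ⟨j, -, mate_v, half_v, -⟩ | ⟨j, -, half_v, -⟩ <;>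
    rw [half_u, half_v]
    · rwa [mate_u, mate_v] at planar
    all_goals omega
  exposed v hv u := by
    rcases d.upperHalf_cases v with ⟨j, -, -, -, half_v⟩ | ⟨j, -, -, half_v⟩
    · rw [half_v] at hv
      have exposed := d.exposed _ hv (Sum.inl u)
      rcases d.upperHalf_cases u with ⟨i, -, mate_u, half_u, -⟩ | ⟨i, -, half_u, -⟩ <;> rw [half_u]
      · rwa [mate_u] at exposed
      · omega
    · exact absurd half_v hv
  free_exposed f hf u := by
    obtain ⟨j, mate_f⟩ := upperHalf_mate_eq_self_iff.1 hf
    have planar := d.planar (Sum.inl u) (Sum.inl f)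
    rcases d.upperHalf_cases u with ⟨i, -, mate_u, half_u, -⟩ | ⟨i, -, half_u, -⟩ <;> rw [half_u]
    · simp only [mate_u, mate_f, pos_inl, pos_inr] at planar
      omega
    · omega
  deco_lt_free i hi f hf := by
    obtain ⟨j, mate_f⟩ := upperHalf_mate_eq_self_iff.1 hf
    rcases d.upperHalf_cases i with ⟨k, -, mate_i, -, deco_i⟩ | ⟨k, -, -, deco_i⟩
    · rw [deco_i] at hi
      have exposed := d.exposed _ hi (Sum.inl f)
      have ne : (i : ℕ) ≠ f := fun h => by
        rw [Fin.ext h, mate_f] at mate_i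
        cases mate_i
      simp only [mate_f, pos_inl, pos_inr] at exposed
      omega
    · exact absurd deco_i hi

theorem numProp_eq_iff {A : Arcs (Fin n)} : numProp A = n ↔ ∀ i, A.mate i = i := by
  have card_eq := Finset.card_filter_eq_iff (s := (Finset.univ : Finset (Fin n)))
    (p := fun i => A.mate i = i)
  simpa [numProp] using card_eq

theorem Arcs.numDeco_eq_zero_of_forall_free {A : Arcs (Fin n)} (hA : ∀ i, A.mate i = i) :
    A.numDeco = 0 := by
  simp [numDeco, fun i => A.deco_free i (hA i)]

/-- The involution on the nodes of the box whose arcs are those of `S` in the north face, those of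
`T` in the south face and the propagating edges prescribed by `σ`. -/
def joinMate {S T : Arcs (Fin n)} (σ : S.Free ≃o T.Free) : Node n → Node n :=
  Sum.elim (fun i => if hi : S.mate i = i then Sum.inr (σ ⟨i, hi⟩) else Sum.inl (S.mate i))
    (fun j => if hj : T.mate j = j then Sum.inl (σ.symm ⟨j, hj⟩) else Sum.inr (T.mate j))

open Classical in
/-- The decorations of `A` together with `c` decorations at the leftmost free node. -/
noncomputable def joinDeco (A : Arcs (Fin n)) (c : ℕ) (i : Fin n) : ℕ :=
  if hi : A.mate i = i then if IsBot (⟨i, hi⟩ : A.Free) then c else 0 else A.deco i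

section

variable {S T : Arcs (Fin n)}

theorem joinMate_cases (σ : S.Free ≃o T.Free) (v : Node n) :
    (∃ i, S.mate i ≠ i ∧ v = Sum.inl i ∧ joinMate σ v = Sum.inl (S.mate i)) ∨
    (∃ i : S.Free, v = Sum.inl i.1 ∧ joinMate σ v = Sum.inr (σ i).1) ∨
    (∃ i : S.Free, v = Sum.inr (σ i).1 ∧ joinMate σ v = Sum.inl i.1) ∨
    (∃ j, T.mate j ≠ j ∧ v = Sum.inr j ∧ joinMate σ v = Sum.inr (T.mate j)) := by
  rcases v with i | j
  · by_cases hi : S.mate i = i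
    · exact Or.inr (Or.inl ⟨⟨i, hi⟩, rfl, by simp [joinMate, hi]⟩)
    · exact Or.inl ⟨i, hi, rfl, by simp [joinMate, hi]⟩
  · by_cases hj : T.mate j = j
    · exact Or.inr (Or.inr (Or.inl ⟨σ.symm ⟨j, hj⟩, by simp, by simp [joinMate, hj]⟩))
    · exact Or.inr (Or.inr (Or.inr ⟨j, hj, rfl, by simp [joinMate, hj]⟩))

theorem joinDeco_orderIso (σ : S.Free ≃o T.Free) (c : ℕ) (i : S.Free) :
    joinDeco T c (σ i) = joinDeco S c i := by
  have isBot_iff : IsBot (σ i) ↔ IsBot i :=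
    ⟨fun h j => σ.le_iff_le.1 (h (σ j)), fun h j => σ.le_symm_apply.1 (h (σ.symm j))⟩
  classical
  rw [joinDeco, joinDeco, dif_pos (σ i).2, dif_pos i.2]
  exact if_congr isBot_iff rfl rfl

theorem joinDeco_mate (A : Arcs (Fin n)) (c : ℕ) (i : Fin n) :
    joinDeco A c (A.mate i) = joinDeco A c i := by
  by_cases hi : A.mate i = i
  · rw [hi]
  · simp [joinDeco, hi, A.mate_mate, A.deco_mate, Ne.symm hi]

theorem joinDeco_exposed (hS : S.IsHalf) {c : ℕ} {i : Fin n} (hi : joinDeco S c i ≠ 0) :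
    (∀ u : Fin n, ¬ ((u : ℕ) < i ∧ (i : ℕ) < S.mate u)) ∧
      ∀ f : S.Free, (i : ℕ) ≤ f.1 := by
  unfold joinDeco at hi
  split_ifs at hi with free bot
  · exact ⟨hS.free_exposed i free, bot⟩
  · exact absurd rfl hi
  · exact ⟨hS.exposed i hi, fun f => (hS.deco_lt_free i hi f f.2).le⟩

theorem join_planar (hS : S.IsHalf) (hT : T.IsHalf) (σ : S.Free ≃o T.Free) (u v : Node n) :
    ¬ (pos u < pos v ∧ pos v < pos (joinMate σ u) ∧ pos (joinMate σ u) < pos (joinMate σ v)) := by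
  rcases joinMate_cases σ u with ⟨i, -, rfl, mate_u⟩ | ⟨f, rfl, mate_u⟩ | ⟨f, rfl, mate_u⟩ |
    ⟨i, -, rfl, mate_u⟩ <;>
  rcases joinMate_cases σ v with ⟨j, -, rfl, mate_v⟩ | ⟨g, rfl, mate_v⟩ | ⟨g, rfl, mate_v⟩ |
    ⟨j, -, rfl, mate_v⟩ <;>
  simp only [mate_u, mate_v, pos_inl, pos_inr]
  case inl.inl => exact hS.planar i j
  case inl.inr.inl =>
    have free_exposed := hS.free_exposed g g.2 i
    omega
  case inr.inl.inr.inl =>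
    have lt_iff : (σ f).1.1 < (σ g).1.1 ↔ f.1.1 < g.1.1 := σ.lt_iff_lt
    omega
  case inr.inl.inr.inr.inr =>
    have free_exposed := hT.free_exposed (σ f) (σ f).2 (T.mate j)
    rw [T.mate_mate] at free_exposed
    omega
  case inr.inr.inr.inr.inr.inr =>
    have planar := hT.planar (T.mate j) (T.mate i)
    rw [T.mate_mate, T.mate_mate] at planar
    omega
  all_goals omega

theorem join_exposed (hS : S.IsHalf) (hT : T.IsHalf) (σ : S.Free ≃o T.Free) (c : ℕ) (v : Node n)
    (hv : Sum.elim (joinDeco S c) (joinDeco T c) v ≠ 0) (u : Node n) :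
    ¬ (pos u < pos v ∧ pos v < pos (joinMate σ u)) := by
  rcases v with k | k
  · obtain ⟨exposed, le_free⟩ := joinDeco_exposed hS hv
    rcases joinMate_cases σ u with ⟨i, -, rfl, mate_u⟩ | ⟨f, rfl, mate_u⟩ | ⟨f, rfl, mate_u⟩ |
      ⟨i, -, rfl, mate_u⟩ <;> simp only [mate_u, pos_inl, pos_inr]
    · exact exposed i
    · have le_f := le_free f
      omega
    all_goals omega
  · obtain ⟨exposed, le_free⟩ := joinDeco_exposed hT hv
    rcases joinMate_cases σ u with ⟨i, -, rfl, mate_u⟩ | ⟨f, rfl, mate_u⟩ | ⟨f, rfl, mate_u⟩ |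
      ⟨i, -, rfl, mate_u⟩ <;> simp only [mate_u, pos_inl, pos_inr]
    · omega
    · have le_f := le_free (σ f)
      omega
    · omega
    · have exposed_i := exposed (T.mate i)
      rw [T.mate_mate] at exposed_i
      omega

/-- The diagram with halves `S` and `T` whose leftmost propagating edge, if there is one, carries
`c` decorations. -/
noncomputable def join (hS : S.IsHalf) (hT : T.IsHalf) (σ : S.Free ≃o T.Free) (c : ℕ)
    (hc : (∀ i, S.mate i = i) → c = 0) : LDiagram n where
  mate := joinMate σ
  deco := Sum.elim (joinDeco S c) (joinDeco T c)
  loops := 0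
  mate_mate v := by
    rcases joinMate_cases σ v with ⟨i, hi, rfl, mate_v⟩ | ⟨f, rfl, mate_v⟩ | ⟨f, rfl, mate_v⟩ |
      ⟨i, hi, rfl, mate_v⟩ <;> rw [mate_v]
    · simp [joinMate, S.mate_mate, Ne.symm hi]
    · simp [joinMate, (σ f).2]
    · simp [joinMate, f.2]
    · simp [joinMate, T.mate_mate, Ne.symm hi]
  deco_mate v := by
    rcases joinMate_cases σ v with ⟨i, -, rfl, mate_v⟩ | ⟨f, rfl, mate_v⟩ | ⟨f, rfl, mate_v⟩ |
      ⟨i, -, rfl, mate_v⟩ <;> rw [mate_v]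
    · exact joinDeco_mate S c i
    · exact joinDeco_orderIso σ c f
    · exact (joinDeco_orderIso σ c f).symm
    · exact joinDeco_mate T c i
  deco_free v hv := by
    rcases joinMate_cases σ v with ⟨i, hi, rfl, mate_v⟩ | ⟨f, rfl, mate_v⟩ | ⟨f, rfl, mate_v⟩ |
      ⟨i, hi, rfl, mate_v⟩ <;> simp_all
  no_free v := by
    rcases joinMate_cases σ v with ⟨i, hi, rfl, mate_v⟩ | ⟨f, rfl, mate_v⟩ | ⟨f, rfl, mate_v⟩ |
      ⟨i, hi, rfl, mate_v⟩ <;> simp_all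
  planar := join_planar hS hT σ
  exposed := join_exposed hS hT σ c
  undecorated no_north := by
    have free_S : ∀ i, S.mate i = i := fun i => by
      by_contra hi
      exact no_north i (S.mate i) (by simp [joinMate, hi])
    have free_T : ∀ i, T.mate i = i := by
      rw [← numProp_eq_iff, numProp_eq_card, ← Fintype.card_congr σ.toEquiv, ← numProp_eq_card,
        numProp_eq_iff]
      exact free_S
    obtain rfl := hc free_S
    refine ⟨?_, by simp⟩
    rintro (i | i)
    · simp [joinDeco, free_S]
    · simp [joinDeco, free_T]

theorem upperHalf_join (hS : S.IsHalf) (hT : T.IsHalf) (σ : S.Free ≃o T.Free) (c : ℕ)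
    (hc : (∀ i, S.mate i = i) → c = 0) : (join hS hT σ c hc).upperHalf = S := by
  refine Arcs.ext ?_ ?_ hS.loops.symm <;> funext i <;> by_cases hi : S.mate i = i <;>
    simp [upperHalf, join, joinMate, joinDeco, hi, S.deco_free]

theorem lowerHalf_join (hS : S.IsHalf) (hT : T.IsHalf) (σ : S.Free ≃o T.Free) (c : ℕ)
    (hc : (∀ i, S.mate i = i) → c = 0) : (join hS hT σ c hc).lowerHalf = T := by
  refine Arcs.ext ?_ ?_ hT.loops.symm <;> funext i <;> by_cases hi : T.mate i = i <;>
    simp [upperHalf, LDiagram.flip, join, joinMate, joinDeco, hi, T.deco_free]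

theorem numDeco_join (hS : S.IsHalf) (hT : T.IsHalf) (σ : S.Free ≃o T.Free) (c : ℕ)
    (hc : (∀ i, S.mate i = i) → c = 0) :
    (join hS hT σ c hc).numDeco = S.numDeco + T.numDeco + if numProp S = 0 then 0 else c := by
  have upper := upperHalf_join hS hT σ c hc
  have lower := lowerHalf_join hS hT σ c hc
  split_ifs with hzero <;> rw [numProp_eq_card, Fintype.card_eq_zero_iff] at hzero
  · rw [numDeco_eq_add, upper, lower]
    exact congrArg _ (Fintype.sum_empty _)
  · rw [not_isEmpty_iff] at hzero
    obtain ⟨m, -, hm⟩ := (Finset.univ : Finset S.Free).exists_minimal Finset.univ_nonempty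
    have bot : IsBot m := fun f => (le_total f m).elim (fun hf => hm (Finset.mem_univ f) hf) id
    rw [numDeco_eq_of_isBot _ upper lower bot]
    simp [join, joinDeco, m.2, bot]

end

theorem exists_typeII {S T : Arcs (Fin n)} (hS : S.IsHalf) (hT : T.IsHalf)
    (hp : numProp S = numProp T) (h0 : numProp S = 0 → Even (S.numDeco + T.numDeco)) :
    ∃ d : TypeII n, d.upper = S ∧ d.lower = T := by
  have card_eq := hp.symm
  rw [numProp_eq_card, numProp_eq_card] at card_eq
  let σ : S.Free ≃o T.Free := (Fintype.orderIsoFinOfCardEq S.Free rfl).symm.trans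
    (Fintype.orderIsoFinOfCardEq T.Free card_eq)
  let c := (S.numDeco + T.numDeco) % 2
  have hc : (∀ i, S.mate i = i) → c = 0 := fun free_S => by
    have free_T : ∀ i, T.mate i = i := by rwa [← numProp_eq_iff, ← hp, numProp_eq_iff]
    simp [c, Arcs.numDeco_eq_zero_of_forall_free, free_S, free_T]
  have joinDeco_le : ∀ A : Arcs (Fin n), A.IsHalf → ∀ i, joinDeco A c i ≤ 1 := fun A hA i => by
    have deco_le := hA.deco_le i
    unfold joinDeco
    split_ifs <;> omega
  refine ⟨⟨join hS hT σ c hc, rfl, ?_, ?_⟩, upperHalf_join hS hT σ c hc,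
    lowerHalf_join hS hT σ c hc⟩
  · rintro (i | i)
    exacts [joinDeco_le S hS i, joinDeco_le T hT i]
  · rw [numDeco_join]
    split_ifs with hzero
    · exact h0 hzero
    · rw [Nat.even_iff]
      omega

namespace Arcs.AgreeOn

variable {V W : Type*}

theorem sum_left {U : Set W} {B C : Arcs W} (h : AgreeOn U B C) (A : Arcs V) :
    AgreeOn {x : V ⊕ W | Sum.elim (fun _ => True) (· ∈ U) x} (A.sum B) (A.sum C) where
  mate
    | Sum.inl _, _, _ => rfl
    | Sum.inr w, hw, hmate => congrArg Sum.inr (h.mate w hw hmate)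
  deco
    | Sum.inl _, _, _ => rfl
    | Sum.inr w, hw, hmate => h.deco w hw hmate
  loops := congrArg (A.loops + ·) h.loops

theorem of_isPush {f : V → W} (hf : f.Injective) {A A' : Arcs V} {B B' : Arcs W} {U : Set W}
    (h : AgreeOn U B B') (hA : IsPush f A B) (hA' : IsPush f A' B') : AgreeOn (f ⁻¹' U) A A' where
  mate v hv hmate := hf <| by
    rw [← hA.mate, ← hA'.mate]
    exact h.mate (f v) hv (by rwa [hA.mate, hA'.mate])
  deco v hv hmate := by
    rw [← hA.deco, ← hA'.deco]
    exact h.deco (f v) hv (by rwa [hA.mate])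
  loops := by rw [← hA.loops, ← hA'.loops, h.loops]

end Arcs.AgreeOn

namespace LDiagram

theorem agreeOn_north_iff {d e : LDiagram n} :
    Arcs.AgreeOn (Set.range Sum.inl) d.toArcs e.toArcs ↔
      d.upperHalf = e.upperHalf ∧ d.loops = e.loops := by
  constructor
  · intro h
    have mate_eq : ∀ i, d.mate (Sum.inl i) ∈ Set.range Sum.inl ∨
        e.mate (Sum.inl i) ∈ Set.range Sum.inl → d.mate (Sum.inl i) = e.mate (Sum.inl i) :=
      fun i => h.mate (Sum.inl i) ⟨i, rfl⟩
    have deco_eq : ∀ i, d.mate (Sum.inl i) ∈ Set.range Sum.inl →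
        d.deco (Sum.inl i) = e.deco (Sum.inl i) := fun i => h.deco (Sum.inl i) ⟨i, rfl⟩
    refine ⟨Arcs.ext (funext fun i => ?_) (funext fun i => ?_) rfl, h.loops⟩ <;>
      grind [d.upperHalf_cases i, e.upperHalf_cases i]
  · rintro ⟨hu, hloops⟩
    have mate_eq : ∀ i, d.upperHalf.mate i = e.upperHalf.mate i := fun i => by rw [hu]
    have deco_eq : ∀ i, d.upperHalf.deco i = e.upperHalf.deco i := fun i => by rw [hu]
    refine ⟨?_, ?_, hloops⟩ <;> rintro _ ⟨i, rfl⟩ hmate <;>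
      grind [d.upperHalf_cases i, e.upperHalf_cases i]

theorem agreeOn_north_mul (d : LDiagram n) {e f : LDiagram n}
    (h : Arcs.AgreeOn (Set.range Sum.inl) e.toArcs f.toArcs) :
    Arcs.AgreeOn (Set.range Sum.inl) (d * e).toArcs (d * f).toArcs := by
  have agree_stack := (h.sum_left d.toArcs).glueList ((List.finRange n).map (seam n)) (by
    intro s hs
    obtain ⟨i, -, rfl⟩ := List.mem_map.1 hs
    simp [seam])
  convert agree_stack.of_isPush outer_injective (mul_isPush d e) (mul_isPush d f) using 1
  ext (i | i) <;> simp [outer]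

theorem agreeOn_reduce {U : Set (Node n)} {d e : LDiagram n}
    (h : Arcs.AgreeOn U d.toArcs e.toArcs) :
    Arcs.AgreeOn U d.reduce.toArcs e.reduce.toArcs where
  mate := h.mate
  deco v hv hmate := congrArg (· % 2) (h.deco v hv hmate)
  loops := rfl

theorem upperHalf_reduce_mul_congr (d : LDiagram n) {e f : LDiagram n}
    (hu : e.upperHalf = f.upperHalf) (hl : e.loops = f.loops) :
    (d * e).reduce.upperHalf = (d * f).reduce.upperHalf :=
  (agreeOn_north_iff.1 (agreeOn_reduce (agreeOn_north_mul d (agreeOn_north_iff.2 ⟨hu, hl⟩)))).1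

theorem loops_mul_congr (d : LDiagram n) {e f : LDiagram n} (hu : e.upperHalf = f.upperHalf)
    (hl : e.loops = f.loops) : (d * e).loops = (d * f).loops :=
  (agreeOn_north_mul d (agreeOn_north_iff.2 ⟨hu, hl⟩)).loops

theorem mul_inr_of_mate_inr (d e : LDiagram n) {i j : Fin n} (h : e.mate (Sum.inr i) = Sum.inr j) :
    (d * e).mate (Sum.inr i) = Sum.inr j ∧ (d * e).deco (Sum.inr i) = e.deco (Sum.inr i) := by
  have push := mul_isPush d e
  have ne_seam : ∀ s ∈ (List.finRange n).map (seam n), outer (Sum.inr i) ≠ s.1 ∧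
      outer (Sum.inr i) ≠ s.2 ∧ (d.toArcs.sum e.toArcs).mate (outer (Sum.inr i)) ≠ s.1 ∧
      (d.toArcs.sum e.toArcs).mate (outer (Sum.inr i)) ≠ s.2 := by
    intro s hs
    obtain ⟨k, -, rfl⟩ := List.mem_map.1 hs
    simp [outer, seam, Arcs.sum, h]
  constructor
  · apply outer_injective
    rw [← push.mate, stack, Arcs.glueList_keep _ _ _ ne_seam]
    simp [outer, Arcs.sum, h]
  · rw [← push.deco, stack, Arcs.glueList_deco_of_ne _ _ _ ne_seam]
    simp [outer, Arcs.sum]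

theorem lowerHalf_reduce_mul_of_ne (d : LDiagram n) {e : LDiagram n} {i : Fin n}
    (hi : e.lowerHalf.mate i ≠ i) :
    (d * e).reduce.lowerHalf.mate i = e.lowerHalf.mate i ∧
      (d * e).reduce.lowerHalf.deco i = e.lowerHalf.deco i % 2 := by
  rcases e.lowerHalf_cases i with ⟨j, -, mate_i, half_i, deco_i⟩ | ⟨j, -, half_i, -⟩
  · obtain ⟨mul_mate, mul_deco⟩ := mul_inr_of_mate_inr d e mate_i
    rw [half_i, deco_i, ← mul_deco]
    rcases (d * e).reduce.lowerHalf_cases i with ⟨k, -, mate_k, half_k, deco_k⟩ | ⟨k, mate_k, -⟩ <;>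
      rw [reduce_mate, mul_mate] at mate_k
    · exact ⟨half_k.trans (Sum.inr_injective mate_k).symm, deco_k⟩
    · cases mate_k
  · exact absurd half_i hi

theorem lowerHalf_mate_eq_self_of_mul (d : LDiagram n) {e : LDiagram n} {i : Fin n}
    (hi : (d * e).reduce.lowerHalf.mate i = i) : e.lowerHalf.mate i = i :=
  by_contra fun hne => hne ((lowerHalf_reduce_mul_of_ne d hne).1.symm.trans hi)

theorem numProp_mul_le (d e : LDiagram n) :
    numProp (d * e).reduce.upperHalf ≤ numProp e.upperHalf := by
  rw [← numProp_lowerHalf, ← numProp_lowerHalf e]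
  exact Finset.card_le_card (Finset.monotone_filter_right _ fun i _ =>
    lowerHalf_mate_eq_self_of_mul d)

theorem lowerHalf_reduce_mul (d : LDiagram n) {e : LDiagram n} (he : ∀ v, e.deco v ≤ 1)
    (h : numProp (d * e).reduce.upperHalf = numProp e.upperHalf) :
    (d * e).reduce.lowerHalf = e.lowerHalf := by
  rw [← numProp_lowerHalf, ← numProp_lowerHalf e] at h
  have free_eq := Finset.eq_of_subset_of_card_le (Finset.monotone_filter_right Finset.univ
    fun i _ => lowerHalf_mate_eq_self_of_mul d (e := e)) h.ge
  have free_of_free : ∀ i, e.lowerHalf.mate i = i → (d * e).reduce.lowerHalf.mate i = i := by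
    simpa [Finset.subset_iff] using free_eq.ge
  have halves_eq : ∀ i, (d * e).reduce.lowerHalf.mate i = e.lowerHalf.mate i ∧
      (d * e).reduce.lowerHalf.deco i = e.lowerHalf.deco i := by
    intro i
    by_cases hi : e.lowerHalf.mate i = i
    · have free_i := free_of_free i hi
      exact ⟨free_i.trans hi.symm, by rw [Arcs.deco_free _ i free_i, Arcs.deco_free _ i hi]⟩
    · obtain ⟨mate_eq, deco_eq⟩ := lowerHalf_reduce_mul_of_ne d hi
      have deco_le := (e.flip.upperHalf_isHalf fun v => he v.swap).deco_le i
      exact ⟨mate_eq, deco_eq.trans (Nat.mod_eq_of_lt (Nat.lt_succ_of_le deco_le))⟩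
  exact Arcs.ext (funext fun i => (halves_eq i).1) (funext fun i => (halves_eq i).2) rfl

end LDiagram

theorem numProp_mod_two (A : Arcs (Fin n)) : numProp A % 2 = n % 2 := by
  have modEq := Equiv.Perm.card_fixedPoints_modEq (f := A.mate) (p := 2) (n := 1)
    (funext A.mate_mate)
  rw [Fintype.card_fin, Fintype.card_of_subtype (Finset.univ.filter fun i => A.mate i = i)
    fun i => by simp [Function.mem_fixedPoints, Function.IsFixedPt]] at modEq
  exact modEq.symm

/-- The condition that the label `0⁺` or `0⁻` imposes on the number `x` of decorations of a
half-diagram; other labels impose none. -/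
def Label.Admits (a : Label) (x : ℕ) : Prop :=
  (a = Label.zeroPlus → Even x) ∧ (a = Label.zeroMinus → Odd x)

theorem Label.Valid.even_add {a : Label} (ha : a.Valid n) (h0 : a.abs = 0) {x y : ℕ}
    (hx : a.Admits x) (hy : a.Admits y) : Even (x + y) := by
  cases a with
  | num m => exact absurd h0 (Nat.pos_iff_ne_zero.1 ha.1)
  | zeroPlus => exact (hx.1 rfl).add (hy.1 rfl)
  | zeroMinus => exact (hx.2 rfl).add_odd (hy.2 rfl)

theorem Label.Admits.congr {a : Label} {x y : ℕ} (hx : a.Admits x)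
    (h : a.abs = 0 → Even (x + y)) : a.Admits y := by
  rcases a <;> grind [Label.Admits, Label.abs]

theorem Label.eq_of_abs_eq {a b : Label} (ha : a.Valid n) (hb : b.Valid n) (h : a.abs = b.abs)
    {x : ℕ} (hax : a.Admits x) (hbx : b.Admits x) : a = b := by
  rcases a <;> rcases b <;> grind [Label.Admits, Label.abs, Label.Valid]

theorem exists_label {p x : ℕ} (hp : p ≤ n) (hpar : p % 2 = n % 2) :
    ∃ l : Lam n, l.1.abs = p ∧ l.1.Admits x := by
  rcases Nat.eq_zero_or_pos p with rfl | hpos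
  · have hn : Even n := Nat.even_iff.2 hpar.symm
    rcases Nat.even_or_odd x with hx | hx
    · exact ⟨⟨Label.zeroPlus, hn⟩, rfl, fun _ => hx, nofun⟩
    · exact ⟨⟨Label.zeroMinus, hn⟩, rfl, nofun, fun _ => hx⟩
  · exact ⟨⟨Label.num p, hpos, hp, hpar⟩, rfl, nofun, nofun⟩

namespace M

variable {l l' : Lam n}

theorem isHalf (S : M l) : S.1.IsHalf := by
  obtain ⟨d, h | h⟩ := S.2.1 <;> rw [h]
  exacts [d.1.upperHalf_isHalf d.2.deco_le, d.1.flip.upperHalf_isHalf d.2.flip.deco_le]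

theorem numProp_eq (S : M l) : numProp S.1 = l.1.abs := S.2.2.1

theorem admits (S : M l) : l.1.Admits S.1.numDeco := S.2.2.2

theorem label_eq (S : M l) (S' : M l') (h : S.1 = S'.1) : l = l' :=
  Subtype.ext <| Label.eq_of_abs_eq l.2 l'.2 (by rw [← S.numProp_eq, ← S'.numProp_eq, h])
    S.admits (h ▸ S'.admits)

end M

theorem exists_comp {l : Lam n} (S T : M l) :
    ∃ d : TypeII n, d.upper = S.1 ∧ d.lower = T.1 :=
  exists_typeII S.isHalf T.isHalf (S.numProp_eq.trans T.numProp_eq.symm) fun h0 =>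
    l.2.even_add (S.numProp_eq.symm.trans h0) S.admits T.admits

/-- The diagram `S ∘ T` of type II with upper half `S` and lower half `T`. -/
noncomputable def comp (l : Lam n) (S T : M l) : TypeII n := (exists_comp S T).choose

theorem comp_upper (l : Lam n) (S T : M l) : (comp l S T).upper = S.1 :=
  (exists_comp S T).choose_spec.1

theorem comp_lower (l : Lam n) (S T : M l) : (comp l S T).lower = T.1 :=
  (exists_comp S T).choose_spec.2

theorem comp_iff (l : Lam n) (S T : M l) (d : TypeII n) :
    (d.upper = S.1 ∧ d.lower = T.1) ↔ d = comp l S T := by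
  constructor
  · rintro ⟨upper_eq, lower_eq⟩
    exact Subtype.ext (d.2.ext_halves (comp l S T).2 (upper_eq.trans (comp_upper l S T).symm)
      (lower_eq.trans (comp_lower l S T).symm))
  · rintro rfl
    exact ⟨comp_upper l S T, comp_lower l S T⟩

theorem even_numDeco_halves (d : TypeII n) (h : numProp d.upper = 0) :
    Even (d.upper.numDeco + d.lower.numDeco) := by
  have free_empty : IsEmpty d.1.upperHalf.Free := by
    rw [← Fintype.card_eq_zero_iff, ← numProp_eq_card]
    exact h
  have numDeco_eq : d.1.numDeco = d.upper.numDeco + d.lower.numDeco :=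
    d.1.numDeco_eq_add.trans (congrArg _ (Fintype.sum_empty _))
  exact numDeco_eq ▸ d.2.even

theorem exists_eq_comp (d : TypeII n) :
    ∃ (l : Lam n) (S T : M l), d = comp l S T ∧ l.1.abs = numProp d.upper := by
  have numProp_le : numProp d.upper ≤ n :=
    (Finset.card_le_univ _).trans_eq (Fintype.card_fin n)
  obtain ⟨l, abs_eq, admits_upper⟩ :=
    exists_label (x := d.upper.numDeco) numProp_le (numProp_mod_two d.upper)
  have admits_lower : l.1.Admits d.lower.numDeco :=
    admits_upper.congr fun h0 => even_numDeco_halves d (abs_eq.symm.trans h0)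
  exact ⟨l, ⟨d.upper, ⟨d, Or.inl rfl⟩, abs_eq.symm, admits_upper⟩,
    ⟨d.lower, ⟨d, Or.inr rfl⟩, d.1.numProp_lowerHalf.trans abs_eq.symm, admits_lower⟩,
    (comp_iff _ _ _ _).1 ⟨rfl, rfl⟩, abs_eq⟩

theorem comp_injective :
    Function.Injective fun x : Σ l : Lam n, M l × M l => comp x.1 x.2.1 x.2.2 := by
  rintro ⟨l, S, T⟩ ⟨l', S', T'⟩ (h : comp l S T = comp l' S' T')
  have upper_eq : S.1 = S'.1 := by rw [← comp_upper l S T, h, comp_upper]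
  have lower_eq : T.1 = T'.1 := by rw [← comp_lower l S T, h, comp_lower]
  obtain rfl := S.label_eq S' upper_eq
  rw [show S = S' from Subtype.ext upper_eq, show T = T' from Subtype.ext lower_eq]

theorem comp_surjective :
    Function.Surjective fun x : Σ l : Lam n, M l × M l => comp x.1 x.2.1 x.2.2 := fun d => by
  obtain ⟨l, S, T, h, -⟩ := exists_eq_comp d
  exact ⟨⟨l, S, T⟩, h.symm⟩

theorem TypeII.flip_flip (d : TypeII n) : d.flip.flip = d := Subtype.ext d.1.flip_flip

theorem comp_flip (l : Lam n) (S T : M l) : (comp l S T).flip = comp l T S := by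
  refine (comp_iff l T S _).1 ⟨comp_lower l S T, ?_⟩
  rw [TypeII.lower, TypeII.flip_flip, comp_upper]

instance : Finite (TypeII n) := by
  let data (d : TypeII n) : (Node n → Node n) × (Node n → Fin 2) :=
    (d.1.mate, fun v => ⟨d.1.deco v, Nat.lt_succ_of_le (d.2.deco_le v)⟩)
  refine Finite.of_injective data fun d e h => Subtype.ext (ext_data ?_ (fun v => ?_) ?_)
  · exact congrArg Prod.fst h
  · exact congrArg Fin.val (congrFun (congrArg Prod.snd h) v)
  · rw [d.2.loops, e.2.loops]

instance (l : Lam n) : Finite (M l) := by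
  refine Finite.of_injective (fun S : M l => comp l S S) fun S S' h => Subtype.ext ?_
  rw [← comp_upper l S S, ← comp_upper l S' S']
  exact congrArg TypeII.upper h

/-- The image of a diagram of type II in the loop-free algebra. -/
noncomputable def cell (d : TypeII n) : LFD n := LFD.mk ⟨PHat.of d.1, of_mem_DTL d.1 d.2⟩

theorem cell_one : cell (⟨1, one_isTypeII⟩ : TypeII n) = 1 :=
  (congrArg LFD.mk (Subtype.ext PHat.of_one)).trans (map_one LFD.mk)

theorem cell_mul_cell (d e : TypeII n) :
    cell d * cell e = LFD.mk ⟨PHat.of (d.1 * e.1),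
      PHat.of_mul d.1 e.1 ▸ mul_mem (of_mem_DTL d.1 d.2) (of_mem_DTL e.1 e.2)⟩ :=
  (map_mul LFD.mk _ _).symm.trans (congrArg LFD.mk (Subtype.ext (PHat.of_mul d.1 e.1).symm))

theorem cell_mul_of_even (d e : TypeII n) (h : ∀ m ∈ (d.1 * e.1).loops, m % 2 = 0) :
    cell d * cell e = loopWeight (d.1 * e.1).loops •
      cell ⟨(d.1 * e.1).reduce, d.2.mul_reduce e.2 h⟩ := by
  rw [cell_mul_cell]
  refine Eq.trans ?_ (map_smul LFD.mk _ _)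
  exact congrArg LFD.mk (Subtype.ext (PHat.of_eq_smul_of_reduce h))

theorem cell_mul_of_odd (d e : TypeII n) (h : ¬ ∀ m ∈ (d.1 * e.1).loops, m % 2 = 0) :
    cell d * cell e = 0 := by
  push Not at h
  obtain ⟨m, hm, hodd⟩ := h
  rw [cell_mul_cell]
  exact LFD.mk_eq_zero _ hm (Nat.mod_two_ne_zero.1 hodd)

theorem cell_linearIndependent : LinearIndependent ℤ[X] (cell : TypeII n → LFD n) := by
  let applyOne : LFD n →ₗ[ℤ[X]] ReducedModule n :=
    (LinearMap.applyₗ (Finsupp.single ⟨1, one_isTypeII.isReduced⟩ 1)).comp (LFD.rep n).toLinearMap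
  let incl (d : TypeII n) : {e : LDiagram n // e.IsReduced} := ⟨d.1, d.2.isReduced⟩
  have incl_injective : incl.Injective := fun d e h => Subtype.ext (congrArg (·.1) h)
  have applyOne_cell : applyOne ∘ cell = fun d => Finsupp.single (incl d) (1 : ℤ[X]) := by
    funext d
    change LFD.rep n (LFD.mk ⟨PHat.of d.1, of_mem_DTL d.1 d.2⟩) _ = _
    rw [LFD.rep_mk, action_single, mul_one, one_smul, d.2.isReduced.normalForm_eq]
  refine LinearIndependent.of_comp applyOne ?_
  rw [applyOne_cell]
  exact (Finsupp.linearIndependent_single_one ℤ[X] _).comp incl incl_injective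

theorem mul_mem_span_cell {x y : LFD n} (hx : x ∈ Submodule.span ℤ[X] (Set.range cell))
    (hy : y ∈ Submodule.span ℤ[X] (Set.range cell)) :
    x * y ∈ Submodule.span ℤ[X] (Set.range (cell : TypeII n → LFD n)) := by
  have hxy := Submodule.mul_mem_mul hx hy
  rw [Submodule.span_mul_span] at hxy
  refine Submodule.span_le.2 ?_ hxy
  rintro _ ⟨_, ⟨d, rfl⟩, _, ⟨e, rfl⟩, rfl⟩
  change cell d * cell e ∈ Submodule.span ℤ[X] (Set.range cell)
  by_cases h : ∀ m ∈ (d.1 * e.1).loops, m % 2 = 0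
  · rw [cell_mul_of_even d e h]
    exact Submodule.smul_mem _ _ (Submodule.subset_span ⟨_, rfl⟩)
  · rw [cell_mul_of_odd d e h]
    exact Submodule.zero_mem _

theorem span_cell : Submodule.span ℤ[X] (Set.range (cell : TypeII n → LFD n)) = ⊤ := by
  have one_mem : (1 : LFD n) ∈ Submodule.span ℤ[X] (Set.range cell) :=
    Submodule.subset_span ⟨⟨1, one_isTypeII⟩, cell_one⟩
  let spanCell : Subalgebra ℤ[X] (LFD n) :=
    Submodule.toSubalgebra _ one_mem fun _ _ => mul_mem_span_cell
  refine Submodule.eq_top_iff'.2 fun x => ?_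
  obtain ⟨⟨y, hy⟩, rfl⟩ : ∃ y, LFD.mk y = x := RingQuot.mkAlgHom_surjective ℤ[X] _ x
  change LFD.mk ⟨y, hy⟩ ∈ spanCell
  induction hy using Algebra.adjoin_induction with
  | mem y hy =>
    rcases hy with ⟨i, hi, rfl⟩ | ⟨h, rfl⟩
    · exact Submodule.subset_span ⟨⟨simple i hi, cupCap_isTypeII i hi 0 _ zero_le_one⟩, rfl⟩
    · exact Submodule.subset_span ⟨⟨simpleBar h, cupCap_isTypeII 0 h 1 _ le_rfl⟩, rfl⟩
  | algebraMap r =>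
    have commutes := AlgHom.commutes (LFD.mk : DTL n →ₐ[ℤ[X]] LFD n) r
    exact commutes ▸ spanCell.algebraMap_mem r
  | add y z hy hz mem_y mem_z => exact map_add LFD.mk ⟨y, hy⟩ ⟨z, hz⟩ ▸ add_mem mem_y mem_z
  | mul y z hy hz mem_y mem_z => exact map_mul LFD.mk ⟨y, hy⟩ ⟨z, hz⟩ ▸ mul_mem mem_y mem_z

/-- The basis of the loop-free algebra given by the diagrams of type II. -/
noncomputable def cellBasis (n : ℕ) : Module.Basis (TypeII n) ℤ[X] (LFD n) :=
  Module.Basis.mk cell_linearIndependent span_cell.ge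

theorem cell_induction {p : LFD n → Prop} (cell : ∀ d, p (cell d))
    (add : ∀ x y, p x → p y → p (x + y)) (smul : ∀ (c : ℤ[X]) x, p x → p (c • x)) (x : LFD n) :
    p x := by
  have hx : x ∈ Submodule.span ℤ[X] (Set.range LoopFree.cell) := span_cell ▸ Submodule.mem_top
  induction hx using Submodule.span_induction with
  | mem x hx =>
    obtain ⟨d, rfl⟩ := hx
    exact cell d
  | zero => simpa only [zero_smul] using smul 0 _ (cell ⟨1, one_isTypeII⟩)
  | add x y _ _ hx hy => exact add x y hx hy
  | smul c x _ hx => exact smul c x hx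

/-- The linear map induced by top-bottom inversion. -/
noncomputable def starMap (n : ℕ) : LFD n →ₗ[ℤ[X]] LFD n :=
  (cellBasis n).constr ℤ[X] fun d => cell d.flip

theorem starMap_cell (d : TypeII n) : starMap n (cell d) = cell d.flip := by
  rw [show cell d = cellBasis n d from (Module.Basis.mk_apply _ _ d).symm]
  exact (cellBasis n).constr_basis ℤ[X] _ d

theorem starMap_starMap (x : LFD n) : starMap n (starMap n x) = x := by
  induction x using cell_induction with
  | cell d => rw [starMap_cell, starMap_cell, d.flip_flip]
  | add x y hx hy => rw [map_add, map_add, hx, hy]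
  | smul c x hx => rw [map_smul, map_smul, hx]

theorem starMap_cell_mul_cell (d e : TypeII n) :
    starMap n (cell d * cell e) = cell e.flip * cell d.flip := by
  have flip_mul_flip : e.flip.1 * d.flip.1 = (d.1 * e.1).flip := (flip_mul d.1 e.1).symm
  have loops_eq : (e.flip.1 * d.flip.1).loops = (d.1 * e.1).loops :=
    congrArg (·.loops) flip_mul_flip
  by_cases h : ∀ m ∈ (d.1 * e.1).loops, m % 2 = 0
  · rw [cell_mul_of_even d e h, cell_mul_of_even e.flip d.flip (loops_eq ▸ h), map_smul]
    exact congrArg₂ (loopWeight · • ·) loops_eq.symm ((starMap_cell _).trans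
      (congrArg cell (Subtype.ext (congrArg reduce flip_mul_flip).symm)))
  · rw [cell_mul_of_odd d e h, cell_mul_of_odd e.flip d.flip (loops_eq ▸ h), map_zero]

theorem starMap_mul (x y : LFD n) : starMap n (x * y) = starMap n y * starMap n x := by
  induction x using cell_induction with
  | cell d =>
    induction y using cell_induction with
    | cell e => rw [starMap_cell_mul_cell, starMap_cell, starMap_cell]
    | add x y hx hy => rw [mul_add, map_add, map_add, add_mul, hx, hy]
    | smul c x hx => rw [mul_smul_comm, map_smul, map_smul, smul_mul_assoc, hx]
  | add x y hx hy => rw [add_mul, map_add, map_add, mul_add, hx, hy]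
  | smul c x hx => rw [smul_mul_assoc, map_smul, map_smul, mul_smul_comm, hx]

section CellAction

/-- The span of the basis elements belonging to smaller labels. -/
noncomputable def lowerSpan (l : Lam n) : Submodule ℤ[X] (LFD n) :=
  Submodule.span ℤ[X] {x | ∃ m, m < l ∧ ∃ S T, x = cell (comp m S T)}

theorem cell_mem_lowerSpan {d : TypeII n} {l : Lam n} (h : numProp d.upper < l.1.abs) :
    cell d ∈ lowerSpan l := by
  obtain ⟨m, S, T, d_eq, abs_eq⟩ := exists_eq_comp d
  exact Submodule.subset_span ⟨m, abs_eq.trans_lt h, S, T, congrArg cell d_eq⟩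

open Classical in
/-- The coefficient of `S' ∘ T` in `d * (S ∘ T)`. By `upperHalf_reduce_mul_congr` it does not depend
on `T`, so it is read off the product with `S ∘ S`. -/
noncomputable def cellCoeff (d : TypeII n) (l : Lam n) (S' S : M l) : ℤ[X] :=
  if (∀ m ∈ (d.1 * (comp l S S).1).loops, m % 2 = 0) ∧
    S'.1 = (d.1 * (comp l S S).1).reduce.upperHalf
  then loopWeight (d.1 * (comp l S S).1).loops else 0

open Classical in
theorem cellCoeff_eq (d : TypeII n) (l : Lam n) (S' S T : M l) :
    cellCoeff d l S' S = if (∀ m ∈ (d.1 * (comp l S T).1).loops, m % 2 = 0) ∧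
        S'.1 = (d.1 * (comp l S T).1).reduce.upperHalf
      then loopWeight (d.1 * (comp l S T).1).loops else 0 := by
  have upper_eq := (comp_upper l S S).trans (comp_upper l S T).symm
  have loops_eq := (comp l S S).2.loops.trans (comp l S T).2.loops.symm
  rw [cellCoeff, upperHalf_reduce_mul_congr d.1 upper_eq loops_eq,
    loops_mul_congr d.1 upper_eq loops_eq]

theorem exists_reduce_mul_comp_eq (d : TypeII n) {l : Lam n} {S T : M l}
    (hf : (d.1 * (comp l S T).1).reduce.IsTypeII)
    (h : numProp (d.1 * (comp l S T).1).reduce.upperHalf = l.1.abs) :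
    ∃ S' : M l, S'.1 = (d.1 * (comp l S T).1).reduce.upperHalf ∧
      (⟨(d.1 * (comp l S T).1).reduce, hf⟩ : TypeII n) = comp l S' T := by
  set f : TypeII n := ⟨(d.1 * (comp l S T).1).reduce, hf⟩
  have numProp_comp : numProp (comp l S T).upper = l.1.abs := by rw [comp_upper, S.numProp_eq]
  have lower_eq : f.lower = T.1 :=
    (lowerHalf_reduce_mul d.1 (comp l S T).2.deco_le (h.trans numProp_comp.symm)).trans
      (comp_lower l S T)
  have admits : l.1.Admits f.upper.numDeco := T.admits.congr fun h0 => by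
    rw [add_comm, ← lower_eq]
    exact even_numDeco_halves f (h.trans h0)
  exact ⟨⟨f.upper, ⟨f, Or.inl rfl⟩, h, admits⟩, rfl, (comp_iff _ _ _ _).1 ⟨rfl, lower_eq⟩⟩

theorem cell_mul_cell_comp (d : TypeII n) (l : Lam n) (S T : M l) :
    cell d * cell (comp l S T) - ∑ᶠ S', cellCoeff d l S' S • cell (comp l S' T) ∈ lowerSpan l := by
  simp only [cellCoeff_eq d l _ S T]
  by_cases heven : ∀ m ∈ (d.1 * (comp l S T).1).loops, m % 2 = 0
  · rw [cell_mul_of_even d _ heven]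
    have numProp_le : numProp (d.1 * (comp l S T).1).reduce.upperHalf ≤ l.1.abs :=
      (numProp_mul_le d.1 (comp l S T).1).trans_eq
        ((congrArg numProp (comp_upper l S T)).trans S.numProp_eq)
    rcases numProp_le.eq_or_lt with heq | hlt
    · obtain ⟨S', upper_eq, comp_eq⟩ :=
        exists_reduce_mul_comp_eq d (d.2.mul_reduce (comp l S T).2 heven) heq
      rw [finsum_eq_single _ S', if_pos ⟨heven, upper_eq⟩, comp_eq, sub_self]
      · exact Submodule.zero_mem _
      · intro S'' hne
        rw [if_neg fun h => hne (Subtype.ext (h.2.trans upper_eq.symm)), zero_smul]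
    · have upper_ne (S' : M l) : S'.1 ≠ (d.1 * (comp l S T).1).reduce.upperHalf :=
        fun h => hlt.ne (h ▸ S'.numProp_eq)
      simp only [upper_ne, and_false, if_false, zero_smul, finsum_zero, sub_zero]
      exact Submodule.smul_mem _ _ (cell_mem_lowerSpan hlt)
  · simp only [heven, false_and, if_false, zero_smul, finsum_zero, sub_zero,
      cell_mul_of_odd d _ heven]
    exact Submodule.zero_mem _

theorem exists_coeff (a : LFD n) (l : Lam n) : ∃ r : M l → M l → ℤ[X], ∀ S T,
    a * cell (comp l S T) - ∑ᶠ S', r S' S • cell (comp l S' T) ∈ lowerSpan l := by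
  induction a using cell_induction with
  | cell d => exact ⟨cellCoeff d l, cell_mul_cell_comp d l⟩
  | add x y hx hy =>
    obtain ⟨r, hr⟩ := hx
    obtain ⟨s, hs⟩ := hy
    refine ⟨fun S' S => r S' S + s S' S, fun S T => ?_⟩
    simp only [add_smul, add_mul]
    rw [finsum_add_distrib (Set.toFinite _) (Set.toFinite _), add_sub_add_comm]
    exact Submodule.add_mem _ (hr S T) (hs S T)
  | smul c x hx =>
    obtain ⟨r, hr⟩ := hx
    refine ⟨fun S' S => c * r S' S, fun S T => ?_⟩
    simp only [mul_smul, smul_mul_assoc]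
    rw [← smul_finsum' c (Set.toFinite _), ← smul_sub]
    exact Submodule.smul_mem _ _ (hr S T)

end CellAction

theorem isCellDatum (n : ℕ) :
    IsCellDatum ℤ[X] (fun (l : Lam n) S T => cell (comp l S T)) (starMap n) where
  finite _ := inferInstance
  injective := cell_linearIndependent.injective.comp comp_injective
  linearIndependent := (cell_linearIndependent.comp _ comp_injective).linearIndepOn_id
  span := by
    rw [← span_cell]
    exact congrArg _ (comp_surjective.range_comp cell)
  star_star := starMap_starMap
  star_mul := starMap_mul
  star_C l S T := by rw [starMap_cell, comp_flip]
  mul_C := exists_coeff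

end LoopFree

theorem mainTheorem1_general (n : ℕ) :
    ∃ (hmem : ∀ d : LoopFree.TypeII n, LoopFree.PHat.of d.1 ∈ LoopFree.DTL n)
      (comp : ∀ l : LoopFree.Lam n, LoopFree.M l → LoopFree.M l → LoopFree.TypeII n)
      (star : LoopFree.LFD n →ₗ[Polynomial ℤ] LoopFree.LFD n),
      (∀ l S T d, (d.upper = S.1 ∧ d.lower = T.1) ↔ d = comp l S T) ∧
      (∀ d, star (LoopFree.LFD.mk ⟨LoopFree.PHat.of d.1, hmem d⟩) =
        LoopFree.LFD.mk ⟨LoopFree.PHat.of d.flip.1, hmem d.flip⟩) ∧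
      LoopFree.IsCellDatum (Polynomial ℤ)
        (fun l S T => LoopFree.LFD.mk ⟨LoopFree.PHat.of (comp l S T).1, hmem (comp l S T)⟩)
        star :=
  ⟨fun d => LoopFree.LDiagram.of_mem_DTL d.1 d.2, LoopFree.comp, LoopFree.starMap n,
    LoopFree.comp_iff, LoopFree.starMap_cell, LoopFree.isCellDatum n⟩

theorem mainTheorem1 (n : ℕ) (hn : 4 ≤ n) :
    ∃ (hmem : ∀ d : LoopFree.TypeII n, LoopFree.PHat.of d.1 ∈ LoopFree.DTL n)
      (comp : ∀ l : LoopFree.Lam n, LoopFree.M l → LoopFree.M l → LoopFree.TypeII n)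
      (star : LoopFree.LFD n →ₗ[Polynomial ℤ] LoopFree.LFD n),
      (∀ l S T d, (d.upper = S.1 ∧ d.lower = T.1) ↔ d = comp l S T) ∧
      (∀ d, star (LoopFree.LFD.mk ⟨LoopFree.PHat.of d.1, hmem d⟩) =
        LoopFree.LFD.mk ⟨LoopFree.PHat.of d.flip.1, hmem d.flip⟩) ∧
      LoopFree.IsCellDatum (Polynomial ℤ)
        (fun l S T => LoopFree.LFD.mk ⟨LoopFree.PHat.of (comp l S T).1, hmem (comp l S T)⟩)
        star :=
  mainTheorem1_general n
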